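/- Let $1\le k\le n$ be integers, let $\mathcal O=\mathbf C\{x_1,\dots,x_n\}$ be the ring of convergent power series and let $\mathcal D=\mathcal O[\partial_1,\dots,\partial_n]$ be the ring of germs of linear differential operators with holomorphic coefficients. For $1\le i\le k$ and $\ell\in\mathbf Z$ let $V^{(i)}_\ell(\mathcal D)$ be the set of the operators $\sum_{\alpha,\beta} p_{\alpha\beta}x^\alpha\partial^\beta\in\mathcal D$ such that $\beta_i-\alpha_i\le \ell$ whenever $p_{\alpha\beta}\ne 0$, and for $s\in\mathbf Z^k$ put $V_s(\mathcal D)=\bigcap_{i=1}^k V^{(i)}_{s_i}(\mathcal D)$. Let $\mathcal M$ be a left $\mathcal D$-module with a good multifiltration $U_\bullet(\mathcal M)$, that is, there are $r\ge 0$, a surjective $\mathcal D$-linear map $\pi:\mathcal D^r\to\mathcal M$ and $n^{(1)},\dots,n^{(r)}\in\mathbf Z^k$ such that $U_s(\mathcal M)=\pi\bigl(\bigoplus_{j=1}^r V_{s-n^{(j)}}(\mathcal D)\bigr)$ for all $s\in\mathbf Z^k$. For a rational simplicial cone $\Gamma$ in the positive quadrant $(\mathbf Q^k)^*_+$ of $(\mathbf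 Q^k)^*=\mathrm{Hom}_{\mathbf Q}(\mathbf Q^k,\mathbf Q)$ (the linear forms with non-negative coefficients), let $\check\Gamma=\{a\in\mathbf Q^k : \gamma(a)\ge 0\ \forall\gamma\in\Gamma\}$, let $A_\Gamma=\mathbf C[\check\Gamma\cap\mathbf Z^k]$, let $\mathcal L(\Gamma)$ be the set of primitive integral generators of the one-dimensional faces of $\Gamma$, and put $$U^\Gamma_s(\mathcal M)=\sum_{\sigma\in\mathbf Z^k,\ L(\sigma)\le L(s)\ \forall L\in\mathcal L(\Gamma)}U_\sigma(\mathcal M),\qquad \mathcal R^\Gamma(\mathcal M)=\bigoplus_{s\in\mathbf Z^k}U^\Gamma_s(\mathcal M)\,u^s\subset\mathcal M[u_1^{\pm1},\dots,u_k^{\pm1}].$$ The group $\mathcal R^\Gamma(\mathcal M)$ is a module over $A_\Gamma\subset\mathbf C[u_1^{\pm1},\dots,u_k^{\pm1}]$. **Theorem.** There is a finite fan $\mathcal E$ of rational simplicial cones in $(\mathbf Q^k)^*$ whose support (the union of its cones) is the whole positive quadrant $(\mathbf Q^k)^*_+$ and such that, for each cone $\Gamma\in\mathcal E$, the Rees module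 $\mathcal R^\Gamma(\mathcal M)$ is flat over $A_\Gamma$. -/

import Mathlib

/-! ### Convergent power series and germs of differential operators -/

section DiffOp

open MvPowerSeries

lemma card_antidiagonal_le_two_pow {n : ℕ} (d : Fin n →₀ ℕ) :
    ((Finset.HasAntidiagonal.antidiagonal d).card : ℝ) ≤ 2 ^ d.degree := by
  have h1 : (Finset.HasAntidiagonal.antidiagonal d).card ≤ (Finset.Iic d).card := by
    refine Finset.card_le_card_of_injOn Prod.fst ?_ ?_
    · intro p hp
      have hp' : p.1 + p.2 = d := by simpa using hp
      simp only [Finset.coe_Iic, Set.mem_Iic]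
      rw [← hp']
      exact le_self_add
    · intro p hp q hq h
      have hp' : p.1 + p.2 = d := by simpa using hp
      have hq' : q.1 + q.2 = d := by simpa using hq
      refine Prod.ext h ?_
      have h' : p.1 = q.1 := h
      rw [← hq', h'] at hp'
      exact add_left_cancel hp'
  have h2 : (Finset.Iic d).card ≤ 2 ^ d.degree := by
    rw [Finsupp.card_Iic, Finsupp.degree_apply, ← Finset.prod_pow_eq_pow_sum]
    refine Finset.prod_le_prod' fun i _ => ?_
    rw [Nat.card_Iic]
    exact Nat.lt_two_pow_self
  exact_mod_cast h1.trans h2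

/-- `f` converges in a neighbourhood of the origin: its coefficients satisfy Cauchy estimates
`|f_α| ≤ C R^{|α|}`. -/
def IsConvergentSeries {n : ℕ} (f : MvPowerSeries (Fin n) ℂ) : Prop :=
  ∃ C R : ℝ, 0 ≤ C ∧ 0 ≤ R ∧ ∀ α : Fin n →₀ ℕ, ‖coeff α f‖ ≤ C * R ^ α.degree

/-- The ring `𝒪 = ℂ{x₁, …, xₙ}` of convergent power series. -/
def convergentSeries (n : ℕ) : Subalgebra ℂ (MvPowerSeries (Fin n) ℂ) where
  carrier := {f | IsConvergentSeries f}
  mul_mem' := by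
    classical
    rintro f g ⟨C, R, hC, hR, hf⟩ ⟨C', R', hC', hR', hg⟩
    refine ⟨C * C', 2 * max R R', by positivity, by positivity, fun α => ?_⟩
    rw [coeff_mul]
    have key : ∀ p ∈ Finset.HasAntidiagonal.antidiagonal α,
        ‖coeff p.1 f * coeff p.2 g‖ ≤ C * C' * max R R' ^ α.degree := by
      intro p hp
      have hp' : p.1 + p.2 = α := by simpa using hp
      rw [norm_mul, ← hp', map_add, pow_add]
      calc ‖coeff p.1 f‖ * ‖coeff p.2 g‖
          ≤ (C * R ^ p.1.degree) * (C' * R' ^ p.2.degree) :=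
            mul_le_mul (hf _) (hg _) (norm_nonneg _) (by positivity)
        _ ≤ (C * max R R' ^ p.1.degree) * (C' * max R R' ^ p.2.degree) := by
            gcongr
            · exact le_max_left _ _
            · exact le_max_right _ _
        _ = _ := by ring
    calc ‖∑ p ∈ Finset.HasAntidiagonal.antidiagonal α, coeff p.1 f * coeff p.2 g‖
        ≤ ∑ p ∈ Finset.HasAntidiagonal.antidiagonal α, ‖coeff p.1 f * coeff p.2 g‖ := norm_sum_le _ _
      _ ≤ ∑ _p ∈ Finset.HasAntidiagonal.antidiagonal α, C * C' * max R R' ^ α.degree := Finset.sum_le_sum key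
      _ = (Finset.HasAntidiagonal.antidiagonal α).card * (C * C' * max R R' ^ α.degree) := by
          rw [Finset.sum_const, nsmul_eq_mul]
      _ ≤ 2 ^ α.degree * (C * C' * max R R' ^ α.degree) := by
          gcongr
          exact card_antidiagonal_le_two_pow α
      _ = C * C' * (2 * max R R') ^ α.degree := by rw [mul_pow]; ring
  add_mem' := by
    rintro f g ⟨C, R, hC, hR, hf⟩ ⟨C', R', hC', hR', hg⟩
    refine ⟨C + C', max R R', by positivity, by positivity, fun α => ?_⟩
    rw [map_add]
    calc ‖coeff α f + coeff α g‖ ≤ C * R ^ α.degree + C' * R' ^ α.degree :=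
          (norm_add_le _ _).trans (add_le_add (hf α) (hg α))
      _ ≤ C * max R R' ^ α.degree + C' * max R R' ^ α.degree := by
          gcongr
          · exact le_max_left _ _
          · exact le_max_right _ _
      _ = _ := by ring
  algebraMap_mem' := by
    classical
    intro c
    refine ⟨‖c‖, 1, norm_nonneg _, zero_le_one, fun α => ?_⟩
    rw [MvPowerSeries.algebraMap_apply, coeff_C]
    split_ifs <;> simp

/-- The type of convergent power series in `n` variables. -/
def ConvSeries (n : ℕ) : Type := convergentSeries n

noncomputable instance (n : ℕ) : CommRing (ConvSeries n) :=
  inferInstanceAs (CommRing (convergentSeries n))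

noncomputable instance (n : ℕ) : Algebra ℂ (ConvSeries n) :=
  inferInstanceAs (Algebra ℂ (convergentSeries n))

/-- The inclusion of the convergent power series into the formal ones. -/
noncomputable def ConvSeries.toSeries (n : ℕ) : ConvSeries n →ₐ[ℂ] MvPowerSeries (Fin n) ℂ :=
  (convergentSeries n).val

lemma IsConvergentSeries.pderiv {n : ℕ} {f : MvPowerSeries (Fin n) ℂ}
    (hf : IsConvergentSeries f) (i : Fin n) :
    IsConvergentSeries (MvPowerSeries.pderiv ℂ i f) := by
  obtain ⟨C, R, hC, hR, hf⟩ := hf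
  refine ⟨C * R, 2 * R, by positivity, by positivity, fun α => ?_⟩
  rw [coeff_pderiv, norm_mul]
  have h1 : ‖((α i : ℂ) + 1)‖ ≤ 2 ^ α.degree := by
    have h2 : α i + 1 ≤ 2 ^ α.degree :=
      (Nat.lt_two_pow_self (n := α i)).trans_le
        (Nat.pow_le_pow_right two_pos (Finsupp.le_degree i α))
    have h3 : ((α i : ℂ) + 1) = ((α i + 1 : ℕ) : ℂ) := by push_cast; rfl
    rw [h3, Complex.norm_natCast]
    exact_mod_cast h2
  calc ‖coeff (α + Finsupp.single i 1) f‖ * ‖((α i : ℂ) + 1)‖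
      ≤ (C * R ^ (α + Finsupp.single i 1).degree) * 2 ^ α.degree :=
        mul_le_mul (hf _) h1 (norm_nonneg _) (by positivity)
    _ = C * R * (2 * R) ^ α.degree := by
        rw [map_add, Finsupp.degree_single, pow_succ, mul_pow]; ring

/-- The partial derivative `∂ᵢ`, as a `ℂ`-linear endomorphism of `𝒪`. -/
noncomputable def partialOp (n : ℕ) (i : Fin n) : Module.End ℂ (ConvSeries n) where
  toFun f := (⟨MvPowerSeries.pderiv ℂ i f.1, IsConvergentSeries.pderiv f.2 i⟩ :
    convergentSeries n)
  map_add' f g := Subtype.ext (map_add (MvPowerSeries.pderiv ℂ i) f.1 g.1)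
  map_smul' c f := Subtype.ext ((MvPowerSeries.pderiv ℂ i).map_smul c f.1)

/-- Multiplication by `a ∈ 𝒪`, as a `ℂ`-linear endomorphism of `𝒪`. -/
noncomputable def multOp (n : ℕ) (a : ConvSeries n) : Module.End ℂ (ConvSeries n) :=
  LinearMap.mulLeft ℂ a

/-- The ring `𝒟 = 𝒪[∂₁, …, ∂ₙ]` of germs of linear differential operators with holomorphic
coefficients: the algebra of operators on `𝒪` generated by the multiplications by elements
of `𝒪` and by the partial derivatives. -/
noncomputable def diffOpAlgebra (n : ℕ) : Subalgebra ℂ (Module.End ℂ (ConvSeries n)) :=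
  Algebra.adjoin ℂ (Set.range (multOp n) ∪ Set.range (partialOp n))

/-- The type of germs of differential operators. -/
def DiffOp (n : ℕ) : Type := diffOpAlgebra n

noncomputable instance (n : ℕ) : Ring (DiffOp n) :=
  inferInstanceAs (Ring (diffOpAlgebra n))

noncomputable instance (n : ℕ) : Algebra ℂ (DiffOp n) :=
  inferInstanceAs (Algebra ℂ (diffOpAlgebra n))

/-- The action of a differential operator on `𝒪`. -/
noncomputable def DiffOp.toEnd (n : ℕ) : DiffOp n →ₐ[ℂ] Module.End ℂ (ConvSeries n) :=
  (diffOpAlgebra n).val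

/-- The monomial operator `∂^β = ∂₁^{β₁} ⋯ ∂ₙ^{βₙ}`. -/
noncomputable def partialMonomial (n : ℕ) (β : Fin n →₀ ℕ) : Module.End ℂ (ConvSeries n) :=
  (List.ofFn fun i => partialOp n i ^ β i).prod

/-- The operator `∑_β p_β(x) ∂^β`. -/
noncomputable def ofCoeffs (n : ℕ) (p : (Fin n →₀ ℕ) →₀ ConvSeries n) :
    Module.End ℂ (ConvSeries n) :=
  p.sum fun β a => multOp n a * partialMonomial n β

lemma ofCoeffs_add (n : ℕ) (p q : (Fin n →₀ ℕ) →₀ ConvSeries n) :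
    ofCoeffs n (p + q) = ofCoeffs n p + ofCoeffs n q := by
  refine Finsupp.sum_add_index' (fun β => ?_) (fun β a b => ?_)
  · simp [multOp]
  · rw [← add_mul]
    congr 1
    ext x
    simp [multOp, add_mul]

lemma ofCoeffs_smul (n : ℕ) (c : ℂ) (p : (Fin n →₀ ℕ) →₀ ConvSeries n) :
    ofCoeffs n (c • p) = c • ofCoeffs n p := by
  unfold ofCoeffs
  rw [Finsupp.sum_smul_index' (fun β => by simp [multOp]), Finsupp.smul_sum]
  refine Finsupp.sum_congr fun β _ => ?_
  rw [← smul_mul_assoc]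
  congr 1
  ext x
  simp [multOp]

/-- The `V`-filtration along `xᵢ = 0`: `V^{(i)}_ℓ(𝒟)` is the set of the operators
`∑ p_{αβ} x^α ∂^β` with `βᵢ - αᵢ ≤ ℓ` whenever `p_{αβ} ≠ 0`. -/
noncomputable def vFiltration (n : ℕ) (i : Fin n) (l : ℤ) : Submodule ℂ (DiffOp n) where
  carrier := {P | ∃ p : (Fin n →₀ ℕ) →₀ ConvSeries n,
    DiffOp.toEnd n P = ofCoeffs n p ∧
    ∀ α β : Fin n →₀ ℕ, coeff α (ConvSeries.toSeries n (p β)) ≠ 0 →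
      (β i : ℤ) - (α i : ℤ) ≤ l}
  add_mem' := by
    rintro P Q ⟨p, hP, hp⟩ ⟨q, hQ, hq⟩
    refine ⟨p + q, by rw [ofCoeffs_add, ← hP, ← hQ, map_add], fun α β h => ?_⟩
    by_cases h0 : coeff α (ConvSeries.toSeries n (p β)) = 0
    · refine hq α β fun h1 => h ?_
      simp [h0, h1]
    · exact hp α β h0
  zero_mem' := ⟨0, by simp [ofCoeffs], fun α β h => absurd (by simp) h⟩
  smul_mem' := by
    rintro c P ⟨p, hP, hp⟩
    refine ⟨c • p, by rw [ofCoeffs_smul, ← hP, map_smul], fun α β h => hp α β fun h1 => h ?_⟩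
    simp [h1]

/-- The multifiltration `V_s(𝒟) = ⋂_{i ≤ k} V^{(i)}_{s_i}(𝒟)`, for `s ∈ ℤᵏ`. -/
noncomputable def multiV {n k : ℕ} (hkn : k ≤ n) (s : Fin k → ℤ) : Submodule ℂ (DiffOp n) :=
  ⨅ i : Fin k, vFiltration n (Fin.castLE hkn i) (s i)

/-- The shifted multifiltration `V[n]_s(𝒟ʳ) = ⨁_j V_{s - n^{(j)}}(𝒟)` of the free module. -/
noncomputable def shiftedMultiV {n k r : ℕ} (hkn : k ≤ n) (shift : Fin r → Fin k → ℤ)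
    (s : Fin k → ℤ) : Submodule ℂ (Fin r → DiffOp n) :=
  Submodule.pi Set.univ fun j => multiV hkn (s - shift j)

end DiffOp

section Multifiltration

variable {n k : ℕ} {M : Type*} [AddCommGroup M] [Module (DiffOp n) M] [Module ℂ M]

/-- `U` is a good multifiltration of the left `𝒟`-module `M`: for some presentation
`π : 𝒟ʳ → M` (a surjective `𝒟`-linear map) and some shift multivector,
`U_s = π (V[n]_s(𝒟ʳ))` for all `s ∈ ℤᵏ`. -/
def IsGoodMultifiltration [IsScalarTower ℂ (DiffOp n) M] (hkn : k ≤ n)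
    (U : (Fin k → ℤ) → Submodule ℂ M) : Prop :=
  ∃ (r : ℕ) (π : (Fin r → DiffOp n) →ₗ[DiffOp n] M) (shift : Fin r → Fin k → ℤ),
    Function.Surjective π ∧
    ∀ s, U s = (shiftedMultiV hkn shift s).map (π.restrictScalars ℂ)

end Multifiltration

/-! ### Cones and fans in the dual of `ℚᵏ` -/

section Cones

/-- The dual space `(ℚᵏ)* = Hom_ℚ(ℚᵏ, ℚ)`. -/
abbrev DualSpace (k : ℕ) : Type := Module.Dual ℚ (Fin k → ℚ)

/-- The value `L(s)` of a linear form on a lattice point `s ∈ ℤᵏ`. -/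
def evalLattice {k : ℕ} (L : DualSpace k) (s : Fin k → ℤ) : ℚ :=
  L fun i => (s i : ℚ)

/-- The positive quadrant `(ℚᵏ)*₊`: the linear forms with non-negative coefficients. -/
def positiveQuadrant (k : ℕ) : Set (DualSpace k) :=
  {L | ∀ i, 0 ≤ L (Pi.single i 1)}

/-- `L` has integral coefficients. -/
def IsIntegralForm {k : ℕ} (L : DualSpace k) : Prop :=
  ∀ i, ∃ z : ℤ, L (Pi.single i 1) = z

/-- `L` is a primitive element of the lattice of integral forms. -/
def IsPrimitiveForm {k : ℕ} (L : DualSpace k) : Prop :=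
  L ≠ 0 ∧ IsIntegralForm L ∧
    ∀ (m : ℕ) (L' : DualSpace k), IsIntegralForm L' → L = m • L' → m = 1

/-- `𝓛(Γ)`: the primitive elements of the one-dimensional faces of `Γ`. -/
def primitiveGenerators {k : ℕ} (Γ : PointedCone ℚ (DualSpace k)) : Set (DualSpace k) :=
  {L | IsPrimitiveForm L ∧ (PointedCone.hull ℚ {L}).IsFaceOf Γ}

/-- A fan of (rational) simplicial cones: a finite non-empty set of simplicial cones containing
the faces of its members, any two of which meet along a common face. -/
structure IsSimplicialFan {k : ℕ} (E : Set (PointedCone ℚ (DualSpace k))) : Prop where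
  finite : E.Finite
  nonempty : E.Nonempty
  isSimplicial : ∀ Γ ∈ E, Γ.IsSimplicial
  face_mem : ∀ Γ ∈ E, ∀ τ : PointedCone ℚ (DualSpace k), τ.IsFaceOf Γ → τ ∈ E
  inf_isFaceOf : ∀ Γ ∈ E, ∀ Γ' ∈ E, (Γ ⊓ Γ').IsFaceOf Γ ∧ (Γ ⊓ Γ').IsFaceOf Γ'

/-- The support of a set of cones: the union of its members. -/
def fanSupport {k : ℕ} (E : Set (PointedCone ℚ (DualSpace k))) : Set (DualSpace k) :=
  ⋃ Γ ∈ E, (Γ : Set (DualSpace k))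

/-- The semigroup `Γ̌ ∩ ℤᵏ` of lattice points of the dual cone of `Γ`. -/
def dualLattice {k : ℕ} (Γ : PointedCone ℚ (DualSpace k)) : AddSubmonoid (Fin k → ℤ) where
  carrier := {a | ∀ L ∈ Γ, 0 ≤ evalLattice L a}
  zero_mem' := fun L _ => by
    have h : (fun i => (((0 : Fin k → ℤ) i : ℤ) : ℚ)) = 0 := by
      funext i
      simp
    change 0 ≤ L (fun i => (((0 : Fin k → ℤ) i : ℤ) : ℚ))
    rw [h, map_zero]
  add_mem' := fun {a b} ha hb L hL => by
    have h : evalLattice L (a + b) = evalLattice L a + evalLattice L b := by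
      unfold evalLattice
      rw [← map_add]
      congr 1
      funext i
      simp
    rw [h]
    exact add_nonneg (ha L hL) (hb L hL)

/-- The semigroup algebra `A_Γ = ℂ[Γ̌ ∩ ℤᵏ]`. -/
abbrev conicalAlgebra {k : ℕ} (Γ : PointedCone ℚ (DualSpace k)) : Type :=
  AddMonoidAlgebra ℂ (dualLattice Γ)

end Cones

/-! ### Laurent polynomials with coefficients in a module, and Rees modules -/

section Rees

variable {k : ℕ} {M : Type*} [AddCommGroup M] [Module ℂ M]

/-- `M[u₁^{±1}, …, u_k^{±1}]`: the finite sums `∑ m_s u^s` with `s ∈ ℤᵏ` and `m_s ∈ M`. -/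
def LaurentModule (k : ℕ) (M : Type*) [AddCommGroup M] : Type _ := (Fin k → ℤ) →₀ M

noncomputable instance : AddCommGroup (LaurentModule k M) :=
  inferInstanceAs (AddCommGroup ((Fin k → ℤ) →₀ M))

/-- The coefficient of `u^s`. -/
def LaurentModule.coeff (f : LaurentModule k M) (s : Fin k → ℤ) : M :=
  (show (Fin k → ℤ) →₀ M from f) s

/-- Multiplication by the Laurent monomials `u^a`, `a` in a semigroup `S ⊆ ℤᵏ`: it sends
`m u^s` to `m u^{a+s}`. -/
noncomputable def laurentShift (M : Type*) [AddCommGroup M] [Module ℂ M]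
    (S : AddSubmonoid (Fin k → ℤ)) :
    Multiplicative S →* Module.End ℂ ((Fin k → ℤ) →₀ M) where
  toFun a := Finsupp.lmapDomain M ℂ fun s => (a.toAdd : Fin k → ℤ) + s
  map_one' := by
    ext
    simp
  map_mul' a b := by
    ext s m : 2
    simp [Finsupp.lmapDomain_apply, Finsupp.mapDomain_single, add_assoc]

/-- The module structure of `M[u^{±1}]` over the semigroup algebra `ℂ[S]`, for which
`c u^a · m u^s = c m u^{a+s}`. -/
noncomputable instance (S : AddSubmonoid (Fin k → ℤ)) :
    Module (AddMonoidAlgebra ℂ S) (LaurentModule k M) :=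
  Module.compHom ((Fin k → ℤ) →₀ M)
    (AddMonoidAlgebra.lift ℂ (Module.End ℂ ((Fin k → ℤ) →₀ M)) S (laurentShift M S)).toRingHom

/-- The `Γ`-filtration `U^Γ_s = ∑_σ U_σ`, the sum over the `σ ∈ ℤᵏ` with `L(σ) ≤ L(s)` for
all `L ∈ 𝓛(Γ)`. -/
def coneFiltration (U : (Fin k → ℤ) → Submodule ℂ M) (Γ : PointedCone ℚ (DualSpace k))
    (s : Fin k → ℤ) : Submodule ℂ M :=
  ⨆ σ ∈ {σ : Fin k → ℤ | ∀ L ∈ primitiveGenerators Γ, evalLattice L σ ≤ evalLattice L s}, U σ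

lemma coneFiltration_mono (U : (Fin k → ℤ) → Submodule ℂ M)
    (Γ : PointedCone ℚ (DualSpace k)) {a : Fin k → ℤ} (ha : a ∈ dualLattice Γ)
    (s : Fin k → ℤ) : coneFiltration U Γ s ≤ coneFiltration U Γ (a + s) := by
  refine biSup_mono fun σ hσ L hL => (hσ L hL).trans ?_
  have h : evalLattice L (a + s) = evalLattice L a + evalLattice L s := by
    unfold evalLattice
    rw [← map_add]
    congr 1
    funext i
    simp
  have h0 : 0 ≤ evalLattice L a :=
    ha L (hL.2.le (Submodule.subset_span rfl))
  rw [h]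
  linarith

lemma LaurentModule.smul_single_coeff (S : AddSubmonoid (Fin k → ℤ)) (a : S) (c : ℂ)
    (f : LaurentModule k M) (s : Fin k → ℤ) :
    ((AddMonoidAlgebra.single a c : AddMonoidAlgebra ℂ S) • f).coeff ((a : Fin k → ℤ) + s) =
      c • f.coeff s := by
  have h : (AddMonoidAlgebra.single a c : AddMonoidAlgebra ℂ S) • f =
      c • (Finsupp.mapDomain (fun s => (a : Fin k → ℤ) + s)
        (show (Fin k → ℤ) →₀ M from f)) := by
    change (AddMonoidAlgebra.lift ℂ _ S (laurentShift M S) (AddMonoidAlgebra.single a c))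
      (show (Fin k → ℤ) →₀ M from f) = _
    rw [AddMonoidAlgebra.lift_single]
    rfl
  rw [h]
  change c • (Finsupp.mapDomain (fun s => (a : Fin k → ℤ) + s) _ : (Fin k → ℤ) →₀ M) _ = _
  rw [Finsupp.mapDomain_apply (add_right_injective _)]
  rfl

/-- The Rees module `𝓡^Γ(M) = ⨁_s U^Γ_s u^s ⊆ M[u^{±1}]`, as an `A_Γ`-module. -/
noncomputable def reesModule (U : (Fin k → ℤ) → Submodule ℂ M)
    (Γ : PointedCone ℚ (DualSpace k)) :
    Submodule (conicalAlgebra Γ) (LaurentModule k M) where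
  carrier := {f | ∀ s, f.coeff s ∈ coneFiltration U Γ s}
  add_mem' hf hg s := add_mem (hf s) (hg s)
  zero_mem' s := zero_mem _
  smul_mem' := by
    intro p f hf
    induction p using AddMonoidAlgebra.induction_linear with
    | zero => rw [zero_smul]; exact fun s => zero_mem _
    | add p q hp hq => rw [add_smul]; exact fun s => add_mem (hp s) (hq s)
    | single a c =>
      intro s
      have h := LaurentModule.smul_single_coeff (dualLattice Γ) a c f (-(a : Fin k → ℤ) + s)
      have h' := coneFiltration_mono U Γ a.2 (-(a : Fin k → ℤ) + s)
      rw [add_neg_cancel_left] at h h'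
      rw [h]
      exact Submodule.smul_mem _ _ (h' (hf _))

end Rees

/-!
Let `π : 𝒟ʳ → M` be the presentation defining the multifiltration, and `I` its kernel. The proof
reduces flatness to the existence of normal forms modulo `I` adapted to a cone, and finds a fan for
all of whose cones these exist.

*Flatness from normal forms.* For a cone `Γ`, the semigroup `S = Γ̌ ∩ ℤᵏ` defines a filtration of
`𝒟ʳ` by sets of monomials `x^α ∂^β e_j`. Suppose that the operators of order at most `d` have
unique normal forms modulo `I`, characterized by the absence of the monomials of a set `Δ`, and that
an operator and its normal form lie in the same steps of this filtration (`HasNormalForms`). By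
Dickson's lemma, the remaining monomials fall into finitely many classes, which are not separated by
the finitely many steps under consideration and have each a monomial of largest order
(`exists_exponent_classes`). Splitting normal forms according to these classes gives, for any finite
family of homogeneous elements of the Rees module, elements of `M` that are linearly independent
over `ℂ`, belong to the multifiltration, and express the family (`exists_adapted_of_hasNormalForms`).
They generate a free submodule of the Rees module, so that every relation between elements of the
latter is trivial and the Rees module is flat (`flat_reesModule_of_adapted`).

*Normal forms by division.* If finitely many elements of `I` have leading monomials for a linear
weight, vectors of convergent power series can be divided by them. The division is the inversion of
`1 + K` for an operator `K` that becomes small in weighted `ℓ¹` norms `∑ ‖c_α‖ t^{w · α}` as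
`t → 0`, hence a Neumann series (`exists_division`).

*Finding the fan.* The complexes of cones cut by the hyperplanes of finitely many lattice points
are obtained by stellar subdivisions of the quadrant (`exists_cut_finset`). If each of them had a
cone without normal forms, an ultrafilter finer than the inclusion of finite sets of lattice points
would make the duals of these cones converge to a semigroup `S` with `S ∪ -S = ℤᵏ`, that is, to a
total preorder on `ℤᵏ`. Refined by a generic weight, it gives every operator a largest monomial, and
by Dickson's lemma finitely many elements of `I` account for all largest monomials of `I`
(`exists_finite_topExponents`). Only finitely many comparisons of lattice points are needed to
recognize these largest monomials, so that they are also leading monomials for almost all cones of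
the family, and division gives normal forms for those cones: a contradiction
(`exists_hasNormalForms`, `exists_complex_hasNormalForms`).
-/

/-! ### Complexes of simplicial cones and their subdivisions -/

section ConeComplexes

/-- A finite family `K` of finite sets of vectors, closed under subsets, such that a non-negative
combination of the vectors of a member of `K` is determined, coefficients included, by its value.
The cones generated by the members of `K` are then the cones of a simplicial fan. -/
structure IsConeComplex {V : Type*} [AddCommGroup V] [Module ℚ V] (K : Set (Finset V)) :
    Prop where
  finite : K.Finite
  empty_mem : ∅ ∈ K
  subset_mem : ∀ σ ∈ K, ∀ τ ⊆ σ, τ ∈ K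
  eq_of_eval_eq : ∀ c d : V →₀ ℚ, (∀ v, 0 ≤ c v) → (∀ v, 0 ≤ d v) → c.support ∈ K →
    d.support ∈ K → Finsupp.linearCombination ℚ id c = Finsupp.linearCombination ℚ id d → c = d

variable {V : Type*} [AddCommGroup V] [Module ℚ V]

/-- The union of the cones generated by the members of `K`. -/
def complexSupport (K : Set (Finset V)) : Set V :=
  {x | ∃ c : V →₀ ℚ, (∀ v, 0 ≤ c v) ∧ c.support ∈ K ∧ Finsupp.linearCombination ℚ id c = x}

/-- Each cone of `K` lies on one side of the hyperplane `f = 0`. -/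
def IsCutBy (K : Set (Finset V)) (f : V →ₗ[ℚ] ℚ) : Prop :=
  ∀ σ ∈ K, (∀ v ∈ σ, 0 ≤ f v) ∨ (∀ v ∈ σ, f v ≤ 0)

open Classical in
/-- The stellar subdivision of `K` at a point `w` of the cone generated by `{a, b}`. -/
def stellarSubdivision (K : Set (Finset V)) (a b w : V) : Set (Finset V) :=
  {τ | τ ∈ K ∧ ¬(a ∈ τ ∧ b ∈ τ)} ∪
    {σ | ∃ τ ∈ K, ¬(a ∈ τ ∧ b ∈ τ) ∧ insert a (insert b τ) ∈ K ∧ σ = insert w τ}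

lemma PointedCone.mem_hull_finset {σ : Finset V} {x : V} :
    x ∈ PointedCone.hull ℚ (σ : Set V) ↔ ∃ c : V →₀ ℚ, (∀ v, 0 ≤ c v) ∧ c.support ⊆ σ ∧
      Finsupp.linearCombination ℚ id c = x := by
  rw [PointedCone.mem_hull_set]
  constructor
  · rintro ⟨c, h1, h2, h3⟩
    exact ⟨c, h2, by exact_mod_cast h1, by simpa [Finsupp.linearCombination_apply] using h3⟩
  · rintro ⟨c, h1, h2, h3⟩
    exact ⟨c, by exact_mod_cast h2, h1, by simpa [Finsupp.linearCombination_apply] using h3⟩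

section Stellar

variable {K : Set (Finset V)} {a b : V} {p q : ℚ}

open Classical in
/-- The point `p a + q b` of an edge has two sets of coefficients if it is itself a vertex. -/
lemma IsConeComplex.notMem_of_edge (hK : IsConeComplex K) (hab : a ≠ b)
    (hE : ({a, b} : Finset V) ∈ K) (hp : 0 < p) (hq : 0 < q) {σ : Finset V} (hσ : σ ∈ K) :
    p • a + q • b ∉ σ := by
  intro hw
  set w := p • a + q • b with hwdef
  have h1 := hK.eq_of_eval_eq (Finsupp.single w 1) (Finsupp.single a p + Finsupp.single b q)
    (fun v => by rw [Finsupp.single_apply]; split_ifs <;> norm_num)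
    (fun v => by
      rw [Finsupp.add_apply, Finsupp.single_apply, Finsupp.single_apply]
      split_ifs <;> linarith)
    (hK.subset_mem _ hσ _ (Finsupp.support_single_subset.trans (by simpa using hw)))
    (hK.subset_mem _ hE _ (Finsupp.support_add.trans (Finset.union_subset
      (Finsupp.support_single_subset.trans (by simp))
      (Finsupp.support_single_subset.trans (by simp)))))
    (by simp [hwdef])
  have ha := DFunLike.congr_fun h1 a
  have hb := DFunLike.congr_fun h1 b
  simp only [Finsupp.single_apply, Finsupp.add_apply, if_true, hab, hab.symm, if_false] at ha hb
  split_ifs at ha hb with h2 h3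
  · exact hab (h2.symm.trans h3)
  all_goals linarith

/-- The coefficients on `K` of the vector with coefficients `d` on a stellar subdivision. -/
noncomputable def stellarPush (a b : V) (p q : ℚ) (w : V) (d : V →₀ ℚ) : V →₀ ℚ :=
  d.erase w + d w • (Finsupp.single a p + Finsupp.single b q)

open Classical in
lemma eval_stellarPush (d : V →₀ ℚ) :
    Finsupp.linearCombination ℚ id (stellarPush a b p q (p • a + q • b) d) =
      Finsupp.linearCombination ℚ id d := by
  have h : d = d.erase (p • a + q • b) + Finsupp.single (p • a + q • b) (d (p • a + q • b)) := by
    rw [add_comm, Finsupp.single_add_erase]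
  conv_rhs => rw [h]
  simp only [stellarPush, map_add, map_smul, Finsupp.linearCombination_single, id_eq]

omit [AddCommGroup V] [Module ℚ V] in
open Classical in
lemma stellarPush_nonneg (hp : 0 < p) (hq : 0 < q) {d : V →₀ ℚ} (hd : ∀ v, 0 ≤ d v) {w : V} (v : V) :
    0 ≤ stellarPush a b p q w d v := by
  simp only [stellarPush, Finsupp.add_apply, Finsupp.smul_apply, smul_eq_mul,
    Finsupp.single_apply, Finsupp.erase_apply]
  have := hd w
  have := hd v
  have : 0 ≤ (if a = v then p else 0) + (if b = v then q else 0) := by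
    split_ifs <;> linarith
  have := mul_nonneg (hd w) this
  split_ifs at * <;> linarith

open Classical in
lemma stellarPush_support (hK : IsConeComplex K) (hab : a ≠ b)
    (hE : ({a, b} : Finset V) ∈ K) (hp : 0 < p) (hq : 0 < q) {d : V →₀ ℚ}
    (hd : d.support ∈ stellarSubdivision K a b (p • a + q • b)) :
    (stellarPush a b p q (p • a + q • b) d).support ∈ K := by
  set w := p • a + q • b with hw
  rcases hd with ⟨h1, -⟩ | ⟨τ, hτ, -, h2, h3⟩
  · have h0 : d w = 0 := by
      rw [← Finsupp.notMem_support_iff]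
      exact hK.notMem_of_edge hab hE hp hq h1
    have : stellarPush a b p q w d = d := by
      ext v
      by_cases hv : v = w
      · subst hv; simp [stellarPush, h0]
      · simp [stellarPush, h0]
    rwa [this]
  · refine hK.subset_mem _ h2 _ fun v hv => ?_
    by_contra hcon
    simp only [Finset.mem_insert, not_or] at hcon
    rw [Finsupp.mem_support_iff] at hv
    apply hv
    simp only [stellarPush, Finsupp.add_apply, Finsupp.smul_apply, smul_eq_mul,
      Finsupp.single_apply, Ne.symm hcon.1, Ne.symm hcon.2.1, if_false, add_zero, mul_zero]
    rw [Finsupp.erase_apply]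
    split_ifs with h
    · rfl
    · rw [← Finsupp.notMem_support_iff, h3]
      simp [h, hcon.2.2]

open Classical in
lemma not_both_of_stellar (hab : a ≠ b) (hp : 0 < p) (hq : 0 < q)
    (hE : ({a, b} : Finset V) ∈ K) (hK : IsConeComplex K)
    {σ : Finset V} (hσ : σ ∈ stellarSubdivision K a b (p • a + q • b)) :
    ¬(a ∈ σ ∧ b ∈ σ) := by
  rcases hσ with ⟨-, h⟩ | ⟨τ, -, h, h2, rfl⟩
  · exact h
  · have hw := hK.notMem_of_edge hab hE hp hq h2
    simp only [Finset.mem_insert, not_or] at hw ⊢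
    rintro ⟨h3, h4⟩
    exact h ⟨h3.resolve_left (Ne.symm hw.1), h4.resolve_left (Ne.symm hw.2.1)⟩

omit [AddCommGroup V] [Module ℚ V] in
open Classical in
lemma stellarPush_apply_of_ne (hab : a ≠ b) {w : V} (ha : a ≠ w) (hb : b ≠ w) (d : V →₀ ℚ) :
    stellarPush a b p q w d a = d a + d w * p ∧ stellarPush a b p q w d b = d b + d w * q ∧
      ∀ v, v ≠ a → v ≠ b → v ≠ w → stellarPush a b p q w d v = d v := by
  refine ⟨?_, ?_, fun v h1 h2 h3 => ?_⟩
  · simp [stellarPush, ha, hab.symm]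
  · simp [stellarPush, hb, hab]
  · simp [stellarPush, h3, h1.symm, h2.symm]

open Classical in
/-- A stellar subdivision of a cone complex is a cone complex: the coefficient of the new vertex
is recovered from the old coefficients as the smallest of two ratios. -/
lemma IsConeComplex.stellar (hK : IsConeComplex K) (hab : a ≠ b)
    (hE : ({a, b} : Finset V) ∈ K) (hp : 0 < p) (hq : 0 < q) :
    IsConeComplex (stellarSubdivision K a b (p • a + q • b)) := by
  set w := p • a + q • b with hw
  have hwa : a ≠ w := fun h =>
    hK.notMem_of_edge hab hE hp hq hE (by rw [← hw, ← h]; simp)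
  have hwb : b ≠ w := fun h =>
    hK.notMem_of_edge hab hE hp hq hE (by rw [← hw, ← h]; simp)
  refine ⟨?_, ?_, ?_, ?_⟩
  · refine (hK.finite.subset fun τ h => h.1).union ((hK.finite.image (insert w)).subset ?_)
    rintro _ ⟨τ, hτ, -, -, rfl⟩
    exact ⟨τ, hτ, rfl⟩
  · exact Or.inl ⟨hK.empty_mem, by simp⟩
  · rintro σ (⟨h1, h2⟩ | ⟨τ, h1, h2, h3, rfl⟩) ρ hρ
    · exact Or.inl ⟨hK.subset_mem _ h1 _ hρ, fun h => h2 ⟨hρ h.1, hρ h.2⟩⟩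
    · have h4 : ρ.erase w ⊆ τ := by
        intro v hv
        rw [Finset.mem_erase] at hv
        exact (Finset.mem_insert.1 (hρ hv.2)).resolve_left hv.1
      have h5 : ρ.erase w ∈ K := hK.subset_mem _ h1 _ h4
      have h6 : ¬(a ∈ ρ.erase w ∧ b ∈ ρ.erase w) := fun h => h2 ⟨h4 h.1, h4 h.2⟩
      by_cases hwρ : w ∈ ρ
      · refine Or.inr ⟨ρ.erase w, h5, h6, hK.subset_mem _ h3 _ ?_, (Finset.insert_erase hwρ).symm⟩
        exact Finset.insert_subset_insert _ (Finset.insert_subset_insert _ h4)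
      · rw [Finset.erase_eq_of_notMem hwρ] at h5 h6
        exact Or.inl ⟨h5, h6⟩
  · -- the coefficient of `w` is forced, since `a` and `b` cannot both carry positive coefficients
    have key : ∀ c d : V →₀ ℚ, (∀ v, 0 ≤ d v) →
        c.support ∈ stellarSubdivision K a b w →
        stellarPush a b p q w c = stellarPush a b p q w d → d w ≤ c w := by
      intro c d hd hcs h
      by_contra! hlt
      obtain ⟨h1, h2, -⟩ := stellarPush_apply_of_ne (p := p) (q := q) hab hwa hwb c
      obtain ⟨h3, h4, -⟩ := stellarPush_apply_of_ne (p := p) (q := q) hab hwa hwb d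
      rw [h] at h1 h2
      refine not_both_of_stellar hab hp hq hE hK hcs ⟨?_, ?_⟩ <;> rw [Finsupp.mem_support_iff]
      · have := hd a
        nlinarith
      · have := hd b
        nlinarith
    intro c d hc hd hcs hds h
    have hpush : stellarPush a b p q w c = stellarPush a b p q w d :=
      hK.eq_of_eval_eq _ _ (stellarPush_nonneg hp hq hc) (stellarPush_nonneg hp hq hd)
        (stellarPush_support hK hab hE hp hq hcs) (stellarPush_support hK hab hE hp hq hds)
        (by rw [eval_stellarPush, eval_stellarPush, h])
    have hwe : c w = d w := le_antisymm (key d c hc hds hpush.symm) (key c d hd hcs hpush)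
    obtain ⟨h1, h2, h5⟩ := stellarPush_apply_of_ne (p := p) (q := q) hab hwa hwb c
    obtain ⟨h3, h4, h6⟩ := stellarPush_apply_of_ne (p := p) (q := q) hab hwa hwb d
    rw [hpush] at h1 h2
    ext v
    by_cases hva : v = a
    · subst hva; rw [hwe] at h1; linarith
    by_cases hvb : v = b
    · subst hvb; rw [hwe] at h2; linarith
    by_cases hvw : v = w
    · rw [hvw, hwe]
    rw [← h5 v hva hvb hvw, ← h6 v hva hvb hvw, hpush]

open Classical in
lemma complexSupport_stellar (hK : IsConeComplex K) (hab : a ≠ b)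
    (hE : ({a, b} : Finset V) ∈ K) (hp : 0 < p) (hq : 0 < q) :
    complexSupport (stellarSubdivision K a b (p • a + q • b)) = complexSupport K := by
  set w := p • a + q • b with hw
  ext x
  constructor
  · rintro ⟨d, hd, hds, rfl⟩
    exact ⟨_, stellarPush_nonneg hp hq hd, stellarPush_support hK hab hE hp hq hds,
      eval_stellarPush d⟩
  · rintro ⟨c, hc, hcs, rfl⟩
    by_cases hboth : a ∈ c.support ∧ b ∈ c.support
    swap
    · exact ⟨c, hc, Or.inl ⟨hcs, hboth⟩, rfl⟩
    have hwc := hK.notMem_of_edge hab hE hp hq hcs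
    rw [← hw] at hwc
    have hwa : w ≠ a := fun h => hwc (h ▸ hboth.1)
    have hwb : w ≠ b := fun h => hwc (h ▸ hboth.2)
    have ha0 : 0 < c a := lt_of_le_of_ne (hc a) (Ne.symm (Finsupp.mem_support_iff.1 hboth.1))
    have hb0 : 0 < c b := lt_of_le_of_ne (hc b) (Ne.symm (Finsupp.mem_support_iff.1 hboth.2))
    -- the largest multiple of `w` that can be removed without a negative coefficient
    set t := min (c a / p) (c b / q) with ht
    have htpos : 0 < t := lt_min (by positivity) (by positivity)
    have hta : p * t ≤ c a := by
      have := min_le_left (c a / p) (c b / q)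
      rw [← ht, le_div_iff₀ hp] at this
      linarith
    have htb : q * t ≤ c b := by
      have := min_le_right (c a / p) (c b / q)
      rw [← ht, le_div_iff₀ hq] at this
      linarith
    set e : V →₀ ℚ := c - t • (Finsupp.single a p + Finsupp.single b q) with he
    have hea : e a = c a - p * t := by
      simp [he, hab.symm, mul_comm]
    have heb : e b = c b - q * t := by
      simp [he, hab, mul_comm]
    have hev : ∀ v, v ≠ a → v ≠ b → e v = c v := fun v h1 h2 => by
      simp [he, h1.symm, h2.symm]
    have hew : e w = 0 := by
      rw [hev w hwa hwb, ← Finsupp.notMem_support_iff]; exact hwc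
    have hes : e.support ⊆ c.support := by
      intro v hv
      by_cases h1 : v = a
      · exact h1 ▸ hboth.1
      by_cases h2 : v = b
      · exact h2 ▸ hboth.2
      rwa [Finsupp.mem_support_iff, hev v h1 h2, ← Finsupp.mem_support_iff] at hv
    have hnot : ¬(a ∈ e.support ∧ b ∈ e.support) := by
      rw [Finsupp.mem_support_iff, Finsupp.mem_support_iff, hea, heb]
      rintro ⟨h1, h2⟩
      rcases min_choice (c a / p) (c b / q) with h | h
      · rw [← ht] at h
        apply h1; rw [h]; field_simp; ring
      · rw [← ht] at h
        apply h2; rw [h]; field_simp; ring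
    have he0 : ∀ v, 0 ≤ e v := by
      intro v
      by_cases h1 : v = a
      · rw [h1, hea]; linarith
      by_cases h2 : v = b
      · rw [h2, heb]; linarith
      rw [hev v h1 h2]; exact hc v
    refine ⟨e + Finsupp.single w t, fun v => ?_, Or.inr ⟨e.support, hK.subset_mem _ hcs _ hes, hnot,
      hK.subset_mem _ hcs _ ?_, ?_⟩, ?_⟩
    · rw [Finsupp.add_apply, Finsupp.single_apply]
      have := he0 v
      split_ifs <;> linarith
    · exact Finset.insert_subset hboth.1 (Finset.insert_subset hboth.2 hes)
    · ext v
      rw [Finset.mem_insert, Finsupp.mem_support_iff, Finsupp.mem_support_iff, Finsupp.add_apply,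
        Finsupp.single_apply]
      by_cases h : w = v
      · subst h; simp [hew, htpos.ne']
      · simp [h, Ne.symm h]
    · simp only [he, hw, map_add, map_sub, map_smul, Finsupp.linearCombination_single, id_eq]
      module

lemma IsCutBy.stellar {f : V →ₗ[ℚ] ℚ} (hf : IsCutBy K f) (hp : 0 < p) (hq : 0 < q) :
    IsCutBy (stellarSubdivision K a b (p • a + q • b)) f := by
  classical
  rintro σ (⟨h, -⟩ | ⟨τ, -, -, h, rfl⟩)
  · exact hf σ h
  · rcases hf _ h with h | h
    · left
      intro v hv
      rcases Finset.mem_insert.1 hv with rfl | hv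
      · have h1 := h a (by simp)
        have h2 := h b (by simp)
        simp only [map_add, map_smul, smul_eq_mul]
        positivity
      · exact h v (by simp [hv])
    · right
      intro v hv
      rcases Finset.mem_insert.1 hv with rfl | hv
      · have h1 := h a (by simp)
        have h2 := h b (by simp)
        simp only [map_add, map_smul, smul_eq_mul]
        nlinarith
      · exact h v (by simp [hv])

end Stellar

open Classical in
/-- The edges of `K` crossing the hyperplane `f = 0`. -/
def crossingEdges (K : Set (Finset V)) (f : V →ₗ[ℚ] ℚ) : Set (V × V) :=
  {e | ({e.1, e.2} : Finset V) ∈ K ∧ 0 < f e.1 ∧ f e.2 < 0}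

open Classical in
lemma crossingEdges_finite {K : Set (Finset V)} (hK : IsConeComplex K) (f : V →ₗ[ℚ] ℚ) :
    (crossingEdges K f).Finite := by
  refine (hK.finite.biUnion (t := fun σ => (↑(σ ×ˢ σ) : Set (V × V)))
    fun σ _ => Finset.finite_toSet _).subset ?_
  rintro ⟨a, b⟩ ⟨h, -, -⟩
  simp only [Set.mem_iUnion]
  exact ⟨_, h, by simp⟩

open Classical in
/-- Subdividing the crossing edges one after the other at their points on the hyperplane `f = 0`
cuts all the cones of the complex along that hyperplane. -/
lemma exists_cut {K : Set (Finset V)} (hK : IsConeComplex K) (f : V →ₗ[ℚ] ℚ) :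
    ∃ K' : Set (Finset V), IsConeComplex K' ∧ complexSupport K' = complexSupport K ∧
      IsCutBy K' f ∧ ∀ g : V →ₗ[ℚ] ℚ, IsCutBy K g → IsCutBy K' g := by
  induction hN : (crossingEdges K f).ncard using Nat.strong_induction_on generalizing K with
  | _ N ih =>
  by_cases hne : (crossingEdges K f).Nonempty
  · obtain ⟨⟨a, b⟩, hE, ha, hb⟩ := hne
    simp only at hE ha hb
    have hab : a ≠ b := by rintro rfl; linarith
    have hp : 0 < -f b := by linarith
    set w := (-f b) • a + f a • b with hw
    have hfw : f w = 0 := by simp [hw]; ring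
    have hsub : crossingEdges (stellarSubdivision K a b w) f ⊂ crossingEdges K f := by
      refine Set.ssubset_iff_exists.2 ⟨?_, (a, b), ⟨hE, ha, hb⟩, ?_⟩
      · rintro ⟨x, y⟩ ⟨h, hx, hy⟩
        refine ⟨?_, hx, hy⟩
        rcases h with ⟨h, -⟩ | ⟨τ, -, -, -, h⟩
        · exact h
        · have : w ∈ ({x, y} : Finset V) := by rw [h]; simp
          simp only [Finset.mem_insert, Finset.mem_singleton] at this
          rcases this with h | h <;> subst h <;> simp only [hfw] at hx hy <;> linarith
      · rintro ⟨h, -, -⟩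
        exact not_both_of_stellar hab hp ha hE hK h (by simp)
    obtain ⟨K', h1, h2, h3, h4⟩ := ih _
      (hN ▸ Set.ncard_lt_ncard hsub (crossingEdges_finite hK f)) (hK.stellar hab hE hp ha) rfl
    exact ⟨K', h1, h2.trans (complexSupport_stellar hK hab hE hp ha), h3,
      fun g hg => h4 g (hg.stellar hp ha)⟩
  · refine ⟨K, hK, rfl, fun σ hσ => ?_, fun g hg => hg⟩
    by_contra! hcon
    obtain ⟨⟨b, hb, hfb⟩, a, ha, hfa⟩ := hcon
    refine hne ⟨(a, b), hK.subset_mem _ hσ _ ?_, hfa, hfb⟩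
    simp [Finset.insert_subset_iff, ha, hb]

lemma exists_cut_finset {K : Set (Finset V)} (hK : IsConeComplex K) {ι : Type*} (s : Finset ι)
    (f : ι → V →ₗ[ℚ] ℚ) :
    ∃ K' : Set (Finset V), IsConeComplex K' ∧ complexSupport K' = complexSupport K ∧
      ∀ i ∈ s, IsCutBy K' (f i) := by
  classical
  induction s using Finset.induction_on with
  | empty => exact ⟨K, hK, rfl, by simp⟩
  | insert i s _ ih =>
    obtain ⟨K', h1, h2, h3⟩ := ih
    obtain ⟨K'', h4, h5, h6, h7⟩ := exists_cut h1 (f i)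
    refine ⟨K'', h4, h5.trans h2, fun j hj => ?_⟩
    rcases Finset.mem_insert.1 hj with rfl | hj
    · exact h6
    · exact h7 _ (h3 j hj)

end ConeComplexes

/-! ### The fan of a complex of simplicial cones -/

section Fans

section Faces

variable {V : Type*} [AddCommGroup V] [Module ℚ V]

/-- In a linear relation, the positive and the negative part have the same value. -/
lemma IsConeComplex.linearIndepOn {K : Set (Finset V)} (hK : IsConeComplex K) {σ : Finset V}
    (hσ : σ ∈ K) : LinearIndepOn ℚ id (σ : Set V) := by
  classical
  rw [linearIndepOn_iff]
  intro l hl h0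
  rw [Finsupp.mem_supported] at hl
  have hsub : ∀ g : V →₀ ℚ, (∀ v, l v = 0 → g v = 0) → g.support ∈ K := fun g hg =>
    hK.subset_mem _ hσ _ fun v hv => by
      have : v ∈ (l.support : Set V) := by
        simp only [Finset.mem_coe, Finsupp.mem_support_iff] at hv ⊢
        exact fun h => hv (hg v h)
      exact_mod_cast hl this
  have h := hK.eq_of_eval_eq (l.mapRange (fun x => max x 0) (by simp))
    (l.mapRange (fun x => max (-x) 0) (by simp)) (fun v => by simp) (fun v => by simp)
    (hsub _ fun v hv => by simp [hv]) (hsub _ fun v hv => by simp [hv]) ?_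
  · ext v
    have hv := DFunLike.congr_fun h v
    simp only [Finsupp.mapRange_apply] at hv
    rcases le_total (l v) 0 with h1 | h1
    · rw [max_eq_right h1, max_eq_left (by linarith)] at hv
      simpa using hv.symm
    · rw [max_eq_left h1, max_eq_right (by linarith)] at hv
      simpa using hv
  · rw [← sub_eq_zero, ← map_sub, ← h0]
    congr 1
    ext v
    simp only [Finsupp.sub_apply, Finsupp.mapRange_apply]
    rcases le_total (l v) 0 with h1 | h1
    · rw [max_eq_right h1, max_eq_left (by linarith)]; ring
    · rw [max_eq_left h1, max_eq_right (by linarith)]; ring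

lemma eq_of_linearIndepOn_finset {σ : Finset V} (hσ : LinearIndepOn ℚ id (σ : Set V))
    {c d : V →₀ ℚ} (hc : c.support ⊆ σ) (hd : d.support ⊆ σ)
    (h : Finsupp.linearCombination ℚ id c = Finsupp.linearCombination ℚ id d) : c = d :=
  linearIndepOn_iffₛ.1 hσ c (by rw [Finsupp.mem_supported]; exact_mod_cast hc) d
    (by rw [Finsupp.mem_supported]; exact_mod_cast hd) h

lemma hull_isFaceOf_hull {σ τ : Finset V} (hσ : LinearIndepOn ℚ id (σ : Set V)) (hτ : τ ⊆ σ) :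
    (PointedCone.hull ℚ (τ : Set V)).IsFaceOf (PointedCone.hull ℚ (σ : Set V)) := by
  classical
  refine ⟨Submodule.span_mono (by exact_mod_cast hτ), ?_⟩
  intro x y a hx hy ha hxy
  rw [PointedCone.mem_hull_finset] at hx hy hxy ⊢
  obtain ⟨c, hc0, hcs, rfl⟩ := hx
  obtain ⟨d, hd0, hds, rfl⟩ := hy
  obtain ⟨e, he0, hes, he⟩ := hxy
  have h : e = a • c + d := by
    refine eq_of_linearIndepOn_finset hσ (hes.trans hτ) (Finsupp.support_add.trans ?_)
      (by rw [he]; simp)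
    exact Finset.union_subset (Finsupp.support_smul.trans hcs) hds
  refine ⟨c, hc0, fun v hv => ?_, rfl⟩
  by_contra hvt
  have h1 : e v = 0 := by
    rw [← Finsupp.notMem_support_iff]
    exact fun h => hvt (hes h)
  rw [h, Finsupp.add_apply, Finsupp.smul_apply, smul_eq_mul] at h1
  have h2 : 0 < c v := lt_of_le_of_ne (hc0 v) (Ne.symm (Finsupp.mem_support_iff.1 hv))
  have h3 := hd0 v
  have h4 := mul_pos ha h2
  linarith

open Classical in
/-- A face of a finitely generated cone is generated by the generators that it contains. -/
lemma eq_hull_of_isFaceOf_hull {σ : Finset V} {F : PointedCone ℚ V}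
    (hF : F.IsFaceOf (PointedCone.hull ℚ (σ : Set V))) :
    F = PointedCone.hull ℚ ((σ.filter (· ∈ F) : Finset V) : Set V) := by
  apply le_antisymm
  · intro x hx
    have hx' := hF.le hx
    rw [PointedCone.mem_hull_finset] at hx' ⊢
    obtain ⟨c, hc0, hcs, rfl⟩ := hx'
    refine ⟨c, hc0, fun v hv => Finset.mem_filter.2 ⟨hcs hv, ?_⟩, rfl⟩
    have h2 : 0 < c v := lt_of_le_of_ne (hc0 v) (Ne.symm (Finsupp.mem_support_iff.1 hv))
    rw [Finsupp.linearCombination_apply, Finsupp.sum, ← Finset.add_sum_erase _ _ hv] at hx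
    refine hF.mem_of_smul_add_mem (PointedCone.subset_hull (hcs hv)) ?_ h2 hx
    refine Submodule.sum_mem _ fun w hw => ?_
    exact PointedCone.smul_mem _ (hc0 w)
      (PointedCone.subset_hull (hcs (Finset.mem_of_mem_erase hw)))
  · refine Submodule.span_le.2 fun v hv => ?_
    simp only [Finset.coe_filter, Set.mem_ofPred_eq] at hv
    exact hv.2

open Classical in
lemma IsConeComplex.hull_inf_hull {K : Set (Finset V)} (hK : IsConeComplex K) {σ τ : Finset V}
    (hσ : σ ∈ K) (hτ : τ ∈ K) :
    PointedCone.hull ℚ (σ : Set V) ⊓ PointedCone.hull ℚ (τ : Set V) =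
      PointedCone.hull ℚ ((σ ∩ τ : Finset V) : Set V) := by
  apply le_antisymm
  · rintro x ⟨hx, hy⟩
    rw [SetLike.mem_coe, PointedCone.mem_hull_finset] at hx hy
    rw [PointedCone.mem_hull_finset]
    obtain ⟨c, hc0, hcs, rfl⟩ := hx
    obtain ⟨d, hd0, hds, hd⟩ := hy
    have h := hK.eq_of_eval_eq c d hc0 hd0 (hK.subset_mem _ hσ _ hcs) (hK.subset_mem _ hτ _ hds)
      hd.symm
    subst h
    exact ⟨c, hc0, Finset.subset_inter hcs hds, rfl⟩
  · refine le_inf (Submodule.span_mono ?_) (Submodule.span_mono ?_)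
    · exact_mod_cast Finset.inter_subset_left
    · exact_mod_cast Finset.inter_subset_right

lemma isConeComplex_powerset {s : Finset V} (hs : LinearIndepOn ℚ id (s : Set V)) :
    IsConeComplex {σ : Finset V | σ ⊆ s} where
  finite := by
    classical
    refine (Finset.finite_toSet s.powerset).subset fun σ hσ => ?_
    simpa using hσ
  empty_mem := by simp
  subset_mem := fun σ hσ τ hτ => hτ.trans hσ
  eq_of_eval_eq := fun c d _ _ hc hd h => eq_of_linearIndepOn_finset hs hc hd h

lemma complexSupport_powerset (s : Finset V) :
    complexSupport {σ : Finset V | σ ⊆ s} = (PointedCone.hull ℚ (s : Set V) : Set V) := by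
  ext x
  rw [SetLike.mem_coe, PointedCone.mem_hull_finset]
  rfl

end Faces

variable {k : ℕ}

/-- The fan generated by a complex of simplicial cones. -/
def fanOfComplex (K : Set (Finset (DualSpace k))) : Set (PointedCone ℚ (DualSpace k)) :=
  (fun σ : Finset (DualSpace k) => PointedCone.hull ℚ (σ : Set (DualSpace k))) '' K

lemma isSimplicialFan_fanOfComplex {K : Set (Finset (DualSpace k))} (hK : IsConeComplex K) :
    IsSimplicialFan (fanOfComplex K) where
  finite := hK.finite.image _
  nonempty := ⟨_, ∅, hK.empty_mem, rfl⟩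
  isSimplicial := by
    rintro _ ⟨σ, hσ, rfl⟩
    exact ⟨σ, σ.finite_toSet, hK.linearIndepOn hσ, rfl⟩
  face_mem := by
    classical
    rintro _ ⟨σ, hσ, rfl⟩ τ hτ
    rw [eq_hull_of_isFaceOf_hull hτ]
    exact ⟨_, hK.subset_mem _ hσ _ (Finset.filter_subset _ _), rfl⟩
  inf_isFaceOf := by
    classical
    rintro _ ⟨σ, hσ, rfl⟩ _ ⟨τ, hτ, rfl⟩
    simp only
    rw [hK.hull_inf_hull hσ hτ]
    exact ⟨hull_isFaceOf_hull (hK.linearIndepOn hσ) Finset.inter_subset_left,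
      hull_isFaceOf_hull (hK.linearIndepOn hτ) Finset.inter_subset_right⟩

lemma fanSupport_fanOfComplex {K : Set (Finset (DualSpace k))} (hK : IsConeComplex K) :
    fanSupport (fanOfComplex K) = complexSupport K := by
  ext x
  simp only [fanSupport, fanOfComplex, Set.mem_iUnion, Set.mem_image, SetLike.mem_coe]
  constructor
  · rintro ⟨_, ⟨σ, hσ, rfl⟩, hx⟩
    obtain ⟨c, h1, h2, h3⟩ := PointedCone.mem_hull_finset.1 hx
    exact ⟨c, h1, hK.subset_mem _ hσ _ h2, h3⟩
  · rintro ⟨c, h1, h2, h3⟩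
    exact ⟨_, ⟨_, h2, rfl⟩, PointedCone.mem_hull_finset.2 ⟨c, h1, subset_rfl, h3⟩⟩

lemma dual_eq_sum (L : DualSpace k) (x : Fin k → ℚ) : L x = ∑ i, x i * L (Pi.single i 1) := by
  conv_lhs => rw [pi_eq_sum_univ' x]
  simp

open Classical in
/-- The positive quadrant is generated by the coordinate forms, and its faces form a complex. -/
lemma exists_quadrant_complex (k : ℕ) :
    ∃ K : Set (Finset (DualSpace k)), IsConeComplex K ∧ complexSupport K = positiveQuadrant k := by
  have hli : LinearIndependent ℚ (fun i : Fin k => (LinearMap.proj i : DualSpace k)) := by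
    rw [Fintype.linearIndependent_iff]
    intro g hg i
    have := LinearMap.congr_fun hg (Pi.single i 1)
    simpa [Pi.single_apply] using this
  set s : Finset (DualSpace k) := Finset.univ.image fun i => LinearMap.proj i with hs
  refine ⟨_, isConeComplex_powerset (s := s) ?_, ?_⟩
  · have := hli.linearIndepOn_id
    simpa [hs] using this
  · rw [complexSupport_powerset]
    ext L
    constructor
    · intro hL
      obtain ⟨c, h1, h2, rfl⟩ := PointedCone.mem_hull_finset.1 hL
      intro i
      rw [Finsupp.linearCombination_apply, Finsupp.sum, LinearMap.sum_apply]
      refine Finset.sum_nonneg fun v hv => ?_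
      obtain ⟨j, -, rfl⟩ := Finset.mem_image.1 (h2 hv)
      have := h1 (LinearMap.proj j : DualSpace k)
      simp only [id, LinearMap.smul_apply, smul_eq_mul, LinearMap.proj_apply, Pi.single_apply]
      split_ifs <;> linarith
    · intro hL
      have : L = ∑ i, L (Pi.single i 1) • (LinearMap.proj i : DualSpace k) := by
        ext i
        simp [Pi.single_apply]
      rw [this]
      refine Submodule.sum_mem _ fun i _ => PointedCone.smul_mem _ (hL i)
        (PointedCone.subset_hull ?_)
      simp [hs]

/-- Evaluation of linear forms at a lattice point. -/
def evalAt (a : Fin k → ℤ) : DualSpace k →ₗ[ℚ] ℚ where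
  toFun L := evalLattice L a
  map_add' _ _ := rfl
  map_smul' _ _ := rfl

lemma evalLattice_add (L : DualSpace k) (a b : Fin k → ℤ) :
    evalLattice L (a + b) = evalLattice L a + evalLattice L b := by
  unfold evalLattice
  rw [← map_add]
  congr 1
  funext i
  simp

lemma evalLattice_neg (L : DualSpace k) (a : Fin k → ℤ) :
    evalLattice L (-a) = -evalLattice L a := by
  unfold evalLattice
  rw [← map_neg]
  congr 1

lemma evalLattice_sub (L : DualSpace k) (a b : Fin k → ℤ) :
    evalLattice L (a - b) = evalLattice L a - evalLattice L b := by
  rw [sub_eq_add_neg, evalLattice_add, evalLattice_neg, sub_eq_add_neg]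

lemma evalLattice_nonneg {L : DualSpace k} (hL : L ∈ positiveQuadrant k) {a : Fin k → ℤ}
    (ha : 0 ≤ a) : 0 ≤ evalLattice L a := by
  unfold evalLattice
  rw [dual_eq_sum]
  exact Finset.sum_nonneg fun i _ => mul_nonneg (by exact_mod_cast ha i) (hL i)

lemma mem_dualLattice_hull {σ : Finset (DualSpace k)} {a : Fin k → ℤ} :
    a ∈ dualLattice (PointedCone.hull ℚ (σ : Set (DualSpace k))) ↔
      ∀ v ∈ σ, 0 ≤ evalLattice v a := by
  constructor
  · exact fun h v hv => h v (PointedCone.subset_hull (by exact_mod_cast hv))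
  · intro h L hL
    obtain ⟨c, h1, h2, rfl⟩ := PointedCone.mem_hull_finset.1 hL
    change 0 ≤ evalAt a _
    rw [Finsupp.linearCombination_apply, Finsupp.sum, map_sum]
    refine Finset.sum_nonneg fun v hv => ?_
    rw [map_smul, smul_eq_mul]
    exact mul_nonneg (h1 v) (h v (h2 hv))

/-- Every ray of the dual space contains a primitive integral form. -/
lemma exists_primitive_smul {v : DualSpace k} (hv : v ≠ 0) :
    ∃ r : ℚ, 0 < r ∧ IsPrimitiveForm (r • v) := by
  set x : Fin k → ℚ := fun i => v (Pi.single i 1) with hx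
  -- clear the denominators by means of `N`, then divide by the gcd of the coefficients
  set N : ℕ := ∏ i, (x i).den with hN
  have hNpos : 0 < N := Finset.prod_pos fun i _ => (x i).den_pos
  have hz : ∀ i, ∃ z : ℤ, (N : ℚ) * x i = z := by
    intro i
    obtain ⟨m, hm⟩ : (x i).den ∣ N := Finset.dvd_prod_of_mem _ (Finset.mem_univ i)
    refine ⟨m * (x i).num, ?_⟩
    rw [hm]
    push_cast
    have := Rat.mul_den_eq_num (x i)
    linear_combination (m : ℚ) * this
  choose z hz using hz
  have hzne : ∃ i, z i ≠ 0 := by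
    by_contra! h
    apply hv
    ext i
    have h1 := hz i
    rw [h i] at h1
    simp only [Int.cast_zero, mul_eq_zero, Nat.cast_eq_zero, hNpos.ne', false_or] at h1
    simpa [hx] using h1
  obtain ⟨i₀, hi₀⟩ := hzne
  obtain ⟨y, hy, hg⟩ := Finset.extract_gcd z (s := Finset.univ) ⟨i₀, Finset.mem_univ _⟩
  set g : ℤ := Finset.univ.gcd z with hgdef
  have hg0 : g ≠ 0 := by
    rw [hgdef, Ne, Finset.gcd_eq_zero_iff]
    exact fun h => hi₀ (h i₀ (Finset.mem_univ _))
  have hgpos : 0 < g := by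
    have : 0 ≤ g := Int.nonneg_of_normalize_eq_self (by rw [hgdef, Finset.normalize_gcd])
    omega
  have hgq : (0 : ℚ) < g := by exact_mod_cast hgpos
  refine ⟨N / g, by positivity, smul_ne_zero (by positivity) hv, ?_, ?_⟩
  all_goals
    have hval : ∀ i, ((N / g : ℚ) • v) (Pi.single i 1) = y i := by
      intro i
      have h1 := hz i
      rw [hy i (Finset.mem_univ i)] at h1
      push_cast at h1
      rw [LinearMap.smul_apply, smul_eq_mul, div_mul_eq_mul_div, div_eq_iff hgq.ne']
      rw [mul_comm (y i : ℚ)]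
      exact h1
  · exact fun i => ⟨y i, hval i⟩
  · intro m L' hL' h
    have hdvd : (m : ℤ) ∣ Finset.univ.gcd y := Finset.dvd_gcd fun i _ => by
      obtain ⟨t, ht⟩ := hL' i
      refine ⟨t, ?_⟩
      have h1 := hval i
      rw [h, LinearMap.smul_apply, ht] at h1
      simp only [nsmul_eq_mul] at h1
      exact_mod_cast h1.symm
    rw [hg] at hdvd
    exact_mod_cast Int.eq_one_of_dvd_one (by positivity) hdvd

/-- The generators of a simplicial cone span its one-dimensional faces, so that its dual is
determined by the primitive generators of the latter. -/
lemma mem_dualLattice_of_primitiveGenerators {σ : Finset (DualSpace k)}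
    (hσ : LinearIndepOn ℚ id (σ : Set (DualSpace k))) {a : Fin k → ℤ}
    (h : ∀ L ∈ primitiveGenerators (PointedCone.hull ℚ (σ : Set (DualSpace k))),
      0 ≤ evalLattice L a) :
    a ∈ dualLattice (PointedCone.hull ℚ (σ : Set (DualSpace k))) := by
  rw [mem_dualLattice_hull]
  intro v hv
  have hv0 : v ≠ 0 := by
    have := hσ.ne_zero (i := v) (by exact_mod_cast hv)
    simpa using this
  obtain ⟨r, hr, hprim⟩ := exists_primitive_smul hv0
  have hspan : PointedCone.hull ℚ {r • v} =
      PointedCone.hull ℚ ((({v} : Finset (DualSpace k)) : Set (DualSpace k))) := by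
    rw [Finset.coe_singleton]
    apply le_antisymm
    · refine Submodule.span_le.2 ?_
      rintro _ rfl
      exact PointedCone.smul_mem _ hr.le (PointedCone.subset_hull rfl)
    · refine Submodule.span_le.2 ?_
      intro w hw
      rw [Set.mem_singleton_iff] at hw
      subst hw
      have h1 : r⁻¹ • (r • w) ∈ PointedCone.hull ℚ {r • w} :=
        PointedCone.smul_mem _ (inv_nonneg.2 hr.le) (PointedCone.subset_hull rfl)
      rwa [smul_smul, inv_mul_cancel₀ hr.ne', one_smul] at h1
  have h1 := h (r • v) ⟨hprim, by
    rw [hspan]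
    exact hull_isFaceOf_hull hσ (by simpa using hv)⟩
  have h2 : evalLattice (r • v) a = r * evalLattice v a := by
    simp [evalLattice]
  rw [h2] at h1
  exact (mul_nonneg_iff_of_pos_left hr).1 h1

end Fans

/-! ### Flatness of Rees modules admitting adapted bases -/

section Flatness

variable {k : ℕ} {M : Type*} [AddCommGroup M]

/-- The monomial `m u^s`. -/
noncomputable def LaurentModule.monomial (s : Fin k → ℤ) : M →+ LaurentModule k M :=
  Finsupp.singleAddHom s

lemma LaurentModule.coeff_monomial [DecidableEq (Fin k → ℤ)] (s t : Fin k → ℤ) (m : M) :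
    (LaurentModule.monomial s m).coeff t = if s = t then m else 0 := by
  rw [← Finsupp.single_apply]; rfl

/-- Taking the coefficient of `u^s` is additive. -/
def LaurentModule.coeffHom (s : Fin k → ℤ) : LaurentModule k M →+ M where
  toFun f := f.coeff s
  map_zero' := rfl
  map_add' _ _ := rfl

lemma LaurentModule.ext {f g : LaurentModule k M} (h : ∀ s, f.coeff s = g.coeff s) : f = g :=
  Finsupp.ext h

lemma LaurentModule.eq_sum_monomial (f : LaurentModule k M) :
    f = ∑ s ∈ (show (Fin k → ℤ) →₀ M from f).support, LaurentModule.monomial s (f.coeff s) :=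
  (Finsupp.sum_single (show (Fin k → ℤ) →₀ M from f)).symm

lemma LaurentModule.coeff_sum {J : Type*} (s : Finset J) (f : J → LaurentModule k M)
    (t : Fin k → ℤ) : (∑ j ∈ s, f j).coeff t = ∑ j ∈ s, (f j).coeff t :=
  map_sum (LaurentModule.coeffHom t) f s

variable [Module ℂ M]

open Classical in
lemma LaurentModule.coeff_smul_monomial (S : AddSubmonoid (Fin k → ℤ)) (p : AddMonoidAlgebra ℂ S)
    (t s : Fin k → ℤ) (m : M) :
    (p • LaurentModule.monomial t m).coeff s =
      (if h : s - t ∈ S then p.coeff ⟨s - t, h⟩ else 0) • m := by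
  induction p using AddMonoidAlgebra.induction_linear with
  | zero =>
    rw [zero_smul]
    split_ifs <;> simp [LaurentModule.coeff] <;> rfl
  | add p q hp hq =>
    have : ((p + q) • LaurentModule.monomial t m).coeff s =
      (p • LaurentModule.monomial t m).coeff s + (q • LaurentModule.monomial t m).coeff s := by
      rw [add_smul]; rfl
    rw [this, hp, hq, ← add_smul]
    congr 1
    split_ifs <;> simp
  | single a c =>
    have h := LaurentModule.smul_single_coeff S a c (LaurentModule.monomial t m) (-a + s)
    rw [add_neg_cancel_left] at h
    rw [h, LaurentModule.coeff_monomial]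
    by_cases h1 : t = -a + s
    · have h2 : s - t = a := by rw [h1]; abel
      have h3 : s - t ∈ S := h2 ▸ a.2
      have h4 : (⟨s - t, h3⟩ : S) = a := Subtype.ext h2
      rw [if_pos h1, dif_pos h3, h4]
      simp
    · rw [if_neg h1]
      have h2 : ∀ h : s - t ∈ S, a ≠ ⟨s - t, h⟩ := by
        intro h h3
        apply h1
        rw [h3]
        simp
      split_ifs with h3
      · simp [AddMonoidAlgebra.coeff_single, h2 h3]
      · simp

lemma LaurentModule.smul_monomial (S : AddSubmonoid (Fin k → ℤ)) (a : S) (c : ℂ)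
    (t : Fin k → ℤ) (m : M) :
    (AddMonoidAlgebra.single a c : AddMonoidAlgebra ℂ S) • LaurentModule.monomial t m =
      LaurentModule.monomial ((a : Fin k → ℤ) + t) (c • m) := by
  classical
  refine LaurentModule.ext fun s => ?_
  have h := LaurentModule.smul_single_coeff S a c (LaurentModule.monomial t m) (-a + s)
  rw [add_neg_cancel_left] at h
  rw [h, LaurentModule.coeff_monomial, LaurentModule.coeff_monomial]
  by_cases h1 : t = -a + s
  · rw [if_pos h1, if_pos (by rw [h1]; abel)]
  · rw [if_neg h1, if_neg, smul_zero]
    rintro rfl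
    exact h1 (by abel)

/-- The elements `v_j u^{t_j}` are independent over a semigroup algebra when the `v_j` are
independent over `ℂ`. -/
lemma linearIndependent_monomial (S : AddSubmonoid (Fin k → ℤ)) {J : Type*} [Fintype J]
    {v : J → M} (hv : LinearIndependent ℂ v) (t : J → Fin k → ℤ) (b : J → AddMonoidAlgebra ℂ S)
    (h : ∑ j, b j • LaurentModule.monomial (t j) (v j) = 0) (j : J) : b j = 0 := by
  classical
  refine AddMonoidAlgebra.ext (Finsupp.ext fun a => ?_)
  have h1 : (∑ j, b j • LaurentModule.monomial (t j) (v j)).coeff (a + t j) = 0 := by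
    rw [h]; rfl
  rw [LaurentModule.coeff_sum] at h1
  simp only [LaurentModule.coeff_smul_monomial] at h1
  have h2 := Fintype.linearIndependent_iff.1 hv _ h1 j
  rw [dif_pos (by rw [add_sub_cancel_right]; exact a.2)] at h2
  simpa using h2

/-- A Rees module is flat if each finite family of its homogeneous elements is expressed by
means of a family of elements of the filtration that is independent over `ℂ`: the latter
generates a free submodule of the Rees module, in which any relation between the given elements
is trivial. -/
theorem flat_reesModule_of_adapted (U : (Fin k → ℤ) → Submodule ℂ M)
    (Γ : PointedCone ℚ (DualSpace k))
    (h : ∀ X : Finset ((Fin k → ℤ) × M), (∀ x ∈ X, x.2 ∈ coneFiltration U Γ x.1) →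
      ∃ (J : Type) (_ : Fintype J) (v : J → M) (t : J → Fin k → ℤ), LinearIndependent ℂ v ∧
        (∀ j, v j ∈ coneFiltration U Γ (t j)) ∧
        ∀ x ∈ X, x.2 ∈ Submodule.span ℂ (v '' {j | x.1 - t j ∈ dualLattice Γ})) :
    Module.Flat (conicalAlgebra Γ) (reesModule U Γ) := by
  classical
  refine Module.Flat.of_forall_isTrivialRelation fun {l f x} hfx => ?_
  -- the homogeneous components of the elements of the given relation
  set X : Finset ((Fin k → ℤ) × M) := Finset.univ.biUnion fun i : Fin l =>
    (show (Fin k → ℤ) →₀ M from (x i : LaurentModule k M)).support.image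
      fun s => (s, (x i : LaurentModule k M).coeff s) with hX
  obtain ⟨J, _, v, t, hv, hvt, hspan⟩ := h X (by
    intro y hy
    simp only [hX, Finset.mem_biUnion, Finset.mem_image] at hy
    obtain ⟨i, -, s, -, rfl⟩ := hy
    exact (x i).2 s)
  have hg : ∀ j, LaurentModule.monomial (t j) (v j) ∈ reesModule U Γ := by
    intro j s
    rw [LaurentModule.coeff_monomial]
    split_ifs with h1
    · exact h1 ▸ hvt j
    · exact zero_mem _
  set g : J → reesModule U Γ := fun j => ⟨_, hg j⟩ with hgdef
  have hxg : ∀ i, x i ∈ Submodule.span (conicalAlgebra Γ) (Set.range g) := by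
    intro i
    have h1 : (x i : LaurentModule k M) ∈ Submodule.span (conicalAlgebra Γ)
        (Set.range fun j => LaurentModule.monomial (t j) (v j)) := by
      rw [LaurentModule.eq_sum_monomial (x i : LaurentModule k M)]
      refine Submodule.sum_mem _ fun s hs => ?_
      have h2 := hspan (s, (x i : LaurentModule k M).coeff s) (by
        simp only [hX, Finset.mem_biUnion, Finset.mem_image]
        exact ⟨i, Finset.mem_univ _, s, hs, rfl⟩)
      simp only at h2
      generalize (x i : LaurentModule k M).coeff s = m at h2
      induction h2 using Submodule.span_induction with
      | mem m hm =>
        obtain ⟨j, hj, rfl⟩ := hm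
        have h3 := LaurentModule.smul_monomial (dualLattice Γ) ⟨_, hj⟩ 1 (t j) (v j)
        rw [one_smul, sub_add_cancel] at h3
        rw [← h3]
        exact Submodule.smul_mem _ _ (Submodule.subset_span ⟨j, rfl⟩)
      | zero => rw [map_zero]; exact zero_mem _
      | add m m' _ _ h3 h4 => rw [map_add]; exact add_mem h3 h4
      | smul c m _ h3 =>
        have h4 := LaurentModule.smul_monomial (dualLattice Γ) 0 c s m
        rw [AddSubmonoid.coe_zero, zero_add] at h4
        rw [← h4]
        exact Submodule.smul_mem _ _ h3
    have h2 : (Set.range fun j => LaurentModule.monomial (t j) (v j)) =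
        (reesModule U Γ).subtype '' Set.range g := by
      rw [← Set.range_comp]
      rfl
    rw [h2, ← Submodule.map_span] at h1
    obtain ⟨y, hy, hyx⟩ := h1
    rwa [← Subtype.ext hyx]
  simp only [Submodule.mem_span_range_iff_exists_fun] at hxg
  choose c hc using hxg
  set e := Fintype.equivFin J with he
  refine ⟨Fintype.card J, fun i j => c i (e.symm j), fun j => g (e.symm j), fun i => ?_,
    fun j => ?_⟩
  · rw [← hc i]
    exact (Equiv.sum_comp e.symm fun j => c i j • g j).symm
  · refine linearIndependent_monomial (dualLattice Γ) hv t (fun j => ∑ i, f i * c i j) ?_ (e.symm j)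
    have h1 : ∑ j, (∑ i, f i * c i j) • g j = 0 := by
      rw [← hfx]
      simp only [Finset.sum_smul, mul_smul]
      rw [Finset.sum_comm]
      refine Finset.sum_congr rfl fun i _ => ?_
      rw [← hc i, Finset.smul_sum]
    have h2 := congrArg (reesModule U Γ).subtype h1
    rw [map_sum, map_zero] at h2
    exact h2

end Flatness

/-! ### Coefficients of differential operators -/

section Coefficients

open MvPowerSeries

variable {n : ℕ}

lemma toSeries_injective : Function.Injective (ConvSeries.toSeries n) := Subtype.val_injective

lemma coeff_toSeries_partialOp (i : Fin n) (f : ConvSeries n) (α : Fin n →₀ ℕ) :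
    coeff α (ConvSeries.toSeries n (partialOp n i f)) =
      coeff (α + Finsupp.single i 1) (ConvSeries.toSeries n f) * (α i + 1) :=
  coeff_pderiv _ _

lemma partialOp_commute (i j : Fin n) : Commute (partialOp n i) (partialOp n j) := by
  refine LinearMap.ext fun f => toSeries_injective (MvPowerSeries.ext fun α => ?_)
  rw [Module.End.mul_apply, Module.End.mul_apply]
  simp only [coeff_toSeries_partialOp]
  rw [add_right_comm]
  by_cases h : i = j
  · subst h; rfl
  · simp only [Finsupp.add_apply, Finsupp.single_apply, h, Ne.symm h, if_false, add_zero]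
    ring

lemma partialOp_mul_multOp (i : Fin n) (a : ConvSeries n) :
    partialOp n i * multOp n a = multOp n (partialOp n i a) + multOp n a * partialOp n i := by
  refine LinearMap.ext fun f => toSeries_injective ?_
  change MvPowerSeries.pderiv ℂ i (a.1 * f.1) =
    MvPowerSeries.pderiv ℂ i a.1 * f.1 + a.1 * MvPowerSeries.pderiv ℂ i f.1
  rw [Derivation.leibniz, smul_eq_mul, smul_eq_mul]
  ring

lemma multOp_mul (a b : ConvSeries n) : multOp n (a * b) = multOp n a * multOp n b := by
  refine LinearMap.ext fun f => ?_
  simp [multOp]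

lemma multOp_zero : multOp n 0 = 0 := by
  refine LinearMap.ext fun f => ?_
  simp [multOp]

lemma multOp_one : multOp n 1 = 1 := by
  refine LinearMap.ext fun f => ?_
  simp [multOp]

lemma List.prod_ofFn_ite_mul {N : Type*} [Monoid N] {m : ℕ} (a : N) (F : Fin m → N)
    (h : ∀ j, Commute a (F j)) (i : Fin m) :
    (List.ofFn fun j => (if j = i then a else 1) * F j).prod = a * (List.ofFn F).prod := by
  induction m with
  | zero => exact i.elim0
  | succ m ih =>
    rw [List.ofFn_succ, List.ofFn_succ, List.prod_cons, List.prod_cons]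
    refine Fin.cases ?_ (fun i => ?_) i
    · simp [Fin.succ_ne_zero, mul_assoc]
    · simp only [Fin.succ_inj, (Fin.succ_ne_zero i).symm, if_false, one_mul]
      rw [ih (fun j => F j.succ) (fun j => h j.succ), ← mul_assoc, ← mul_assoc, (h 0).eq]

lemma partialOp_mul_partialMonomial (i : Fin n) (β : Fin n →₀ ℕ) :
    partialOp n i * partialMonomial n β = partialMonomial n (β + Finsupp.single i 1) := by
  unfold partialMonomial
  rw [← List.prod_ofFn_ite_mul _ _ (fun j => (partialOp_commute i j).pow_right _) i]
  congr 2
  funext j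
  by_cases h : j = i
  · subst h; simp [pow_succ']
  · simp [h]

lemma partialMonomial_zero : partialMonomial n 0 = 1 := by
  unfold partialMonomial
  rw [List.prod_eq_one]
  intro x hx
  simp only [List.mem_ofFn] at hx
  obtain ⟨j, rfl⟩ := hx
  simp

lemma ofCoeffs_single (β : Fin n →₀ ℕ) (a : ConvSeries n) :
    ofCoeffs n (Finsupp.single β a) = multOp n a * partialMonomial n β :=
  Finsupp.sum_single_index (by rw [multOp_zero, zero_mul])

/-- The coefficients of `a ∘ P` in terms of those of `P`. -/
noncomputable def mulCoeffs (a : ConvSeries n) (p : (Fin n →₀ ℕ) →₀ ConvSeries n) :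
    (Fin n →₀ ℕ) →₀ ConvSeries n :=
  p.mapRange (a * ·) (mul_zero a)

/-- The coefficients of `∂ᵢ ∘ P` in terms of those of `P`. -/
noncomputable def partialCoeffs (i : Fin n) (p : (Fin n →₀ ℕ) →₀ ConvSeries n) :
    (Fin n →₀ ℕ) →₀ ConvSeries n :=
  p.mapRange (partialOp n i) (map_zero _) + p.mapDomain (· + Finsupp.single i 1)

lemma ofCoeffs_mulCoeffs (a : ConvSeries n) (p : (Fin n →₀ ℕ) →₀ ConvSeries n) :
    ofCoeffs n (mulCoeffs a p) = multOp n a * ofCoeffs n p := by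
  induction p using Finsupp.induction_linear with
  | zero => simp [mulCoeffs, ofCoeffs]
  | add p q hp hq =>
    rw [ofCoeffs_add, mul_add, ← hp, ← hq, ← ofCoeffs_add]
    congr 1
    exact Finsupp.mapRange_add (fun x y => mul_add a x y) p q
  | single β b =>
    rw [mulCoeffs, Finsupp.mapRange_single, ofCoeffs_single, ofCoeffs_single, multOp_mul, mul_assoc]

lemma ofCoeffs_partialCoeffs (i : Fin n) (p : (Fin n →₀ ℕ) →₀ ConvSeries n) :
    ofCoeffs n (partialCoeffs i p) = partialOp n i * ofCoeffs n p := by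
  induction p using Finsupp.induction_linear with
  | zero => simp [partialCoeffs, ofCoeffs]
  | add p q hp hq =>
    rw [ofCoeffs_add, mul_add, ← hp, ← hq, ← ofCoeffs_add]
    congr 1
    rw [partialCoeffs, Finsupp.mapRange_add (fun x y => map_add _ x y), Finsupp.mapDomain_add]
    simp only [partialCoeffs]
    abel
  | single β b =>
    rw [partialCoeffs, Finsupp.mapRange_single, Finsupp.mapDomain_single, ofCoeffs_add,
      ofCoeffs_single, ofCoeffs_single, ofCoeffs_single, ← mul_assoc, partialOp_mul_multOp,
      add_mul, mul_assoc, partialOp_mul_partialMonomial]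

/-- The operators `∑ p_β ∂^β` are stable under multiplication on the left by the generators of `𝒟`.
-/
lemma exists_ofCoeffs {P : Module.End ℂ (ConvSeries n)} (hP : P ∈ diffOpAlgebra n) :
    ∃ p, P = ofCoeffs n p := by
  suffices h : ∀ p, ∃ q, P * ofCoeffs n p = ofCoeffs n q by
    obtain ⟨q, hq⟩ := h (Finsupp.single 0 1)
    rw [ofCoeffs_single, multOp_one, partialMonomial_zero, mul_one, mul_one] at hq
    exact ⟨q, hq⟩
  induction hP using Algebra.adjoin_induction with
  | mem x hx =>
    intro p
    rcases hx with ⟨a, rfl⟩ | ⟨i, rfl⟩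
    · exact ⟨_, (ofCoeffs_mulCoeffs a p).symm⟩
    · exact ⟨_, (ofCoeffs_partialCoeffs i p).symm⟩
  | algebraMap c =>
    intro p
    exact ⟨c • p, by rw [ofCoeffs_smul, Algebra.algebraMap_eq_smul_one, smul_mul_assoc, one_mul]⟩
  | add x y _ _ hx hy =>
    intro p
    obtain ⟨q, hq⟩ := hx p
    obtain ⟨q', hq'⟩ := hy p
    exact ⟨q + q', by rw [add_mul, hq, hq', ofCoeffs_add]⟩
  | mul x y _ _ hx hy =>
    intro p
    obtain ⟨q, hq⟩ := hy p
    obtain ⟨q', hq'⟩ := hx q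
    exact ⟨q', by rw [mul_assoc, hq, hq']⟩

lemma multOp_mem (a : ConvSeries n) : multOp n a ∈ diffOpAlgebra n :=
  Algebra.subset_adjoin (Or.inl ⟨a, rfl⟩)

lemma partialOp_mem (i : Fin n) : partialOp n i ∈ diffOpAlgebra n :=
  Algebra.subset_adjoin (Or.inr ⟨i, rfl⟩)

lemma ofCoeffs_mem (p : (Fin n →₀ ℕ) →₀ ConvSeries n) : ofCoeffs n p ∈ diffOpAlgebra n := by
  refine sum_mem fun β _ => mul_mem (multOp_mem _) ?_
  refine list_prod_mem fun x hx => ?_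
  simp only [List.mem_ofFn] at hx
  obtain ⟨j, rfl⟩ := hx
  exact pow_mem (partialOp_mem j) _

lemma Finsupp.induction_add_single {σ : Type*} {p : (σ →₀ ℕ) → Prop} (zero : p 0)
    (add : ∀ i β, p β → p (β + Finsupp.single i 1)) (β : σ →₀ ℕ) : p β := by
  induction hd : β.degree generalizing β with
  | zero =>
    rw [Finsupp.degree_eq_zero_iff] at hd
    exact hd ▸ zero
  | succ d ih =>
    have hne : β ≠ 0 := by rintro rfl; simp at hd
    obtain ⟨i, hi⟩ := Finsupp.ne_iff.1 hne
    have hle : Finsupp.single i 1 ≤ β := by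
      rw [Finsupp.single_le_iff]
      exact Nat.one_le_iff_ne_zero.2 hi
    have h1 : β - Finsupp.single i 1 + Finsupp.single i 1 = β := tsub_add_cancel_of_le hle
    rw [← h1]
    refine add i _ (ih _ ?_)
    rw [← h1, map_add, Finsupp.degree_single] at hd
    omega

/-- The coefficient at `α` of `∂^β f` is a non-zero multiple of that of `f` at `α + β`. -/
lemma exists_coeff_partialMonomial (β α : Fin n →₀ ℕ) : ∃ c : ℂ, c ≠ 0 ∧ ∀ f : ConvSeries n,
    coeff α (ConvSeries.toSeries n (partialMonomial n β f)) =
      c * coeff (α + β) (ConvSeries.toSeries n f) := by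
  induction β using Finsupp.induction_add_single generalizing α with
  | zero => exact ⟨1, one_ne_zero, fun f => by rw [partialMonomial_zero, add_zero, one_mul]; rfl⟩
  | add i β ih =>
    obtain ⟨c, hc, h⟩ := ih (α + Finsupp.single i 1)
    refine ⟨c * (α i + 1), mul_ne_zero hc (Nat.cast_add_one_ne_zero _), fun f => ?_⟩
    rw [← partialOp_mul_partialMonomial, Module.End.mul_apply, coeff_toSeries_partialOp, h,
      add_right_comm α, add_assoc α]
    ring

/-- The monomial `x^α` as a convergent power series. -/
noncomputable def ConvSeries.monomial (α : Fin n →₀ ℕ) : ConvSeries n :=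
  (⟨MvPowerSeries.monomial α 1, 1, 1, zero_le_one, zero_le_one, fun β => by
    classical
    rw [coeff_monomial]; split_ifs <;> simp⟩ : convergentSeries n)

open Classical in
lemma coeff_toSeries_monomial (α β : Fin n →₀ ℕ) :
    coeff α (ConvSeries.toSeries n (ConvSeries.monomial β)) = if α = β then 1 else 0 :=
  coeff_monomial α β 1

lemma ofCoeffs_injective : Function.Injective (ofCoeffs n) := by
  classical
  suffices h : ∀ p, ofCoeffs n p = 0 → p = 0 by
    intro p q hpq
    rw [← sub_eq_zero]
    apply h
    have h1 := ofCoeffs_add n (p - q) q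
    rw [sub_add_cancel, hpq] at h1
    simpa using h1.symm
  intro p hp
  by_contra hne
  -- test the operator on `x^β` for a minimal exponent `β` of its coefficients
  obtain ⟨β, hβ⟩ := p.support.exists_minimal (Finsupp.support_nonempty_iff.2 hne)
  have h1 := LinearMap.congr_fun hp (ConvSeries.monomial β)
  rw [ofCoeffs, Finsupp.sum, LinearMap.sum_apply, Finset.sum_eq_single_of_mem β hβ.1] at h1
  · obtain ⟨c, hc, hcf⟩ := exists_coeff_partialMonomial (n := n) β 0
    have h2 : partialMonomial n β (ConvSeries.monomial β) = algebraMap ℂ (ConvSeries n) c := by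
      refine toSeries_injective (MvPowerSeries.ext fun α => ?_)
      rw [AlgHom.commutes, MvPowerSeries.algebraMap_apply, coeff_C]
      split_ifs with hα
      · rw [hα, hcf, zero_add, coeff_toSeries_monomial, if_pos rfl, mul_one]; rfl
      · obtain ⟨c', -, h'⟩ := exists_coeff_partialMonomial (n := n) β α
        rw [h', coeff_toSeries_monomial, if_neg (by simpa using hα), mul_zero]
    rw [Module.End.mul_apply, h2] at h1
    change p β * algebraMap ℂ (ConvSeries n) c = 0 at h1
    apply Finsupp.mem_support_iff.1 hβ.1
    have h3 := congrArg (· * algebraMap ℂ (ConvSeries n) c⁻¹) h1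
    simpa only [mul_assoc, ← map_mul, mul_inv_cancel₀ hc, map_one, mul_one, zero_mul] using h3
  · intro γ hγ hne'
    have h2 : partialMonomial n γ (ConvSeries.monomial β) = 0 := by
      refine toSeries_injective (MvPowerSeries.ext fun α => ?_)
      obtain ⟨c', -, h'⟩ := exists_coeff_partialMonomial (n := n) γ α
      rw [h', coeff_toSeries_monomial, if_neg, mul_zero, map_zero, map_zero]
      intro h3
      have h4 : γ ≤ β := h3 ▸ le_add_self
      exact hne' (le_antisymm h4 (hβ.2 hγ h4))
    rw [Module.End.mul_apply, h2, map_zero]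

/-- The operator of multiplication by `a`, as a differential operator. -/
noncomputable def DiffOp.ofFun (a : ConvSeries n) : DiffOp n :=
  (⟨multOp n a, multOp_mem a⟩ : diffOpAlgebra n)

/-- The partial derivative `∂ᵢ`, as a differential operator. -/
noncomputable def DiffOp.partial (i : Fin n) : DiffOp n :=
  (⟨partialOp n i, partialOp_mem i⟩ : diffOpAlgebra n)

lemma DiffOp.toEnd_injective : Function.Injective (DiffOp.toEnd n) := Subtype.val_injective

/-- The family `(p_β)` of the coefficients of the operator `∑ p_β ∂^β`. -/
noncomputable def DiffOp.coeffs : DiffOp n ≃ₗ[ℂ] ((Fin n →₀ ℕ) →₀ ConvSeries n) :=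
  LinearEquiv.symm <| LinearEquiv.ofBijective
    { toFun := fun p => (⟨ofCoeffs n p, ofCoeffs_mem p⟩ : diffOpAlgebra n)
      map_add' := fun p q => Subtype.ext (ofCoeffs_add n p q)
      map_smul' := fun c p => Subtype.ext (ofCoeffs_smul n c p) }
    ⟨fun _ _ h => ofCoeffs_injective (congrArg Subtype.val h), fun P => by
      obtain ⟨p, hp⟩ := exists_ofCoeffs P.2
      exact ⟨p, Subtype.ext hp.symm⟩⟩

lemma DiffOp.toEnd_coeffs_symm (p : (Fin n →₀ ℕ) →₀ ConvSeries n) :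
    DiffOp.toEnd n (DiffOp.coeffs.symm p) = ofCoeffs n p := rfl

lemma DiffOp.coeffs_eq_iff {P : DiffOp n} {p : (Fin n →₀ ℕ) →₀ ConvSeries n} :
    DiffOp.coeffs P = p ↔ DiffOp.toEnd n P = ofCoeffs n p := by
  rw [← LinearEquiv.eq_symm_apply, ← DiffOp.toEnd_coeffs_symm]
  exact DiffOp.toEnd_injective.eq_iff.symm

lemma DiffOp.toEnd_eq (P : DiffOp n) : DiffOp.toEnd n P = ofCoeffs n (DiffOp.coeffs P) :=
  DiffOp.coeffs_eq_iff.1 rfl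

lemma DiffOp.coeffs_ofFun_mul (a : ConvSeries n) (P : DiffOp n) :
    DiffOp.coeffs (DiffOp.ofFun a * P) = mulCoeffs a (DiffOp.coeffs P) := by
  rw [DiffOp.coeffs_eq_iff, map_mul, ofCoeffs_mulCoeffs, ← DiffOp.toEnd_eq]
  rfl

lemma DiffOp.coeffs_partial_mul (i : Fin n) (P : DiffOp n) :
    DiffOp.coeffs (DiffOp.partial i * P) = partialCoeffs i (DiffOp.coeffs P) := by
  rw [DiffOp.coeffs_eq_iff, map_mul, ofCoeffs_partialCoeffs, ← DiffOp.toEnd_eq]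
  rfl

lemma mem_vFiltration_iff {i : Fin n} {l : ℤ} {P : DiffOp n} :
    P ∈ vFiltration n i l ↔ ∀ α β : Fin n →₀ ℕ,
      coeff α (ConvSeries.toSeries n (DiffOp.coeffs P β)) ≠ 0 → (β i : ℤ) - (α i : ℤ) ≤ l := by
  constructor
  · rintro ⟨p, hp, h⟩
    rwa [DiffOp.coeffs_eq_iff.2 hp]
  · exact fun h => ⟨_, DiffOp.toEnd_eq P, h⟩

end Coefficients

/-! ### Neumann series for weighted `ℓ¹` norms -/

section Division

open scoped ENNReal

section Neumann

variable {E : Type*}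

/-- The weighted `ℓ¹` norm of a function. -/
noncomputable def weightedNorm (φ : E → ℝ≥0∞) (c : E → ℂ) : ℝ≥0∞ := ∑' e, ‖c e‖ₑ * φ e

lemma weightedNorm_add_le (φ : E → ℝ≥0∞) (c d : E → ℂ) :
    weightedNorm φ (c + d) ≤ weightedNorm φ c + weightedNorm φ d := by
  unfold weightedNorm
  rw [← ENNReal.tsum_add]
  refine ENNReal.tsum_le_tsum fun e => ?_
  rw [← add_mul]
  gcongr
  exact enorm_add_le _ _

lemma weightedNorm_neg (φ : E → ℝ≥0∞) (c : E → ℂ) :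
    weightedNorm φ (-c) = weightedNorm φ c := by
  simp [weightedNorm]

lemma le_weightedNorm (φ : E → ℝ≥0∞) (c : E → ℂ) (e : E) : ‖c e‖ₑ * φ e ≤ weightedNorm φ c :=
  ENNReal.le_tsum e

lemma weightedNorm_zero (φ : E → ℝ≥0∞) : weightedNorm φ (0 : E → ℂ) = 0 := by
  simp [weightedNorm]

lemma weightedNorm_sum_le (φ : E → ℝ≥0∞) {ι : Type*} (s : Finset ι) (c : ι → E → ℂ) :
    weightedNorm φ (∑ i ∈ s, c i) ≤ ∑ i ∈ s, weightedNorm φ (c i) := by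
  classical
  induction s using Finset.induction_on with
  | empty => simp [weightedNorm_zero]
  | insert i s hi ih =>
    rw [Finset.sum_insert hi, Finset.sum_insert hi]
    exact (weightedNorm_add_le _ _ _).trans (by gcongr)

lemma eq_of_weightedNorm_sub_eq_zero {φ : E → ℝ≥0∞} (hφ : ∀ e, φ e ≠ 0) {c d : E → ℂ}
    (h : weightedNorm φ (c - d) = 0) : c = d := by
  funext e
  have h1 := le_weightedNorm φ (c - d) e
  rw [h, nonpos_iff_eq_zero, mul_eq_zero, or_iff_left (hφ e), enorm_eq_zero, Pi.sub_apply,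
    sub_eq_zero] at h1
  exact h1

/-- The Neumann series `∑ (-K)^j P` inverts `1 + K` when `K` has norm at most `1/2`. The solution
has its support in `Z` if `P` does and `K` preserves this property. -/
lemma exists_add_map_eq {φ : E → ℝ≥0∞} (hφ : ∀ e, φ e ≠ 0)
    (K : (E → ℂ) →ₗ[ℂ] (E → ℂ))
    (hK : ∀ c, weightedNorm φ (K c) ≤ 2⁻¹ * weightedNorm φ c) {P : E → ℂ}
    (hP : weightedNorm φ P ≠ ⊤) :
    ∃ Q : E → ℂ, Q + K Q = P ∧ weightedNorm φ Q ≠ ⊤ ∧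
      ∀ Z : Set E, (∀ e, e ∉ Z → P e = 0) →
        (∀ c : E → ℂ, (∀ e, e ∉ Z → c e = 0) → ∀ e, e ∉ Z → K c e = 0) →
        ∀ e, e ∉ Z → Q e = 0 := by
  set F : ℕ → E → ℂ := fun j => ((-K) ^ j) P with hF
  have hF0 : F 0 = P := by simp [hF]
  have hFs : ∀ j, F (j + 1) = -K (F j) := fun j => by
    simp only [hF, pow_succ', Module.End.mul_apply, LinearMap.neg_apply]
  have hnorm : ∀ j, weightedNorm φ (F j) ≤ 2⁻¹ ^ j * weightedNorm φ P := by
    intro j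
    induction j with
    | zero => simp [hF0]
    | succ j ih =>
      rw [hFs, weightedNorm_neg, pow_succ', mul_assoc]
      exact (hK _).trans (by gcongr)
  have hgeom : ∀ J : ℕ, ∑' j, weightedNorm φ (F (j + J)) ≤ 2⁻¹ ^ J * (2 * weightedNorm φ P) := by
    intro J
    calc ∑' j, weightedNorm φ (F (j + J))
        ≤ ∑' j : ℕ, 2⁻¹ ^ j * (2⁻¹ ^ J * weightedNorm φ P) :=
          ENNReal.tsum_le_tsum fun j => (hnorm _).trans_eq (by rw [pow_add]; ring)
      _ = 2⁻¹ ^ J * (2 * weightedNorm φ P) := by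
          rw [ENNReal.tsum_mul_right, ENNReal.tsum_geometric, ENNReal.one_sub_inv_two, inv_inv]
          ring
  have hfin : ∑' j, weightedNorm φ (F j) ≠ ⊤ := by
    have h := hgeom 0
    simp only [add_zero, pow_zero, one_mul] at h
    exact ne_top_of_le_ne_top (ENNReal.mul_ne_top (by simp) hP) h
  have hsum : ∀ e, Summable fun j => F j e := by
    intro e
    apply Summable.of_enorm
    have h1 : (∑' j, ‖F j e‖ₑ) * φ e ≤ ∑' j, weightedNorm φ (F j) := by
      rw [← ENNReal.tsum_mul_right]
      exact ENNReal.tsum_le_tsum fun j => le_weightedNorm φ _ e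
    intro h2
    rw [h2, ENNReal.top_mul (hφ e), top_le_iff] at h1
    exact hfin h1
  have htail : ∀ J, weightedNorm φ (fun e => ∑' j, F (j + J) e) ≤
      2⁻¹ ^ J * (2 * weightedNorm φ P) := by
    intro J
    refine le_trans ?_ (hgeom J)
    unfold weightedNorm
    rw [ENNReal.tsum_comm]
    refine ENNReal.tsum_le_tsum fun e => ?_
    rw [ENNReal.tsum_mul_right]
    gcongr
    exact enorm_tsum_le_tsum_enorm
  set Q : E → ℂ := fun e => ∑' j, F j e with hQ
  have hQT : ∀ J, Q = ∑ j ∈ Finset.range J, F j + fun e => ∑' j, F (j + J) e := by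
    intro J
    funext e
    rw [Pi.add_apply, Finset.sum_apply]
    exact ((hsum e).sum_add_tsum_nat_add J).symm
  refine ⟨Q, ?_, ?_, ?_⟩
  · apply eq_of_weightedNorm_sub_eq_zero hφ
    have hpart : ∀ J, ∑ j ∈ Finset.range J, F j + K (∑ j ∈ Finset.range J, F j) - P = -F J := by
      intro J
      induction J with
      | zero => simp [hF0]
      | succ J ih =>
        rw [Finset.sum_range_succ, map_add, hFs]
        linear_combination ih
    -- `K` is not assumed to commute with infinite sums: compare `Q` with the partial sums
    have hle : ∀ J, weightedNorm φ (Q + K Q - P) ≤ 2⁻¹ ^ J * (5 * weightedNorm φ P) := by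
      intro J
      set T : E → ℂ := fun e => ∑' j, F (j + J) e with hT
      have h1 : Q + K Q - P = T + K T + -F J := by
        rw [← hpart J, hQT J, map_add, ← hT]
        ring
      rw [h1]
      calc weightedNorm φ (T + K T + -F J)
          ≤ weightedNorm φ T + weightedNorm φ (K T) + weightedNorm φ (-F J) :=
            (weightedNorm_add_le _ _ _).trans (by gcongr; exact weightedNorm_add_le _ _ _)
        _ ≤ 2⁻¹ ^ J * (2 * weightedNorm φ P) + 2⁻¹ ^ J * (2 * weightedNorm φ P) +
            2⁻¹ ^ J * weightedNorm φ P := by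
            gcongr
            · exact htail J
            · refine (hK T).trans (le_trans ?_ (htail J))
              exact mul_le_of_le_one_left' (by simp)
            · rw [weightedNorm_neg]; exact hnorm J
        _ = 2⁻¹ ^ J * (5 * weightedNorm φ P) := by ring
    have hlim : Filter.Tendsto (fun J : ℕ => (2⁻¹ : ℝ≥0∞) ^ J * (5 * weightedNorm φ P))
        Filter.atTop (nhds 0) := by
      rw [← zero_mul (5 * weightedNorm φ P)]
      refine ENNReal.Tendsto.mul_const (ENNReal.tendsto_pow_atTop_nhds_zero_of_lt_one (by simp)) ?_
      exact Or.inr (ENNReal.mul_ne_top (by simp) hP)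
    exact nonpos_iff_eq_zero.1 (ge_of_tendsto' hlim hle)
  · have h := htail 0
    simp only [add_zero, pow_zero, one_mul] at h
    exact ne_top_of_le_ne_top (ENNReal.mul_ne_top (by simp) hP) h
  · intro Z hZ hKZ e he
    have h : ∀ j, ∀ e, e ∉ Z → F j e = 0 := by
      intro j
      induction j with
      | zero => rwa [hF0]
      | succ j ih =>
        intro e he
        rw [hFs, Pi.neg_apply, hKZ _ ih e he, neg_zero]
    simp [hQ, h _ e he]

end Neumann

end Division

/-! ### Weighted norms of vectors of convergent power series -/

section Division

open scoped ENNReal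
open Filter Topology MvPowerSeries

section Weights

variable {n : ℕ} {B : Type*}

/-- The weight `∑ wᵢ αᵢ` of an exponent. -/
noncomputable def expWeight (w : Fin n → ℝ) (α : Fin n →₀ ℕ) : ℝ := ∑ i, w i * α i

lemma expWeight_add (w : Fin n → ℝ) (α α' : Fin n →₀ ℕ) :
    expWeight w (α + α') = expWeight w α + expWeight w α' := by
  simp [expWeight, mul_add, Finset.sum_add_distrib]

lemma expWeight_nonneg {w : Fin n → ℝ} (hw : ∀ i, 0 ≤ w i) (α : Fin n →₀ ℕ) :
    0 ≤ expWeight w α :=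
  Finset.sum_nonneg fun i _ => mul_nonneg (hw i) (Nat.cast_nonneg _)

lemma ENNReal.tsum_prod_apply_eq_pow (f : ℕ → ℝ≥0∞) (n : ℕ) :
    ∑' x : Fin n → ℕ, ∏ i, f (x i) = (∑' j, f j) ^ n := by
  induction n with
  | zero => simp
  | succ n ih =>
    rw [← (Fin.consEquiv fun _ : Fin (n + 1) => ℕ).tsum_eq, ENNReal.tsum_prod', pow_succ',
      ← ENNReal.tsum_mul_right]
    refine tsum_congr fun j => ?_
    rw [← ih, ← ENNReal.tsum_mul_left]
    refine tsum_congr fun x => ?_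
    rw [Fin.prod_univ_succ]
    simp [Fin.consEquiv]

lemma tsum_inv_two_pow_degree_ne_top (n : ℕ) :
    ∑' α : Fin n →₀ ℕ, (2⁻¹ : ℝ≥0∞) ^ α.degree ≠ ⊤ := by
  have h : ∑' α : Fin n →₀ ℕ, (2⁻¹ : ℝ≥0∞) ^ α.degree = (∑' j : ℕ, (2⁻¹ : ℝ≥0∞) ^ j) ^ n := by
    rw [← ENNReal.tsum_prod_apply_eq_pow, ← (Finsupp.equivFunOnFinite : (Fin n →₀ ℕ) ≃ (Fin n → ℕ)).tsum_eq]
    refine tsum_congr fun α => ?_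
    rw [Finsupp.degree_eq_sum, Finset.prod_pow_eq_pow_sum]
    rfl
  rw [h, ENNReal.tsum_geometric, ENNReal.one_sub_inv_two, inv_inv]
  exact ENNReal.pow_ne_top (by simp)

/-- The weight function `(α, b) ↦ t^{w · α - ω_b}`. The smaller `t`, the more it favours the
exponents `(α, b)` for which `ω_b - w · α` is large. -/
noncomputable def rpowWeight (w : Fin n → ℝ) (ω : B → ℝ) (t : ℝ) (e : (Fin n →₀ ℕ) × B) : ℝ≥0∞ :=
  ENNReal.ofReal (t ^ (expWeight w e.1 - ω e.2))

lemma rpowWeight_ne_zero (w : Fin n → ℝ) (ω : B → ℝ) {t : ℝ} (ht : 0 < t)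
    (e : (Fin n →₀ ℕ) × B) : rpowWeight w ω t e ≠ 0 := by
  simpa [rpowWeight] using Real.rpow_pos_of_pos ht _

lemma rpowWeight_add (w : Fin n → ℝ) (ω : B → ℝ) {t : ℝ} (ht : 0 < t) (α α' : Fin n →₀ ℕ) (b : B) :
    rpowWeight w ω t (α + α', b) =
      ENNReal.ofReal (t ^ expWeight w α) * rpowWeight w ω t (α', b) := by
  rw [rpowWeight, rpowWeight, ← ENNReal.ofReal_mul (Real.rpow_nonneg ht.le _), ← Real.rpow_add ht,
    expWeight_add]
  congr 2
  ring

lemma rpow_expWeight {w : Fin n → ℝ} {t : ℝ} (ht : 0 < t) (α : Fin n →₀ ℕ) :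
    t ^ expWeight w α = ∏ i, (t ^ w i) ^ α i := by
  rw [expWeight, Real.rpow_sum_of_pos ht]
  refine Finset.prod_congr rfl fun i _ => ?_
  rw [Real.rpow_mul ht.le, Real.rpow_natCast]

lemma tendsto_rpow_zero {g : ℝ} (hg : 0 < g) :
    Tendsto (fun t : ℝ => t ^ g) (𝓝[>] 0) (𝓝 0) := by
  have h := (Real.continuousAt_rpow_const 0 g (Or.inr hg.le)).tendsto
  rw [Real.zero_rpow hg.ne'] at h
  exact h.mono_left nhdsWithin_le_nhds

/-- The function of the coefficients of a vector of power series. -/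
noncomputable def vecCoeff (F : B → MvPowerSeries (Fin n) ℂ) (e : (Fin n →₀ ℕ) × B) : ℂ :=
  coeff e.1 (F e.2)

lemma IsConvergentSeries.eventually_tsum_ne_top {f : MvPowerSeries (Fin n) ℂ}
    (hf : IsConvergentSeries f) {w : Fin n → ℝ} (hw : ∀ i, 0 < w i) :
    ∀ᶠ t : ℝ in 𝓝[>] 0, ∑' α, ‖coeff α f‖ₑ * ENNReal.ofReal (t ^ expWeight w α) ≠ ⊤ := by
  obtain ⟨C, R, hC, hR, hf⟩ := hf
  have h1 : ∀ᶠ t : ℝ in 𝓝[>] 0, ∀ i, R * t ^ w i ≤ 2⁻¹ := by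
    rw [eventually_all]
    intro i
    have h2 := (tendsto_rpow_zero (hw i)).const_mul R
    rw [mul_zero] at h2
    exact (h2.eventually (gt_mem_nhds (by norm_num : (0 : ℝ) < 2⁻¹))).mono fun t ht => ht.le
  filter_upwards [h1, self_mem_nhdsWithin] with t ht ht0
  have ht0 : 0 < t := ht0
  refine ne_top_of_le_ne_top (b := ENNReal.ofReal C * ∑' α : Fin n →₀ ℕ, 2⁻¹ ^ α.degree)
    (ENNReal.mul_ne_top ENNReal.ofReal_ne_top (tsum_inv_two_pow_degree_ne_top n)) ?_
  rw [← ENNReal.tsum_mul_left]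
  refine ENNReal.tsum_le_tsum fun α => ?_
  rw [← ofReal_norm, ← ENNReal.ofReal_mul (norm_nonneg _)]
  have h2 : (2⁻¹ : ℝ≥0∞) ^ α.degree = ENNReal.ofReal (2⁻¹ ^ α.degree) := by
    rw [ENNReal.ofReal_pow (by norm_num), ENNReal.ofReal_inv_of_pos (by norm_num)]
    simp
  rw [h2, ← ENNReal.ofReal_mul hC]
  refine ENNReal.ofReal_le_ofReal ?_
  calc ‖coeff α f‖ * t ^ expWeight w α
      ≤ C * R ^ α.degree * t ^ expWeight w α := by
        have := Real.rpow_nonneg ht0.le (expWeight w α)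
        gcongr
        exact hf α
    _ = C * ∏ i, (R * t ^ w i) ^ α i := by
        rw [rpow_expWeight ht0, Finsupp.degree_eq_sum, ← Finset.prod_pow_eq_pow_sum, mul_assoc,
          ← Finset.prod_mul_distrib]
        simp only [mul_pow]
    _ ≤ C * ∏ i, (2⁻¹ : ℝ) ^ α i := by
        gcongr with i _
        exact ht i
    _ = C * 2⁻¹ ^ α.degree := by
        rw [Finset.prod_pow_eq_pow_sum, Finsupp.degree_eq_sum]

lemma isConvergentSeries_of_tsum_ne_top {f : MvPowerSeries (Fin n) ℂ} {w : Fin n → ℝ} {t : ℝ}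
    (ht : 0 < t) (ht1 : t < 1) (hw : ∀ i, 0 ≤ w i)
    (h : ∑' α, ‖coeff α f‖ₑ * ENNReal.ofReal (t ^ expWeight w α) ≠ ⊤) :
    IsConvergentSeries f := by
  set S := ∑' α, ‖coeff α f‖ₑ * ENNReal.ofReal (t ^ expWeight w α) with hS
  refine ⟨S.toReal, (t ^ (∑ i, w i))⁻¹, ENNReal.toReal_nonneg,
    inv_nonneg.2 (Real.rpow_nonneg ht.le _), fun α => ?_⟩
  have h1 : ‖coeff α f‖ₑ * ENNReal.ofReal (t ^ expWeight w α) ≤ S := ENNReal.le_tsum α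
  rw [← ofReal_norm, ← ENNReal.ofReal_mul (norm_nonneg _), ENNReal.ofReal_le_iff_le_toReal h] at h1
  have hpos : 0 < (t ^ (∑ i, w i)) ^ α.degree := by positivity
  rw [inv_pow, ← div_eq_mul_inv, le_div_iff₀ hpos]
  refine le_trans ?_ h1
  gcongr
  rw [← Real.rpow_natCast, ← Real.rpow_mul ht.le]
  refine Real.rpow_le_rpow_of_exponent_ge ht ht1.le ?_
  rw [expWeight, Finset.sum_mul]
  refine Finset.sum_le_sum fun i _ => ?_
  gcongr
  · exact hw i
  · exact Finsupp.le_degree i α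

variable [Fintype B]

lemma weightedNorm_rpowWeight_eq (w : Fin n → ℝ) (ω : B → ℝ) {t : ℝ} (ht : 0 < t)
    (c : (Fin n →₀ ℕ) × B → ℂ) :
    weightedNorm (rpowWeight w ω t) c = ∑ b, ENNReal.ofReal (t ^ (-ω b)) *
      ∑' α, ‖c (α, b)‖ₑ * ENNReal.ofReal (t ^ expWeight w α) := by
  rw [weightedNorm, ← (Equiv.prodComm B (Fin n →₀ ℕ)).tsum_eq, ENNReal.tsum_prod', tsum_fintype]
  refine Finset.sum_congr rfl fun b _ => ?_
  rw [← ENNReal.tsum_mul_left]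
  refine tsum_congr fun α => ?_
  rw [Equiv.prodComm_apply, Prod.swap_prod_mk, mul_left_comm]
  congr 1
  rw [rpowWeight, ← ENNReal.ofReal_mul (Real.rpow_nonneg ht.le _), ← Real.rpow_add ht]
  congr 2
  ring

lemma eventually_weightedNorm_ne_top {w : Fin n → ℝ} (hw : ∀ i, 0 < w i) (ω : B → ℝ)
    {F : B → MvPowerSeries (Fin n) ℂ} (hF : ∀ b, IsConvergentSeries (F b)) :
    ∀ᶠ t : ℝ in 𝓝[>] 0, weightedNorm (rpowWeight w ω t) (vecCoeff F) ≠ ⊤ := by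
  have h : ∀ᶠ t : ℝ in 𝓝[>] 0, ∀ b, ∑' α, ‖coeff α (F b)‖ₑ *
      ENNReal.ofReal (t ^ expWeight w α) ≠ ⊤ :=
    eventually_all.2 fun b => (hF b).eventually_tsum_ne_top hw
  filter_upwards [h, self_mem_nhdsWithin] with t ht ht0
  rw [weightedNorm_rpowWeight_eq w ω ht0]
  exact ENNReal.sum_ne_top.2 fun b _ => ENNReal.mul_ne_top ENNReal.ofReal_ne_top (ht b)

lemma isConvergentSeries_of_weightedNorm_ne_top {w : Fin n → ℝ} (hw : ∀ i, 0 < w i) (ω : B → ℝ)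
    {t : ℝ} (ht : 0 < t) (ht1 : t < 1) {F : B → MvPowerSeries (Fin n) ℂ}
    (h : weightedNorm (rpowWeight w ω t) (vecCoeff F) ≠ ⊤) (b : B) : IsConvergentSeries (F b) := by
  refine isConvergentSeries_of_tsum_ne_top ht ht1 (fun i => (hw i).le) fun h1 => h ?_
  rw [weightedNorm_rpowWeight_eq w ω ht, ENNReal.sum_eq_top]
  refine ⟨b, Finset.mem_univ _, ?_⟩
  change _ * ∑' α, ‖coeff α (F b)‖ₑ * _ = ⊤
  rw [h1]
  exact ENNReal.mul_top (by simpa using Real.rpow_pos_of_pos ht _)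

/-- If all exponents of a vector have weight below that of `e₀`, its norm becomes small with
respect to that of the monomial `e₀` when `t` tends to zero. -/
lemma eventually_weightedNorm_le {w : Fin n → ℝ} (hw : ∀ i, 0 < w i) (ω : B → ℝ)
    {F : B → MvPowerSeries (Fin n) ℂ} (hF : ∀ b, IsConvergentSeries (F b))
    (e₀ : (Fin n →₀ ℕ) × B)
    (hlt : ∀ e, vecCoeff F e ≠ 0 → ω e.2 - expWeight w e.1 < ω e₀.2 - expWeight w e₀.1) :
    ∀ᶠ t : ℝ in 𝓝[>] 0,
      weightedNorm (rpowWeight w ω t) (vecCoeff F) ≤ 2⁻¹ * rpowWeight w ω t e₀ := by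
  set g : (Fin n →₀ ℕ) × B → ℝ := fun e => (ω e₀.2 - expWeight w e₀.1) - (ω e.2 - expWeight w e.1)
    with hg
  have hnorm : ∀ t : ℝ, 0 < t → weightedNorm (rpowWeight w ω t) (vecCoeff F) =
      (∑' e, ENNReal.ofReal (‖vecCoeff F e‖ * t ^ g e)) * rpowWeight w ω t e₀ := by
    intro t ht
    rw [weightedNorm, ← ENNReal.tsum_mul_right]
    refine tsum_congr fun e => ?_
    rw [rpowWeight, rpowWeight, ← ofReal_norm, ← ENNReal.ofReal_mul (norm_nonneg _),
      ← ENNReal.ofReal_mul (by positivity), mul_assoc, ← Real.rpow_add ht]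
    congr 3
    simp only [hg]
    ring
  obtain ⟨t₀, ht₀, h0⟩ :=
    ((eventually_weightedNorm_ne_top hw ω hF).and self_mem_nhdsWithin).exists
  have h0 : 0 < t₀ := h0
  have hsum : Summable fun e => ‖vecCoeff F e‖ * t₀ ^ g e := by
    rw [hnorm t₀ h0] at ht₀
    have h1 : ∑' e, ENNReal.ofReal (‖vecCoeff F e‖ * t₀ ^ g e) ≠ ⊤ := fun h2 => ht₀ (by
      rw [h2, ENNReal.top_mul (rpowWeight_ne_zero w ω h0 e₀)])
    refine (ENNReal.summable_toReal h1).congr fun e => ?_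
    exact (ENNReal.toReal_ofReal (by positivity))
  have hbound : ∀ᶠ t : ℝ in 𝓝[>] 0, ∀ e,
      ‖‖vecCoeff F e‖ * t ^ g e‖ ≤ ‖vecCoeff F e‖ * t₀ ^ g e := by
    filter_upwards [self_mem_nhdsWithin, nhdsWithin_le_nhds (gt_mem_nhds h0)] with t ht htt e
    have ht : 0 < t := ht
    rw [Real.norm_of_nonneg (by positivity)]
    by_cases he : vecCoeff F e = 0
    · simp [he]
    · have := hlt e he
      gcongr
  have hlim := tendsto_tsum_of_dominated_convergence (𝓕 := 𝓝[>] (0 : ℝ)) (g := fun _ => (0 : ℝ))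
    hsum (f := fun t e => ‖vecCoeff F e‖ * t ^ g e) (fun e => by
      by_cases he : vecCoeff F e = 0
      · simp [he]
      · have := hlt e he
        simpa using (tendsto_rpow_zero (g := g e) (by simp only [hg]; linarith)).const_mul
          ‖vecCoeff F e‖) hbound
  rw [tsum_zero] at hlim
  filter_upwards [hlim.eventually (gt_mem_nhds (by norm_num : (0 : ℝ) < 2⁻¹)), hbound,
    self_mem_nhdsWithin] with t ht htb ht0
  have ht0 : 0 < t := ht0
  rw [hnorm t ht0]
  gcongr
  rw [← ENNReal.ofReal_tsum_of_nonneg (fun e => by positivity)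
    (hsum.of_nonneg_of_le (fun e => by positivity) fun e => (le_abs_self _).trans (htb e))]
  refine (ENNReal.ofReal_le_ofReal ht.le).trans_eq ?_
  rw [ENNReal.ofReal_inv_of_pos (by norm_num)]
  simp

end Weights

end Division

/-! ### Division of vectors of convergent power series -/

section Division

open scoped ENNReal
open Filter Topology MvPowerSeries

section Reduction

variable {n : ℕ} {B Λ : Type*}

/-- A convergent power series, as an element of `𝒪`. -/
def ConvSeries.mk (f : MvPowerSeries (Fin n) ℂ) (hf : IsConvergentSeries f) : ConvSeries n :=
  (⟨f, hf⟩ : convergentSeries n)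

lemma toSeries_mk (f : MvPowerSeries (Fin n) ℂ) (hf : IsConvergentSeries f) :
    ConvSeries.toSeries n (ConvSeries.mk f hf) = f := rfl

lemma tsum_enorm_coeff_mul_le (w : Fin n → ℝ) {t : ℝ} (ht : 0 < t)
    (q f : MvPowerSeries (Fin n) ℂ) :
    ∑' α, ‖coeff α (q * f)‖ₑ * ENNReal.ofReal (t ^ expWeight w α) ≤
      (∑' α, ‖coeff α q‖ₑ * ENNReal.ofReal (t ^ expWeight w α)) *
        ∑' α, ‖coeff α f‖ₑ * ENNReal.ofReal (t ^ expWeight w α) := by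
  classical
  rw [← ENNReal.tsum_mul_right]
  simp only [← ENNReal.tsum_mul_left]
  rw [← ENNReal.tsum_prod (f := fun α β => ‖coeff α q‖ₑ * ENNReal.ofReal (t ^ expWeight w α) *
      (‖coeff β f‖ₑ * ENNReal.ofReal (t ^ expWeight w β))),
    ← (Finset.HasAntidiagonal.sigmaAntidiagonalEquivProd (A := Fin n →₀ ℕ)).tsum_eq, ENNReal.tsum_sigma']
  refine ENNReal.tsum_le_tsum fun α => ?_
  refine le_trans ?_ (Finset.tsum_subtype (Finset.HasAntidiagonal.antidiagonal α)
    fun p : (Fin n →₀ ℕ) × (Fin n →₀ ℕ) => ‖coeff p.1 q‖ₑ * ENNReal.ofReal (t ^ expWeight w p.1) *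
      (‖coeff p.2 f‖ₑ * ENNReal.ofReal (t ^ expWeight w p.2))).ge
  rw [coeff_mul]
  refine (mul_le_mul_left (enorm_sum_le _ _) _).trans ?_
  rw [Finset.sum_mul]
  refine Finset.sum_le_sum fun p hp => ?_
  have hp' : p.1 + p.2 = α := by simpa using hp
  rw [enorm_mul, ← hp', expWeight_add, Real.rpow_add ht,
    ENNReal.ofReal_mul (Real.rpow_nonneg ht.le _)]
  exact le_of_eq (by ring)

lemma weightedNorm_mul_le [Fintype B] (w : Fin n → ℝ) (ω : B → ℝ) {t : ℝ} (ht : 0 < t)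
    (q : MvPowerSeries (Fin n) ℂ) (F : B → MvPowerSeries (Fin n) ℂ) :
    weightedNorm (rpowWeight w ω t) (vecCoeff fun b => q * F b) ≤
      (∑' α, ‖coeff α q‖ₑ * ENNReal.ofReal (t ^ expWeight w α)) *
        weightedNorm (rpowWeight w ω t) (vecCoeff F) := by
  rw [weightedNorm_rpowWeight_eq w ω ht, weightedNorm_rpowWeight_eq w ω ht, Finset.mul_sum]
  refine Finset.sum_le_sum fun b _ => ?_
  rw [mul_left_comm]
  gcongr
  exact tsum_enorm_coeff_mul_le w ht q (F b)

open Classical in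
/-- The series whose coefficient at `α` is that of `c` at the exponent `(a + α, b)`, if the latter
belongs to `D`. -/
noncomputable def quotientSeries (a : Fin n →₀ ℕ) (b : B) (D : Set ((Fin n →₀ ℕ) × B)) :
    ((Fin n →₀ ℕ) × B → ℂ) →ₗ[ℂ] MvPowerSeries (Fin n) ℂ where
  toFun c := fun α => if (a + α, b) ∈ D then c (a + α, b) else 0
  map_add' c d := MvPowerSeries.ext fun α => by
    change (if (a + α, b) ∈ D then (c + d) (a + α, b) else 0) =
      (if (a + α, b) ∈ D then c (a + α, b) else 0) + (if (a + α, b) ∈ D then d (a + α, b) else 0)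
    split_ifs <;> simp
  map_smul' z c := MvPowerSeries.ext fun α => by
    change (if (a + α, b) ∈ D then (z • c) (a + α, b) else 0) =
      z * (if (a + α, b) ∈ D then c (a + α, b) else 0)
    split_ifs <;> simp

open Classical in
lemma coeff_quotientSeries (a : Fin n →₀ ℕ) (b : B) (D : Set ((Fin n →₀ ℕ) × B))
    (c : (Fin n →₀ ℕ) × B → ℂ) (α : Fin n →₀ ℕ) :
    coeff α (quotientSeries a b D c) = if (a + α, b) ∈ D then c (a + α, b) else 0 := rfl

open Classical in
/-- The products of the quotients by the monomials `(a_l, b_l)` have together a norm bounded by that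
of the dividend, as the parts `D l` of the dividend are disjoint. -/
lemma sum_quotientSeries_le [Fintype Λ] (w : Fin n → ℝ) (ω : B → ℝ) {t : ℝ} (ht : 0 < t)
    (a : Λ → Fin n →₀ ℕ) (b : Λ → B) (D : Λ → Set ((Fin n →₀ ℕ) × B))
    (hD : ∀ l l' e, e ∈ D l → e ∈ D l' → l = l') (c : (Fin n →₀ ℕ) × B → ℂ) :
    ∑ l, (∑' α, ‖coeff α (quotientSeries (a l) (b l) (D l) c)‖ₑ *
        ENNReal.ofReal (t ^ expWeight w α)) * rpowWeight w ω t (a l, b l) ≤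
      weightedNorm (rpowWeight w ω t) c := by
  calc ∑ l, (∑' α, ‖coeff α (quotientSeries (a l) (b l) (D l) c)‖ₑ *
        ENNReal.ofReal (t ^ expWeight w α)) * rpowWeight w ω t (a l, b l)
      ≤ ∑ l, ∑' e, if e ∈ D l then ‖c e‖ₑ * rpowWeight w ω t e else 0 := by
        refine Finset.sum_le_sum fun l _ => ?_
        have hinj : Function.Injective fun α : Fin n →₀ ℕ => (a l + α, b l) := fun x y h =>
          add_left_cancel (congrArg Prod.fst h)
        refine le_trans (le_of_eq ?_) (ENNReal.tsum_comp_le_tsum_of_injective hinj _)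
        rw [← ENNReal.tsum_mul_right]
        refine tsum_congr fun α => ?_
        rw [coeff_quotientSeries, mul_assoc, ← rpowWeight_add w ω ht, add_comm α]
        split_ifs <;> simp
    _ = ∑' e, ∑ l, if e ∈ D l then ‖c e‖ₑ * rpowWeight w ω t e else 0 := by
        rw [Summable.tsum_finsetSum fun _ _ => ENNReal.summable]
    _ ≤ weightedNorm (rpowWeight w ω t) c := by
        refine ENNReal.tsum_le_tsum fun e => ?_
        by_cases h : ∃ l, e ∈ D l
        · obtain ⟨l, hl⟩ := h
          rw [Finset.sum_eq_single l (fun l' _ hl' => if_neg fun h => hl' (hD _ _ _ h hl))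
            (by simp), if_pos hl]
        · push Not at h
          simp [h]

/-- **Division theorem.** The vectors `p_l` have leading exponents `(a_l, b_l)` with respect to a
linear weight, and every exponent in `Δ` is a multiple of one of them. Then each vector of
convergent series is, up to a combination of the `p_l`, a vector without exponents in `Δ`; the
reduction does not leave a set `Z` of exponents that is stable under elementary reductions. -/
theorem exists_division [Fintype B] [Fintype Λ] {w : Fin n → ℝ} (hw : ∀ i, 0 < w i) (ω : B → ℝ)
    (p : Λ → B → ConvSeries n) (a : Λ → Fin n →₀ ℕ) (b : Λ → B)
    (hlead : ∀ l, coeff (a l) (ConvSeries.toSeries n (p l (b l))) = 1)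
    (hlt : ∀ l α β, coeff α (ConvSeries.toSeries n (p l β)) ≠ 0 → (α, β) ≠ (a l, b l) →
      ω β - expWeight w α < ω (b l) - expWeight w (a l))
    (Δ : Set ((Fin n →₀ ℕ) × B)) (hΔ : ∀ e ∈ Δ, ∃ l, a l ≤ e.1 ∧ b l = e.2)
    (P : B → ConvSeries n) :
    ∃ (q : Λ → ConvSeries n) (R : B → ConvSeries n),
      (∀ β, P β = ∑ l, q l * p l β + R β) ∧
      (∀ e ∈ Δ, coeff e.1 (ConvSeries.toSeries n (R e.2)) = 0) ∧
      ∀ Z : Set ((Fin n →₀ ℕ) × B),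
        (∀ α β, coeff α (ConvSeries.toSeries n (P β)) ≠ 0 → (α, β) ∈ Z) →
        (∀ l α, (a l + α, b l) ∈ Z → ∀ α' β, coeff α' (ConvSeries.toSeries n (p l β)) ≠ 0 →
          (α + α', β) ∈ Z) →
        ∀ α β, coeff α (ConvSeries.toSeries n (R β)) ≠ 0 → (α, β) ∈ Z := by
  classical
  -- the exponents in `Δ` that are divided by the leading monomial of `p_l`
  set D : Λ → Set ((Fin n →₀ ℕ) × B) := fun l => {e | ∃ h : e ∈ Δ, (hΔ e h).choose = l} with hDdef
  have hDle : ∀ l e, e ∈ D l → a l ≤ e.1 ∧ b l = e.2 := by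
    rintro _ e ⟨h, rfl⟩
    exact (hΔ e h).choose_spec
  have hDdisj : ∀ l l' e, e ∈ D l → e ∈ D l' → l = l' := by
    rintro _ _ e ⟨h, rfl⟩ ⟨h', rfl⟩
    rfl
  have hDΔ : ∀ e, e ∈ Δ ↔ ∃ l, e ∈ D l :=
    fun e => ⟨fun h => ⟨_, h, rfl⟩, fun ⟨_, h, _⟩ => h⟩
  set Q : Λ → ((Fin n →₀ ℕ) × B → ℂ) →ₗ[ℂ] MvPowerSeries (Fin n) ℂ :=
    fun l => quotientSeries (a l) (b l) (D l) with hQdef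
  -- the vectors `p_l` without their leading terms
  set T : Λ → B → MvPowerSeries (Fin n) ℂ := fun l β =>
    ConvSeries.toSeries n (p l β) - if β = b l then MvPowerSeries.monomial (a l) 1 else 0 with hT
  have hTconv : ∀ l β, IsConvergentSeries (T l β) := by
    intro l β
    refine (convergentSeries n).sub_mem (p l β).2 ?_
    split_ifs
    · exact (ConvSeries.monomial (a l)).2
    · exact (convergentSeries n).zero_mem
  have hTcoeff : ∀ l α β, coeff α (T l β) =
      if (α, β) = (a l, b l) then 0 else coeff α (ConvSeries.toSeries n (p l β)) := by
    intro l α β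
    simp only [hT, map_sub, Prod.mk.injEq]
    by_cases h1 : β = b l
    · subst h1
      rw [if_pos rfl, coeff_monomial]
      by_cases h2 : α = a l
      · subst h2
        simp [hlead]
      · simp [h2]
    · simp [h1]
  have hTne : ∀ l α β, coeff α (T l β) ≠ 0 → (α, β) ≠ (a l, b l) ∧
      coeff α (ConvSeries.toSeries n (p l β)) ≠ 0 := by
    intro l α β h
    rw [hTcoeff] at h
    split_ifs at h with h1
    · exact absurd rfl h
    · exact ⟨h1, h⟩
  -- `c + K c` is the vector `∑ Q_l(c) p_l`, plus the part of `c` with exponents outside `Δ`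
  set K : ((Fin n →₀ ℕ) × B → ℂ) →ₗ[ℂ] ((Fin n →₀ ℕ) × B → ℂ) :=
    { toFun := fun c => ∑ l, vecCoeff fun β => Q l c * T l β
      map_add' := fun c d => by
        rw [← Finset.sum_add_distrib]
        refine Finset.sum_congr rfl fun l _ => funext fun e => ?_
        simp [vecCoeff, add_mul]
      map_smul' := fun z c => by
        rw [Finset.smul_sum]
        refine Finset.sum_congr rfl fun l _ => funext fun e => ?_
        simp [vecCoeff] } with hK
  have hKapply : ∀ c e, K c e = ∑ l, coeff e.1 (Q l c * T l e.2) := by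
    intro c e
    change (∑ l, vecCoeff fun β => Q l c * T l β) e = _
    rw [Finset.sum_apply]
    rfl
  -- for `t` small enough, the operator `K` has norm at most `1/2`
  have hsmall : ∀ᶠ t : ℝ in 𝓝[>] 0, t < 1 := nhdsWithin_le_nhds (gt_mem_nhds one_pos)
  obtain ⟨t, ⟨hPt, hTt⟩, ht1, ht0⟩ := (((eventually_weightedNorm_ne_top hw ω
      (F := fun β => ConvSeries.toSeries n (P β)) fun β => (P β).2).and
    (eventually_all.2 fun l => eventually_weightedNorm_le hw ω (hTconv l) (a l, b l) (by
      rintro ⟨α, β⟩ h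
      obtain ⟨h1, h2⟩ := hTne l α β h
      exact hlt l α β h2 h1))).and (hsmall.and self_mem_nhdsWithin)).exists
  have ht0 : 0 < t := ht0
  have hKnorm : ∀ c, weightedNorm (rpowWeight w ω t) (K c) ≤
      2⁻¹ * weightedNorm (rpowWeight w ω t) c := by
    intro c
    calc weightedNorm (rpowWeight w ω t) (K c)
        ≤ ∑ l, weightedNorm (rpowWeight w ω t) (vecCoeff fun β => Q l c * T l β) :=
          weightedNorm_sum_le _ _ _
      _ ≤ ∑ l, (∑' α, ‖coeff α (Q l c)‖ₑ * ENNReal.ofReal (t ^ expWeight w α)) *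
            (2⁻¹ * rpowWeight w ω t (a l, b l)) := by
          refine Finset.sum_le_sum fun l _ => (weightedNorm_mul_le w ω ht0 _ _).trans ?_
          gcongr
          exact hTt l
      _ = 2⁻¹ * ∑ l, (∑' α, ‖coeff α (Q l c)‖ₑ * ENNReal.ofReal (t ^ expWeight w α)) *
            rpowWeight w ω t (a l, b l) := by
          rw [Finset.mul_sum]
          exact Finset.sum_congr rfl fun l _ => by ring
      _ ≤ 2⁻¹ * weightedNorm (rpowWeight w ω t) c := by
          gcongr
          exact sum_quotientSeries_le w ω ht0 a b D hDdisj c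
  obtain ⟨c, hcP, hcnorm, hcZ⟩ := exists_add_map_eq (rpowWeight_ne_zero w ω ht0)
    K hKnorm hPt
  have hqconv : ∀ l, IsConvergentSeries (Q l c) := by
    intro l
    refine isConvergentSeries_of_tsum_ne_top ht0 ht1 (fun i => (hw i).le) fun htop => hcnorm ?_
    rw [← top_le_iff]
    refine le_trans ?_ (sum_quotientSeries_le w ω ht0 a b D hDdisj c)
    refine le_trans ?_ (Finset.single_le_sum (fun _ _ => zero_le) (Finset.mem_univ l))
    rw [htop, ENNReal.top_mul (rpowWeight_ne_zero w ω ht0 _)]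
  set R : B → MvPowerSeries (Fin n) ℂ := fun β α => if (α, β) ∈ Δ then 0 else c (α, β) with hR
  have hRcoeff : ∀ α β, coeff α (R β) = if (α, β) ∈ Δ then 0 else c (α, β) := fun _ _ => rfl
  have hRconv : ∀ β, IsConvergentSeries (R β) := by
    refine isConvergentSeries_of_weightedNorm_ne_top hw ω ht0 ht1
      (ne_top_of_le_ne_top hcnorm (ENNReal.tsum_le_tsum fun e => ?_))
    gcongr
    rw [vecCoeff, hRcoeff]
    split_ifs <;> simp
  refine ⟨fun l => ConvSeries.mk (Q l c) (hqconv l),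
    fun β => ConvSeries.mk (R β) (hRconv β), fun β => ?_, ?_, ?_⟩
  · apply toSeries_injective
    rw [map_add, map_sum]
    simp only [map_mul, toSeries_mk]
    refine MvPowerSeries.ext fun α => ?_
    rw [map_add, map_sum, hRcoeff]
    have h1 : ∀ l, coeff α (Q l c * ConvSeries.toSeries n (p l β)) =
        coeff α (Q l c * T l β) + if (α, β) ∈ D l then c (α, β) else 0 := by
      intro l
      have h2 : ConvSeries.toSeries n (p l β) =
          T l β + if β = b l then MvPowerSeries.monomial (a l) 1 else 0 := by
        simp [hT]
      rw [h2, mul_add, map_add]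
      congr 1
      by_cases h3 : β = b l
      · subst h3
        rw [if_pos rfl, coeff_mul_monomial, mul_one]
        by_cases h4 : a l ≤ α
        · rw [if_pos h4, coeff_quotientSeries, add_tsub_cancel_of_le h4]
          split_ifs <;> rfl
        · rw [if_neg h4, if_neg fun h => h4 (hDle l _ h).1]
      · rw [if_neg h3, mul_zero, map_zero, if_neg fun h => h3 (hDle l _ h).2.symm]
    have h2 : ∑ l, (if (α, β) ∈ D l then c (α, β) else 0) =
        if (α, β) ∈ Δ then c (α, β) else 0 := by
      by_cases h : (α, β) ∈ Δ
      · obtain ⟨l, hl⟩ := (hDΔ _).1 h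
        rw [Finset.sum_eq_single l (fun l' _ hl' => if_neg fun h => hl' (hDdisj _ _ _ h hl))
          (by simp), if_pos hl, if_pos h]
      · rw [if_neg h]
        exact Finset.sum_eq_zero fun l _ => if_neg fun hl => h ((hDΔ _).2 ⟨l, hl⟩)
    have h3 := congrFun hcP (α, β)
    rw [Pi.add_apply, hKapply] at h3
    change _ = coeff α (ConvSeries.toSeries n (P β)) at h3
    simp only [h1]
    rw [Finset.sum_add_distrib, h2, ← h3]
    split_ifs <;> ring
  · rintro ⟨α, β⟩ h
    exact if_pos h
  · intro Z hPZ hZ α β h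
    by_contra hcon
    apply h
    have h1 := hcZ Z (fun e he => by
      by_contra h2
      exact he (hPZ e.1 e.2 h2)) (by
      intro d hd e he
      rw [hKapply]
      refine Finset.sum_eq_zero fun l _ => ?_
      rw [coeff_mul]
      refine Finset.sum_eq_zero fun x hx => ?_
      by_contra h2
      have h3 := hTne l x.2 e.2 (right_ne_zero_of_mul h2)
      have h4 : coeff x.1 (Q l d) ≠ 0 := left_ne_zero_of_mul h2
      rw [coeff_quotientSeries] at h4
      split_ifs at h4 with h5
      · have h6 : (a l + x.1, b l) ∈ Z := by
          by_contra h7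
          exact h4 (hd _ h7)
        have h7 := hZ l x.1 h6 x.2 e.2 h3.2
        rw [Finset.HasAntidiagonal.mem_antidiagonal.1 hx] at h7
        exact he h7
      · exact h4 rfl) (α, β) hcon
    change (if (α, β) ∈ Δ then 0 else c (α, β)) = 0
    split_ifs
    · rfl
    · exact h1

end Reduction

end Division

/-! ### Dickson's lemma and generic weights -/

section Dickson

/-- The minimal elements of a subset of a well-quasi-order are finite in number. -/
lemma exists_finite_lower_set {A : Type*} [PartialOrder A] [WellQuasiOrderedLE A] (X : Set A) :
    ∃ T ⊆ X, T.Finite ∧ ∀ x ∈ X, ∃ t ∈ T, t ≤ x := by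
  refine ⟨{t | Minimal (· ∈ X) t}, fun t ht => ht.1,
    WellQuasiOrderedLE.finite_of_isAntichain (setOfPred_minimal_antichain _), fun x hx => ?_⟩
  obtain ⟨t, ht, h⟩ := exists_minimal_le_of_wellFoundedLT (· ∈ X) x hx
  exact ⟨t, h, ht⟩

/-- Dickson's lemma for a family `g` of elements of a well-quasi-order, labelled by finitely many
labels `c`. -/
lemma exists_finite_lower_family {ι A C : Type*} [PartialOrder A] [WellQuasiOrderedLE A]
    (X : Set ι) (g : ι → A) (c : ι → C) (hc : (c '' X).Finite) :
    ∃ T ⊆ X, T.Finite ∧ ∀ x ∈ X, ∃ t ∈ T, c t = c x ∧ g t ≤ g x := by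
  classical
  have h : ∀ b : C, ∃ T ⊆ X, T.Finite ∧ ∀ x ∈ X, c x = b → ∃ t ∈ T, c t = b ∧ g t ≤ g x := by
    intro b
    obtain ⟨T', hT', hfin', hle⟩ := Set.exists_subset_image_finite_and.1
      (exists_finite_lower_set (g '' {x ∈ X | c x = b}))
    refine ⟨T', fun t ht => (hT' ht).1, hfin', fun x hx hxb => ?_⟩
    obtain ⟨_, ⟨t, ht, rfl⟩, h⟩ := hle (g x) ⟨x, ⟨hx, hxb⟩, rfl⟩
    exact ⟨t, ht, (hT' ht).2, h⟩
  choose T hT hfin hle using h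
  refine ⟨⋃ b ∈ c '' X, T b, Set.iUnion₂_subset fun b _ => hT b, hc.biUnion fun b _ => hfin b,
    fun x hx => ?_⟩
  obtain ⟨t, ht, h1, h2⟩ := hle (c x) x hx rfl
  exact ⟨t, Set.mem_biUnion ⟨x, hx, rfl⟩ ht, h1, h2⟩

lemma exists_max_of_total {ι : Type*} {R : ι → ι → Prop} (hR : ∀ x y, R x y ∨ R y x)
    (htr : ∀ x y z, R x y → R y z → R x z) (T : Finset ι) (hT : T.Nonempty) :
    ∃ m ∈ T, ∀ t ∈ T, R t m := by
  induction hT using Finset.Nonempty.cons_induction with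
  | singleton a => exact ⟨a, by simp, fun t ht => by
      rw [Finset.mem_singleton] at ht
      subst ht
      exact (hR t t).elim id id⟩
  | cons a s ha _ ih =>
    obtain ⟨m, hm, h⟩ := ih
    rcases hR a m with h1 | h1
    · refine ⟨m, by simp [hm], fun t ht => ?_⟩
      rcases Finset.mem_cons.1 ht with rfl | ht
      · exact h1
      · exact h t ht
    · refine ⟨a, by simp, fun t ht => ?_⟩
      rcases Finset.mem_cons.1 ht with rfl | ht
      · exact (hR t t).elim id id
      · exact htr _ _ _ (h t ht) h1

end Dickson

section LinearWeights

/-- The exponents `(α, β, j)` of the monomials `x^α ∂^β e_j` of `𝒟ʳ`. -/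
abbrev OpExponent (n r : ℕ) : Type := (Fin n →₀ ℕ) × (Fin n →₀ ℕ) × Fin r

variable {n r : ℕ}

/-- The weight of a monomial `x^α ∂^β e_j` for which `xᵢ` has weight `-wᵢ`, `∂ᵢ` has weight `vᵢ`
and `e_j` has weight `c_j`. -/
noncomputable def linWeight (w v : Fin n → ℝ) (c : Fin r → ℝ) (e : OpExponent n r) : ℝ :=
  expWeight v e.2.1 + c e.2.2 - expWeight w e.1

lemma exists_rat_mul_gt {x : ℝ} (hx : x ≠ 0) (M : ℝ) : ∃ u : ℚ, u ≠ 0 ∧ M < u * x := by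
  rcases lt_or_gt_of_ne hx with h | h
  · obtain ⟨N, hN⟩ := exists_nat_gt (M / (-x))
    refine ⟨-(N + 1), neg_ne_zero.2 (by positivity), ?_⟩
    rw [div_lt_iff₀ (by linarith)] at hN
    push_cast
    linarith
  · obtain ⟨N, hN⟩ := exists_nat_gt (M / x)
    refine ⟨N + 1, by positivity, ?_⟩
    rw [div_lt_iff₀ h] at hN
    push_cast
    linarith

open Cardinal in
/-- There is a weight taking distinct values at distinct monomials, for which the weights of the
`xᵢ` are negative and those of the `xᵢ ∂ᵢ` are positive. -/
lemma exists_generic_linWeight (n r : ℕ) : ∃ (w v : Fin n → ℝ) (c : Fin r → ℝ),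
    (∀ i, 0 < w i) ∧ (∀ i, w i < v i) ∧
      Function.Injective (linWeight w v c) := by
  classical
  -- rational multiples of `ℚ`-linearly independent real numbers
  obtain ⟨f, hf⟩ : ∃ f : Fin n ⊕ Fin n ⊕ Fin r → ℝ, LinearIndependent ℚ f := by
    have h : ((Fintype.card (Fin n ⊕ Fin n ⊕ Fin r) : ℕ) : Cardinal) ≤ Module.rank ℚ ℝ := by
      rw [Real.rank_rat_real]
      exact (Cardinal.nat_lt_continuum _).le
    obtain ⟨f, hf⟩ := exists_linearIndependent_of_le_rank h
    exact ⟨f ∘ Fintype.equivFin _, hf.comp _ (Fintype.equivFin _).injective⟩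
  choose a ha0 ha using fun i => exists_rat_mul_gt (hf.ne_zero (Sum.inl i)) 0
  choose b hb0 hb using fun i =>
    exists_rat_mul_gt (hf.ne_zero (Sum.inr (Sum.inl i))) (a i * f (Sum.inl i))
  refine ⟨fun i => a i * f (Sum.inl i), fun i => b i * f (Sum.inr (Sum.inl i)),
    fun j => f (Sum.inr (Sum.inr j)), ha, hb, ?_⟩
  rintro ⟨α, β, j⟩ ⟨α', β', j'⟩ h
  have h0 := Fintype.linearIndependent_iff.1 hf
    (Sum.elim (fun i => a i * ((α' i : ℚ) - α i)) (Sum.elim (fun i => b i * ((β i : ℚ) - β' i))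
      fun l => (if l = j then 1 else 0) - (if l = j' then 1 else 0))) (by
    simp only [linWeight, expWeight] at h
    simp only [Fintype.sum_sum_type, Sum.elim_inl, Sum.elim_inr, Rat.smul_def, Rat.cast_mul,
      Rat.cast_sub, Rat.cast_natCast, sub_mul, mul_sub, Finset.sum_sub_distrib, apply_ite (Rat.cast : ℚ → ℝ),
      Rat.cast_one, Rat.cast_zero, ite_mul, one_mul, zero_mul, Finset.sum_ite_eq',
      Finset.mem_univ, if_true]
    have h1 : ∀ (u : Fin n → ℚ) (g : Fin n → ℝ) (x : Fin n →₀ ℕ),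
        ∑ i, (u i : ℝ) * (x i : ℝ) * g i = ∑ i, (u i : ℝ) * g i * (x i : ℝ) := fun u g x =>
      Finset.sum_congr rfl fun i _ => by ring
    rw [h1, h1, h1, h1]
    linarith)
  have e1 : α = α' := by
    ext i
    have := h0 (Sum.inl i)
    simp only [Sum.elim_inl, mul_eq_zero, ha0 i, false_or, sub_eq_zero] at this
    exact_mod_cast this.symm
  have e2 : β = β' := by
    ext i
    have := h0 (Sum.inr (Sum.inl i))
    simp only [Sum.elim_inl, Sum.elim_inr, mul_eq_zero, hb0 i, false_or, sub_eq_zero] at this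
    exact_mod_cast this
  have e3 : j = j' := by
    by_contra hne
    have := h0 (Sum.inr (Sum.inr j))
    simp [hne] at this
  rw [e1, e2, e3]

end LinearWeights

/-! ### Exponents of vectors of differential operators -/

section Exponents

open MvPowerSeries

variable {n k r : ℕ}

/-- The coefficient of the monomial `x^α ∂^β e_j`. -/
noncomputable def opCoeff (P : Fin r → DiffOp n) (e : OpExponent n r) : ℂ :=
  coeff e.1 (ConvSeries.toSeries n (DiffOp.coeffs (P e.2.2) e.2.1))

lemma opCoeff_smul (c : ℂ) (P : Fin r → DiffOp n) (e : OpExponent n r) :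
    opCoeff (c • P) e = c * opCoeff P e := by
  simp [opCoeff]

lemma coeffs_ext {P Q : Fin r → DiffOp n}
    (h : ∀ j β, DiffOp.coeffs (P j) β = DiffOp.coeffs (Q j) β) : P = Q :=
  funext fun j => DiffOp.coeffs.injective (Finsupp.ext (h j))

lemma opCoeff_ext {P Q : Fin r → DiffOp n} (h : ∀ e, opCoeff P e = opCoeff Q e) : P = Q :=
  coeffs_ext fun j β => toSeries_injective (MvPowerSeries.ext fun α => h (α, β, j))

lemma opCoeff_zero (e : OpExponent n r) : opCoeff (0 : Fin r → DiffOp n) e = 0 := by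
  simp [opCoeff]

/-- The order in `ℤᵏ` of the monomial `x^α ∂^β e_j` for the shifted multifiltration. -/
def vOrder (hkn : k ≤ n) (shift : Fin r → Fin k → ℤ) (e : OpExponent n r) : Fin k → ℤ :=
  fun i => (e.2.1 (Fin.castLE hkn i) : ℤ) - e.1 (Fin.castLE hkn i) + shift e.2.2 i

lemma mem_shiftedMultiV_iff {hkn : k ≤ n} {shift : Fin r → Fin k → ℤ} {s : Fin k → ℤ}
    {P : Fin r → DiffOp n} :
    P ∈ shiftedMultiV hkn shift s ↔ ∀ e, opCoeff P e ≠ 0 → vOrder hkn shift e ≤ s := by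
  simp only [shiftedMultiV, Submodule.mem_pi, Set.mem_univ, true_imp_iff, multiV,
    Submodule.mem_iInf, mem_vFiltration_iff]
  constructor
  · rintro h ⟨α, β, j⟩ he i
    have := h j i α β he
    simp only [Pi.sub_apply] at this
    simp only [vOrder]
    linarith
  · intro h j i α β he
    have := h (α, β, j) he i
    simp only [vOrder] at this
    simp only [Pi.sub_apply]
    linarith

/-- The operators of order at most `d`. -/
def HasOrderLE (d : ℕ) (P : Fin r → DiffOp n) : Prop :=
  ∀ e, opCoeff P e ≠ 0 → e.2.1.degree ≤ d

lemma exists_hasOrderLE (P : Fin r → DiffOp n) : ∃ d, HasOrderLE d P := by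
  classical
  refine ⟨∑ j, ∑ β ∈ (DiffOp.coeffs (P j)).support, β.degree, fun e he => ?_⟩
  have h1 : e.2.1 ∈ (DiffOp.coeffs (P e.2.2)).support := by
    rw [Finsupp.mem_support_iff]
    intro h
    simp [opCoeff, h] at he
  exact (Finset.single_le_sum (f := fun β : Fin n →₀ ℕ => β.degree) (fun _ _ => Nat.zero_le _)
    h1).trans (Finset.single_le_sum
      (f := fun j => ∑ β ∈ (DiffOp.coeffs (P j)).support, β.degree)
      (fun _ _ => Nat.zero_le _) (Finset.mem_univ e.2.2))

lemma HasOrderLE.mono {d d' : ℕ} (h : d ≤ d') {P : Fin r → DiffOp n} (hP : HasOrderLE d P) :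
    HasOrderLE d' P := fun e he => (hP e he).trans h

lemma partialCoeffs_apply_add (i : Fin n) (p : (Fin n →₀ ℕ) →₀ ConvSeries n) (β : Fin n →₀ ℕ) :
    partialCoeffs i p (β + Finsupp.single i 1) =
      partialOp n i (p (β + Finsupp.single i 1)) + p β := by
  rw [partialCoeffs, Finsupp.add_apply, Finsupp.mapRange_apply,
    Finsupp.mapDomain_apply (add_left_injective _)]

lemma partialCoeffs_apply_of_eq_zero (i : Fin n) (p : (Fin n →₀ ℕ) →₀ ConvSeries n)
    {β : Fin n →₀ ℕ} (h : β i = 0) : partialCoeffs i p β = partialOp n i (p β) := by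
  rw [partialCoeffs, Finsupp.add_apply, Finsupp.mapRange_apply,
    Finsupp.mapDomain_of_notMem_range, add_zero]
  rintro ⟨γ, rfl⟩
  simp at h

lemma opCoeff_partial_smul_add (i : Fin n) (P : Fin r → DiffOp n) (α β : Fin n →₀ ℕ) (j : Fin r) :
    opCoeff (DiffOp.partial i • P) (α, β + Finsupp.single i 1, j) =
      opCoeff P (α + Finsupp.single i 1, β + Finsupp.single i 1, j) * (α i + 1) +
        opCoeff P (α, β, j) := by
  simp only [opCoeff, Pi.smul_apply, smul_eq_mul, DiffOp.coeffs_partial_mul,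
    partialCoeffs_apply_add, map_add, coeff_toSeries_partialOp]

lemma opCoeff_partial_smul_of_eq_zero (i : Fin n) (P : Fin r → DiffOp n) (α : Fin n →₀ ℕ)
    {β : Fin n →₀ ℕ} (h : β i = 0) (j : Fin r) :
    opCoeff (DiffOp.partial i • P) (α, β, j) =
      opCoeff P (α + Finsupp.single i 1, β, j) * (α i + 1) := by
  simp only [opCoeff, Pi.smul_apply, smul_eq_mul, DiffOp.coeffs_partial_mul,
    partialCoeffs_apply_of_eq_zero i _ h, coeff_toSeries_partialOp]

/-- An exponent of `∂ᵢ P` comes from an exponent of `P` either by differentiating a coefficient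
or by multiplying by `∂ᵢ`. -/
lemma exists_of_opCoeff_partial_smul_ne_zero {i : Fin n} {P : Fin r → DiffOp n}
    {e : OpExponent n r} (h : opCoeff (DiffOp.partial i • P) e ≠ 0) :
    opCoeff P (e.1 + Finsupp.single i 1, e.2.1, e.2.2) ≠ 0 ∨
      ∃ β, e.2.1 = β + Finsupp.single i 1 ∧ opCoeff P (e.1, β, e.2.2) ≠ 0 := by
  obtain ⟨α, β, j⟩ := e
  by_cases hβ : β i = 0
  · rw [opCoeff_partial_smul_of_eq_zero i P α hβ] at h
    exact Or.inl (left_ne_zero_of_mul h)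
  · have hle : Finsupp.single i 1 ≤ β := by
      rw [Finsupp.single_le_iff]
      exact Nat.one_le_iff_ne_zero.2 hβ
    obtain ⟨γ, rfl⟩ := exists_add_of_le hle
    rw [add_comm (Finsupp.single i 1) γ] at h ⊢
    rw [opCoeff_partial_smul_add] at h
    by_cases h1 : opCoeff P (α + Finsupp.single i 1, γ + Finsupp.single i 1, j) = 0
    · rw [h1, zero_mul, zero_add] at h
      exact Or.inr ⟨γ, rfl, h⟩
    · exact Or.inl h1

/-- The degree of `∂ᵢ` in `ℤᵏ`. -/
noncomputable def partialOrder (hkn : k ≤ n) (i : Fin n) : Fin k → ℤ :=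
  fun i' => (Finsupp.single i 1 : Fin n →₀ ℕ) (Fin.castLE hkn i')

lemma vOrder_add_partial (hkn : k ≤ n) (shift : Fin r → Fin k → ℤ) (i : Fin n) (α β : Fin n →₀ ℕ)
    (j : Fin r) : vOrder hkn shift (α, β + Finsupp.single i 1, j) =
      vOrder hkn shift (α, β, j) + partialOrder hkn i := by
  funext i'
  simp only [vOrder, partialOrder, Finsupp.add_apply, Pi.add_apply]
  push_cast
  ring

lemma vOrder_add_var (hkn : k ≤ n) (shift : Fin r → Fin k → ℤ) (i : Fin n) (α β : Fin n →₀ ℕ)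
    (j : Fin r) : vOrder hkn shift (α + Finsupp.single i 1, β, j) =
      vOrder hkn shift (α, β, j) - partialOrder hkn i := by
  funext i'
  simp only [vOrder, partialOrder, Finsupp.add_apply, Pi.sub_apply]
  push_cast
  ring

lemma linWeight_add_partial (w v : Fin n → ℝ) (c : Fin r → ℝ) (i : Fin n) (α β : Fin n →₀ ℕ)
    (j : Fin r) : linWeight w v c (α, β + Finsupp.single i 1, j) =
      linWeight w v c (α, β, j) + v i := by
  have h : expWeight v (Finsupp.single i 1) = v i := by
    classical
    simp [expWeight, Finsupp.single_apply]
  simp only [linWeight, expWeight_add, h]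
  ring

lemma linWeight_add_var (w v : Fin n → ℝ) (c : Fin r → ℝ) (i : Fin n) (α β : Fin n →₀ ℕ)
    (j : Fin r) : linWeight w v c (α + Finsupp.single i 1, β, j) =
      linWeight w v c (α, β, j) - w i := by
  have h : expWeight w (Finsupp.single i 1) = w i := by
    classical
    simp [expWeight, Finsupp.single_apply]
  simp only [linWeight, expWeight_add, h]
  ring

/-- The monomial `e` is the leading monomial of `P`: its weight is larger than those of the other
monomials of `P`, whose orders moreover differ from that of `e` by elements of the semigroup `S`. -/
structure IsLeading (hkn : k ≤ n) (shift : Fin r → Fin k → ℤ) (S : AddSubmonoid (Fin k → ℤ))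
    (W : OpExponent n r → ℝ) (P : Fin r → DiffOp n) (e : OpExponent n r) : Prop where
  opCoeff_eq_one : opCoeff P e = 1
  sub_mem : ∀ e', opCoeff P e' ≠ 0 → vOrder hkn shift e - vOrder hkn shift e' ∈ S
  weight_lt : ∀ e', opCoeff P e' ≠ 0 → e' ≠ e → W e' < W e

lemma IsLeading.weight_le {hkn : k ≤ n} {shift : Fin r → Fin k → ℤ} {S : AddSubmonoid (Fin k → ℤ)}
    {W : OpExponent n r → ℝ} {P : Fin r → DiffOp n} {e : OpExponent n r}
    (h : IsLeading hkn shift S W P e) {e' : OpExponent n r} (he' : opCoeff P e' ≠ 0) :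
    W e' ≤ W e := by
  by_cases hee : e' = e
  · rw [hee]
  · exact (h.weight_lt e' he' hee).le

/-- Since `wᵢ < vᵢ`, the terms where `∂ᵢ` is applied to a coefficient weigh less than those where it
is multiplied with a monomial. -/
lemma IsLeading.partial_smul {hkn : k ≤ n} {shift : Fin r → Fin k → ℤ}
    {S : AddSubmonoid (Fin k → ℤ)} {w v : Fin n → ℝ} {c : Fin r → ℝ} (hwv : ∀ i, w i < v i)
    {P : Fin r → DiffOp n} {α β : Fin n →₀ ℕ} {j : Fin r}
    (h : IsLeading hkn shift S (linWeight w v c) P (α, β, j)) (i : Fin n) :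
    IsLeading hkn shift S (linWeight w v c) (DiffOp.partial i • P)
      (α, β + Finsupp.single i 1, j) where
  opCoeff_eq_one := by
    rw [opCoeff_partial_smul_add, h.opCoeff_eq_one]
    have h1 : opCoeff P (α + Finsupp.single i 1, β + Finsupp.single i 1, j) = 0 := by
      by_contra hne
      have h2 := h.weight_le hne
      rw [linWeight_add_var, linWeight_add_partial] at h2
      linarith [hwv i]
    rw [h1, zero_mul, zero_add]
  sub_mem := by
    rintro ⟨α', β', j'⟩ he'
    rcases exists_of_opCoeff_partial_smul_ne_zero he' with h1 | ⟨γ, h2, h1⟩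
    · have h3 := h.sub_mem _ h1
      simp only [vOrder_add_var] at h3
      rw [vOrder_add_partial]
      convert! h3 using 1
      abel
    · simp only at h2 h1
      subst h2
      have h3 := h.sub_mem _ h1
      rw [vOrder_add_partial, vOrder_add_partial]
      convert! h3 using 1
      abel
  weight_lt := by
    rintro ⟨α', β', j'⟩ he' hne
    rcases exists_of_opCoeff_partial_smul_ne_zero he' with h1 | ⟨γ, h2, h1⟩
    · have h3 := h.weight_le h1
      simp only [linWeight_add_var] at h3
      rw [linWeight_add_partial]
      linarith [hwv i]
    · simp only at h2 h1
      subst h2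
      rw [linWeight_add_partial, linWeight_add_partial]
      have h3 := h.weight_lt _ h1 (by
        rintro h4
        simp only [Prod.mk.injEq] at h4
        exact hne (by rw [h4.1, h4.2.1, h4.2.2]))
      linarith

lemma HasOrderLE.partial_smul {d : ℕ} {P : Fin r → DiffOp n} (h : HasOrderLE d P) (i : Fin n) :
    HasOrderLE (d + 1) (DiffOp.partial i • P) := by
  intro e he
  rcases exists_of_opCoeff_partial_smul_ne_zero he with h1 | ⟨γ, h2, h1⟩
  · exact (h _ h1).trans (Nat.le_succ d)
  · have h3 := h _ h1
    rw [h2, map_add, Finsupp.degree_single]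
    exact Nat.succ_le_succ h3

/-- Applying derivatives to `P` adds any exponent in `∂` to its leading exponent. -/
lemma IsLeading.exists_add {hkn : k ≤ n} {shift : Fin r → Fin k → ℤ}
    {S : AddSubmonoid (Fin k → ℤ)} {w v : Fin n → ℝ} {c : Fin r → ℝ} (hwv : ∀ i, w i < v i)
    {I : Submodule (DiffOp n) (Fin r → DiffOp n)} {d : ℕ}
    {P : Fin r → DiffOp n} (hPI : P ∈ I) (hPd : HasOrderLE d P) {α β : Fin n →₀ ℕ} {j : Fin r}
    (h : IsLeading hkn shift S (linWeight w v c) P (α, β, j)) (γ : Fin n →₀ ℕ) :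
    ∃ P' ∈ I, HasOrderLE (d + γ.degree) P' ∧
      IsLeading hkn shift S (linWeight w v c) P' (α, β + γ, j) := by
  induction γ using Finsupp.induction_add_single with
  | zero => exact ⟨P, hPI, by simpa using hPd, by simpa using h⟩
  | add i γ ih =>
    obtain ⟨P', h1, h2, h3⟩ := ih
    refine ⟨DiffOp.partial i • P', I.smul_mem _ h1, ?_, ?_⟩
    · rw [map_add, Finsupp.degree_single, ← add_assoc]
      exact h2.partial_smul i
    · rw [← add_assoc]
      exact h3.partial_smul hwv i

/-- The exponents in `∂` of degree at most `d`, together with a component. -/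
abbrev BoundedExponent (n r d : ℕ) : Type := {β : Fin n →₀ ℕ // β.degree ≤ d} × Fin r

noncomputable instance (n d : ℕ) : Fintype {β : Fin n →₀ ℕ // β.degree ≤ d} :=
  (Finsupp.finite_of_degree_le (σ := Fin n) d).fintype

open Classical in
/-- The vector of operators of order at most `d` with given coefficients. -/
noncomputable def ofVector {d : ℕ} (F : BoundedExponent n r d → ConvSeries n) :
    Fin r → DiffOp n := fun j =>
  DiffOp.coeffs.symm (Finsupp.onFinset (Finsupp.finite_of_degree_le (σ := Fin n) d).toFinset
    (fun β => if h : β.degree ≤ d then F (⟨β, h⟩, j) else 0) fun β h => by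
      rw [Set.Finite.mem_toFinset]
      by_contra h1
      exact h (dif_neg h1))

open Classical in
lemma coeffs_ofVector {d : ℕ} (F : BoundedExponent n r d → ConvSeries n) (j : Fin r)
    (β : Fin n →₀ ℕ) :
    DiffOp.coeffs (ofVector F j) β = if h : β.degree ≤ d then F (⟨β, h⟩, j) else 0 := by
  rw [ofVector, LinearEquiv.apply_symm_apply, Finsupp.onFinset_apply]

lemma coeffs_sum_ofFun_smul {Λ : Type*} (s : Finset Λ) (q : Λ → ConvSeries n)
    (P : Λ → Fin r → DiffOp n) (j : Fin r) (β : Fin n →₀ ℕ) :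
    DiffOp.coeffs ((∑ l ∈ s, DiffOp.ofFun (q l) • P l) j) β =
      ∑ l ∈ s, q l * DiffOp.coeffs (P l j) β := by
  rw [Finset.sum_apply, map_sum, Finsupp.finsetSum_apply]
  refine Finset.sum_congr rfl fun l _ => ?_
  rw [Pi.smul_apply, smul_eq_mul, DiffOp.coeffs_ofFun_mul, mulCoeffs, Finsupp.mapRange_apply]

end Exponents

/-! ### Normal forms modulo a submodule of `𝒟ʳ` -/

section NormalForms

open MvPowerSeries

variable {n k r : ℕ}

/-- Operators of each bounded order `d` have unique normal forms modulo `I`, namely operators of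
order at most `d` without exponents in some set `Δ`, and passing to the normal form is compatible
with the filtration of `𝒟ʳ` defined by the semigroup `S`: the `s`-th step of the latter is spanned
by the monomials `e` with `s - vOrder e ∈ S`. -/
def HasNormalForms (hkn : k ≤ n) (shift : Fin r → Fin k → ℤ)
    (I : Submodule (DiffOp n) (Fin r → DiffOp n)) (S : AddSubmonoid (Fin k → ℤ)) : Prop :=
  ∀ d : ℕ, ∃ Δ : Set (OpExponent n r),
    (∀ R ∈ I, HasOrderLE d R → (∀ e ∈ Δ, opCoeff R e = 0) → R = 0) ∧
    ∀ (s : Fin k → ℤ) (P : Fin r → DiffOp n), HasOrderLE d P →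
      (∀ e, opCoeff P e ≠ 0 → s - vOrder hkn shift e ∈ S) →
      ∃ R, HasOrderLE d R ∧ P - R ∈ I ∧ (∀ e ∈ Δ, opCoeff R e = 0) ∧
        ∀ e, opCoeff R e ≠ 0 → s - vOrder hkn shift e ∈ S

lemma vOrder_sub_vOrder_add (hkn : k ≤ n) (shift : Fin r → Fin k → ℤ) (α α₁ α₂ : Fin n →₀ ℕ)
    (b₁ b₂ : (Fin n →₀ ℕ) × Fin r) :
    vOrder hkn shift (α₁ + α, b₁) - vOrder hkn shift (α + α₂, b₂) =
      vOrder hkn shift (α₁, b₁) - vOrder hkn shift (α₂, b₂) := by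
  funext i
  simp only [vOrder, Pi.sub_apply, Finsupp.add_apply]
  push_cast
  ring

/-- The operators `P_t` have leading exponents `t` with respect to a weight and their multiples
have all the exponents in `Δ` as leading exponents: division gives normal forms. -/
lemma exists_normalForm {hkn : k ≤ n} {shift : Fin r → Fin k → ℤ}
    {I : Submodule (DiffOp n) (Fin r → DiffOp n)} {S : AddSubmonoid (Fin k → ℤ)}
    {w v : Fin n → ℝ} {c : Fin r → ℝ} (hw : ∀ i, 0 < w i) (hwv : ∀ i, w i < v i)
    {T : Set (ℕ × OpExponent n r)} (hT : T.Finite)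
    (hTP : ∀ t ∈ T, ∃ P ∈ I, HasOrderLE t.1 P ∧
      IsLeading hkn shift S (linWeight w v c) P t.2)
    {d : ℕ} {Δ : Set (OpExponent n r)}
    (hΔ : ∀ e ∈ Δ, ∃ t ∈ T, t.2.2.2 = e.2.2 ∧ t.2.1 ≤ e.1 ∧ t.2.2.1 ≤ e.2.1 ∧
      t.1 + e.2.1.degree ≤ d + t.2.2.1.degree)
    (s : Fin k → ℤ) {P : Fin r → DiffOp n} (hP : HasOrderLE d P)
    (hPs : ∀ e, opCoeff P e ≠ 0 → s - vOrder hkn shift e ∈ S) :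
    ∃ R, HasOrderLE d R ∧ P - R ∈ I ∧ (∀ e ∈ Δ, opCoeff R e = 0) ∧
        ∀ e, opCoeff R e ≠ 0 → s - vOrder hkn shift e ∈ S := by
  classical
  -- the divisors: the derivatives of the `P_t` that are of order at most `d`
  set Λ₀ : Set ((ℕ × OpExponent n r) × BoundedExponent n r d) :=
    {l | l.1 ∈ T ∧ l.1.2.2.2 = l.2.2 ∧ l.1.2.2.1 ≤ l.2.1 ∧
      l.1.1 + (l.2.1 : Fin n →₀ ℕ).degree ≤ d + l.1.2.2.1.degree} with hΛ₀
  have hfin : Λ₀.Finite := (hT.prod Set.finite_univ).subset fun l hl => ⟨hl.1, Set.mem_univ _⟩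
  have : Fintype Λ₀ := hfin.fintype
  have hdiv : ∀ l : Λ₀, ∃ P' ∈ I, HasOrderLE d P' ∧ IsLeading hkn shift S (linWeight w v c) P'
      (l.1.1.2.1, (l.1.2.1 : Fin n →₀ ℕ), l.1.2.2) := by
    rintro ⟨⟨⟨d', α, β, j⟩, ⟨β', hβ'⟩, j'⟩, ht, hj, hle, hd⟩
    simp only at hj hle hd ⊢
    subst hj
    obtain ⟨P', h1, h2, h3⟩ := hTP _ ht
    obtain ⟨γ, rfl⟩ := exists_add_of_le hle
    obtain ⟨P'', h4, h5, h6⟩ := h3.exists_add hwv h1 h2 γ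
    rw [map_add] at hd
    exact ⟨P'', h4, h5.mono (by simp only; omega), h6⟩
  choose p hpI hpd hplead using hdiv
  obtain ⟨q, R, hPR, hRΔ, hRZ⟩ := exists_division hw
    (fun b : BoundedExponent n r d => expWeight v b.1 + c b.2)
    (fun (l : Λ₀) b => DiffOp.coeffs (p l b.2) b.1) (fun l => l.1.1.2.1) (fun l => l.1.2)
    (fun l => (hplead l).opCoeff_eq_one)
    (fun l α β h hne => (hplead l).weight_lt (α, β.1, β.2) h fun h1 => hne (by
      simp only [Prod.mk.injEq] at h1 ⊢
      exact ⟨h1.1, Prod.ext (Subtype.ext h1.2.1) h1.2.2⟩))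
    {e | (e.1, (e.2.1 : Fin n →₀ ℕ), e.2.2) ∈ Δ}
    (by
      rintro ⟨α, ⟨β, hβ⟩, j⟩ he
      obtain ⟨t, ht, h1, h2, h3, h4⟩ := hΔ _ he
      exact ⟨⟨(t, (⟨β, hβ⟩, j)), ht, h1, h3, h4⟩, h2, rfl⟩)
    (fun b => DiffOp.coeffs (P b.2) b.1)
  have hRcoeff : ∀ α β j, opCoeff (ofVector R) (α, β, j) =
      if h : β.degree ≤ d then coeff α (ConvSeries.toSeries n (R (⟨β, h⟩, j))) else 0 := by
    intro α β j
    rw [opCoeff, coeffs_ofVector]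
    split_ifs with h
    · rfl
    · simp
  have hzero : ∀ {P' : Fin r → DiffOp n}, HasOrderLE d P' → ∀ j (β : Fin n →₀ ℕ), ¬β.degree ≤ d →
      DiffOp.coeffs (P' j) β = 0 := by
    intro P' hP' j β hβ
    refine toSeries_injective (MvPowerSeries.ext fun α => ?_)
    rw [map_zero, map_zero]
    by_contra hne
    exact hβ (hP' (α, β, j) hne)
  refine ⟨ofVector R, ?_, ?_, ?_, ?_⟩
  · rintro ⟨α, β, j⟩ he
    rw [hRcoeff] at he
    by_contra h
    exact he (dif_neg h)
  · have heq : P - ofVector R = ∑ l, DiffOp.ofFun (q l) • p l := by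
      rw [sub_eq_iff_eq_add]
      refine coeffs_ext fun j β => ?_
      rw [Pi.add_apply, map_add, Finsupp.add_apply, coeffs_sum_ofFun_smul, coeffs_ofVector]
      by_cases h : β.degree ≤ d
      · rw [dif_pos h]
        exact hPR (⟨β, h⟩, j)
      · rw [dif_neg h, add_zero, hzero hP j β h, Finset.sum_eq_zero]
        intro l _
        rw [hzero (hpd l) j β h, mul_zero]
    rw [heq]
    exact Submodule.sum_mem _ fun l _ => I.smul_mem _ (hpI l)
  · rintro ⟨α, β, j⟩ he
    rw [hRcoeff]
    split_ifs with h
    · exact hRΔ (α, (⟨β, h⟩, j)) he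
    · rfl
  · rintro ⟨α, β, j⟩ he
    rw [hRcoeff] at he
    split_ifs at he with h
    · refine hRZ {e | s - vOrder hkn shift (e.1, (e.2.1 : Fin n →₀ ℕ), e.2.2) ∈ S}
        (fun α β h => hPs (α, β.1, β.2) h) (fun l α hl α' β' hne => ?_) α (⟨β, h⟩, j) he
      have h1 := (hplead l).sub_mem (α', β'.1, β'.2) hne
      have h2 := S.add_mem hl h1
      rw [← vOrder_sub_vOrder_add hkn shift α] at h2
      simpa using h2
    · exact absurd rfl he

variable {hkn : k ≤ n} {shift : Fin r → Fin k → ℤ}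

lemma vOrder_le_of_le {t e : OpExponent n r} (h1 : t.1 ≤ e.1) (h2 : t.2 = e.2) :
    vOrder hkn shift e ≤ vOrder hkn shift t := by
  intro i
  have : (t.1 (Fin.castLE hkn i) : ℤ) ≤ e.1 (Fin.castLE hkn i) := by exact_mod_cast h1 _
  simp only [vOrder, h2]
  linarith

lemma linWeight_le_of_le {w v : Fin n → ℝ} {c : Fin r → ℝ} (hw : ∀ i, 0 < w i)
    {t e : OpExponent n r} (h1 : t.1 ≤ e.1) (h2 : t.2 = e.2) :
    linWeight w v c e ≤ linWeight w v c t := by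
  obtain ⟨α, hα⟩ := exists_add_of_le h1
  have h3 := expWeight_nonneg (fun i => (hw i).le) α
  simp only [linWeight, h2, hα, expWeight_add]
  linarith

lemma linWeight_lt_of_le {w v : Fin n → ℝ} {c : Fin r → ℝ} (hw : ∀ i, 0 < w i)
    {t e : OpExponent n r} (h1 : t.1 ≤ e.1) (h2 : t.2 = e.2) (hne : e ≠ t) :
    linWeight w v c e < linWeight w v c t := by
  obtain ⟨α, hα⟩ := exists_add_of_le h1
  have h0 : α ≠ 0 := by
    rintro rfl
    rw [add_zero] at hα
    exact hne (Prod.ext hα h2.symm)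
  obtain ⟨i, hi⟩ := Finsupp.ne_iff.1 h0
  have h3 : 0 < expWeight w α := by
    refine Finset.sum_pos' (fun i _ => mul_nonneg (hw i).le (Nat.cast_nonneg _))
      ⟨i, Finset.mem_univ i, mul_pos (hw i) ?_⟩
    exact_mod_cast Nat.pos_of_ne_zero hi
  simp only [linWeight, h2, hα, expWeight_add]
  linarith

/-- Up to multiplication by monomials in `x`, an operator has finitely many monomials. -/
lemma exists_finite_support_lower (P : Fin r → DiffOp n) :
    ∃ T ⊆ {e | opCoeff P e ≠ 0}, T.Finite ∧
      ∀ e, opCoeff P e ≠ 0 → ∃ t ∈ T, t.2 = e.2 ∧ t.1 ≤ e.1 := by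
  obtain ⟨d, hd⟩ := exists_hasOrderLE P
  refine exists_finite_lower_family {e | opCoeff P e ≠ 0} Prod.fst Prod.snd
    (((Finsupp.finite_of_degree_le (σ := Fin n) d).prod (Set.finite_univ (α := Fin r))).subset ?_)
  rintro _ ⟨e, he, rfl⟩
  exact ⟨hd e he, Set.mem_univ _⟩

/-- The monomial `e` is the largest monomial of `P` for the order that compares first the orders
in `ℤᵏ` by means of the semigroup `S` and then the weights `W`. -/
def IsTopExponent (hkn : k ≤ n) (shift : Fin r → Fin k → ℤ) (S : AddSubmonoid (Fin k → ℤ))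
    (W : OpExponent n r → ℝ) (P : Fin r → DiffOp n) (e : OpExponent n r) : Prop :=
  opCoeff P e ≠ 0 ∧ ∀ e', opCoeff P e' ≠ 0 →
    vOrder hkn shift e - vOrder hkn shift e' ∈ S ∧
      (vOrder hkn shift e' - vOrder hkn shift e ∈ S → e' ≠ e → W e' < W e)

/-- Only finitely many monomials of `P` compete, by Dickson's lemma, since the elements of the
quadrant belong to `S` and `x` has negative weights. -/
lemma exists_isTopExponent {S : AddSubmonoid (Fin k → ℤ)} (hS : ∀ a, 0 ≤ a → a ∈ S)
    (htot : ∀ a, a ∈ S ∨ -a ∈ S) {w v : Fin n → ℝ} {c : Fin r → ℝ} (hw : ∀ i, 0 < w i)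
    (hinj : Function.Injective (linWeight w v c)) {P : Fin r → DiffOp n} (hP : P ≠ 0) :
    ∃ e, IsTopExponent hkn shift S (linWeight w v c) P e := by
  obtain ⟨T, hTP, hTfin, hT⟩ := exists_finite_support_lower P
  have hne : T.Nonempty := by
    by_contra hcon
    rw [Set.not_nonempty_iff_eq_empty] at hcon
    refine hP (opCoeff_ext fun e => ?_)
    rw [opCoeff_zero]
    by_contra he
    obtain ⟨t, ht, -⟩ := hT e he
    rw [hcon] at ht
    exact ht
  set V := vOrder hkn shift
  set W := linWeight w v c
  -- the total preorder on the monomials, which on monomials of equivalent orders is that of `W`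
  set le : OpExponent n r → OpExponent n r → Prop := fun x y =>
    V y - V x ∈ S ∧ (V x - V y ∈ S → W x ≤ W y) with hle
  have htrans : ∀ x y z, le x y → le y z → le x z := by
    rintro x y z ⟨h1, h2⟩ ⟨h3, h4⟩
    refine ⟨by simpa using S.add_mem h3 h1, fun h5 => ?_⟩
    have h6 : V x - V y ∈ S := by simpa using S.add_mem h5 h3
    have h7 : V y - V z ∈ S := by
      have := S.add_mem h1 h5
      simpa using this
    exact (h2 h6).trans (h4 h7)
  have htotal : ∀ x y, le x y ∨ le y x := by
    intro x y
    by_cases h1 : V y - V x ∈ S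
    · by_cases h2 : V x - V y ∈ S
      · rcases le_total (W x) (W y) with h3 | h3
        · exact Or.inl ⟨h1, fun _ => h3⟩
        · exact Or.inr ⟨h2, fun _ => h3⟩
      · exact Or.inl ⟨h1, fun h => absurd h h2⟩
    · have h2 : V x - V y ∈ S := by
        have := (htot (V y - V x)).resolve_left h1
        rwa [neg_sub] at this
      exact Or.inr ⟨h2, fun h => absurd h h1⟩
  obtain ⟨m, hm, hmax⟩ := exists_max_of_total htotal htrans hTfin.toFinset (by simpa using hne)
  rw [Set.Finite.mem_toFinset] at hm
  refine ⟨m, hTP hm, fun e he => ?_⟩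
  obtain ⟨t, ht, h2, h1⟩ := hT e he
  have h3 : le e m := by
    refine htrans e t m ⟨hS _ (sub_nonneg.2 (vOrder_le_of_le h1 h2)), fun _ =>
      linWeight_le_of_le hw h1 h2⟩ (hmax t (by simpa using ht))
  exact ⟨h3.1, fun h4 hne => lt_of_le_of_ne (h3.2 h4) fun h => hne (hinj h)⟩

end NormalForms

/-! ### Normal forms for limits of cones -/

section Limits

open MvPowerSeries Filter

variable {n k r : ℕ} {hkn : k ≤ n} {shift : Fin r → Fin k → ℤ}

/-- The weights of the `n` variables defined by a linear form `L` on `ℤᵏ`: the coefficients of `L`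
for the first `k` variables, and zero for the others. -/
noncomputable def formWeight (hkn : k ≤ n) (L : DualSpace k) (i : Fin n) : ℝ :=
  ∑ i' : Fin k, if Fin.castLE hkn i' = i then ((L (Pi.single i' 1) : ℚ) : ℝ) else 0

lemma formWeight_nonneg {L : DualSpace k} (hL : L ∈ positiveQuadrant k) (i : Fin n) :
    0 ≤ formWeight hkn L i := by
  refine Finset.sum_nonneg fun i' _ => ?_
  split_ifs
  · exact_mod_cast hL i'
  · exact le_rfl

lemma expWeight_formWeight (L : DualSpace k) (α : Fin n →₀ ℕ) :
    expWeight (formWeight hkn L) α =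
      ∑ i' : Fin k, (α (Fin.castLE hkn i') : ℝ) * ((L (Pi.single i' 1) : ℚ) : ℝ) := by
  simp only [expWeight, formWeight, Finset.sum_mul, ite_mul, zero_mul]
  rw [Finset.sum_comm]
  simp [mul_comm]

/-- Weights can be perturbed so as to compare first the values of a linear form on the orders. -/
lemma linWeight_add_form (L : DualSpace k) (w v : Fin n → ℝ) (c : Fin r → ℝ) (N : ℝ)
    (e : OpExponent n r) :
    linWeight (fun i => w i + N * formWeight hkn L i) (fun i => v i + N * formWeight hkn L i)
      (fun j => c j + N * ((evalLattice L (shift j) : ℚ) : ℝ)) e =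
      linWeight w v c e + N * ((evalLattice L (vOrder hkn shift e) : ℚ) : ℝ) := by
  have h1 : ∀ (u : Fin n → ℝ) (α : Fin n →₀ ℕ),
      expWeight (fun i => u i + N * formWeight hkn L i) α =
        expWeight u α + N * expWeight (formWeight hkn L) α := by
    intro u α
    simp only [expWeight, Finset.mul_sum, ← Finset.sum_add_distrib]
    exact Finset.sum_congr rfl fun i _ => by ring
  have h2 : ((evalLattice L (vOrder hkn shift e) : ℚ) : ℝ) =
      expWeight (formWeight hkn L) e.2.1 - expWeight (formWeight hkn L) e.1 +
        ((evalLattice L (shift e.2.2) : ℚ) : ℝ) := by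
    rw [expWeight_formWeight, expWeight_formWeight]
    simp only [evalLattice, dual_eq_sum L (fun i => ((_ : ℤ) : ℚ)), vOrder]
    push_cast
    rw [← Finset.sum_sub_distrib, ← Finset.sum_add_distrib]
    exact Finset.sum_congr rfl fun i _ => by ring
  simp only [linWeight, h1, h2]
  ring

/-- The limit of a family of semigroups along an ultrafilter: the elements of almost all of them.
-/
def limitSemigroup {J : Type*} (𝒰 : Ultrafilter J) (S : J → AddSubmonoid (Fin k → ℤ)) :
    AddSubmonoid (Fin k → ℤ) where
  carrier := {a | ∀ᶠ j in 𝒰, a ∈ S j}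
  zero_mem' := Eventually.of_forall fun j => (S j).zero_mem
  add_mem' ha hb := (ha.and hb).mono fun j h => (S j).add_mem h.1 h.2

/-- The largest monomials of the operators of order at most `d` in `I`. -/
def topExponents (hkn : k ≤ n) (shift : Fin r → Fin k → ℤ)
    (I : Submodule (DiffOp n) (Fin r → DiffOp n)) (S : AddSubmonoid (Fin k → ℤ))
    (W : OpExponent n r → ℝ) (d : ℕ) : Set (OpExponent n r) :=
  {e | ∃ P ∈ I, HasOrderLE d P ∧ IsTopExponent hkn shift S W P e}

/-- Finitely many elements of `I`, normalized to have leading coefficient `1`, account for the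
largest monomials of all elements of `I`, whatever their order. -/
lemma exists_finite_topExponents (I : Submodule (DiffOp n) (Fin r → DiffOp n))
    (S : AddSubmonoid (Fin k → ℤ)) (W : OpExponent n r → ℝ) :
    ∃ T : Set (ℕ × OpExponent n r), T.Finite ∧
      (∀ t ∈ T, ∃ P ∈ I, HasOrderLE t.1 P ∧ IsTopExponent hkn shift S W P t.2 ∧
        opCoeff P t.2 = 1) ∧
      ∀ d, ∀ e ∈ topExponents hkn shift I S W d, ∃ t ∈ T, t.2.2.2 = e.2.2 ∧ t.2.1 ≤ e.1 ∧
        t.2.2.1 ≤ e.2.1 ∧ t.1 + e.2.1.degree ≤ d + t.2.2.1.degree := by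
  obtain ⟨T, hTX, hTfin, hT⟩ := exists_finite_lower_family
    {x : ℕ × OpExponent n r | x.2 ∈ topExponents hkn shift I S W x.1}
    -- the last entry, a true difference, ensures that derivatives of the elements found have order
    -- at most `d` when their largest monomial is that of an operator of order at most `d`
    (fun x => (x.2.1, x.2.2.1, x.1 - x.2.2.1.degree)) (fun x => x.2.2.2) (Set.toFinite _)
  refine ⟨T, hTfin, fun t ht => ?_, fun d e he => ?_⟩
  · obtain ⟨P, hPI, hPd, hP⟩ := hTX ht
    have hc := inv_ne_zero hP.1
    have hiff : ∀ e, opCoeff ((opCoeff P t.2)⁻¹ • P) e ≠ 0 ↔ opCoeff P e ≠ 0 := by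
      intro e
      rw [opCoeff_smul]
      exact mul_ne_zero_iff.trans (and_iff_right hc)
    refine ⟨(opCoeff P t.2)⁻¹ • P, ?_, fun e he => hPd e ((hiff e).1 he),
      ⟨(hiff _).2 hP.1, fun e he => hP.2 e ((hiff e).1 he)⟩, ?_⟩
    · rw [← algebraMap_smul (DiffOp n)]
      exact I.smul_mem _ hPI
    · rw [opCoeff_smul, inv_mul_cancel₀ hP.1]
  · obtain ⟨t, ht, h1, h2⟩ := hT (d, e) he
    refine ⟨t, ht, h1, h2.1, h2.2.1, ?_⟩
    have h3 : t.1 - t.2.2.1.degree ≤ d - e.2.1.degree := h2.2.2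
    obtain ⟨P, -, hPd, hP⟩ := he
    obtain ⟨P', -, hPd', hP'⟩ := hTX ht
    have h4 := hPd _ hP.1
    have h5 := hPd' _ hP'.1
    omega

/-- If the largest monomial of an operator is taken with respect to a limit of semigroups `S j`,
then it is for almost all `j` also the leading one for a perturbed weight: up to multiplication by
monomials in `x`, only finitely many monomials have to be compared. The linear form `L j` is
positive on the elements of `S j` that are not invertible in it. -/
lemma IsTopExponent.eventually_isLeading {J : Type*} {𝒰 : Ultrafilter J}
    {S : J → AddSubmonoid (Fin k → ℤ)} {L : J → DualSpace k}
    (hLS : ∀ j, ∀ a ∈ S j, 0 ≤ evalLattice (L j) a)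
    (hLS' : ∀ j, ∀ a ∈ S j, evalLattice (L j) a = 0 → -a ∈ S j)
    (hS : ∀ j a, 0 ≤ a → a ∈ S j) (hL : ∀ j, L j ∈ positiveQuadrant k)
    {w v : Fin n → ℝ} {c : Fin r → ℝ} (hw : ∀ i, 0 < w i)
    {P : Fin r → DiffOp n} {e : OpExponent n r}
    (h : IsTopExponent hkn shift (limitSemigroup 𝒰 S) (linWeight w v c) P e)
    (h1 : opCoeff P e = 1) :
    ∀ᶠ j in 𝒰, ∀ᶠ N : ℝ in atTop, IsLeading hkn shift (S j)
      (linWeight (fun i => w i + N * formWeight hkn (L j) i)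
        (fun i => v i + N * formWeight hkn (L j) i)
        (fun j' => c j' + N * ((evalLattice (L j) (shift j') : ℚ) : ℝ))) P e := by
  obtain ⟨T, hTP, hTfin, hT⟩ := exists_finite_support_lower P
  have hev : ∀ᶠ j in 𝒰, ∀ t ∈ T, vOrder hkn shift e - vOrder hkn shift t ∈ S j ∧
      (vOrder hkn shift t - vOrder hkn shift e ∈ S j →
        vOrder hkn shift t - vOrder hkn shift e ∈ limitSemigroup 𝒰 S) := by
    rw [eventually_all_finite hTfin]
    intro t ht
    refine (h.2 t (hTP ht)).1.and ?_
    by_cases h2 : vOrder hkn shift t - vOrder hkn shift e ∈ limitSemigroup 𝒰 S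
    · exact Eventually.of_forall fun j _ => h2
    · exact (Ultrafilter.eventually_not.2 h2).mono fun j h3 h4 => absurd h4 h3
  refine hev.mono fun j hj => ?_
  -- monomials of equivalent orders are told apart by the weight, the others by `L j` for large `N`
  have hN : ∀ᶠ N : ℝ in atTop, 0 ≤ N ∧ ∀ t ∈ T, t ≠ e →
      linWeight w v c t + N * ((evalLattice (L j) (vOrder hkn shift t) : ℚ) : ℝ) <
        linWeight w v c e + N * ((evalLattice (L j) (vOrder hkn shift e) : ℚ) : ℝ) := by
    refine (eventually_ge_atTop 0).and ?_
    rw [eventually_all_finite hTfin]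
    intro t ht
    obtain ⟨h2, h3⟩ := hj t ht
    have h4 := hLS j _ h2
    rw [evalLattice_sub] at h4
    rcases h4.eq_or_lt with h5 | h5
    · have h6 := hLS' j _ h2 (by rw [evalLattice_sub]; exact h5.symm)
      rw [neg_sub] at h6
      refine Eventually.of_forall fun N hne => ?_
      have h7 := (h.2 t (hTP ht)).2 (h3 h6) hne
      rw [sub_eq_zero.1 h5.symm]
      linarith
    · have h6 : (0 : ℝ) < ((evalLattice (L j) (vOrder hkn shift e) : ℚ) : ℝ) -
          ((evalLattice (L j) (vOrder hkn shift t) : ℚ) : ℝ) := by exact_mod_cast h5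
      filter_upwards [(tendsto_id.atTop_mul_const h6).eventually_gt_atTop
        (linWeight w v c t - linWeight w v c e)] with N hN _
      simp only [id] at hN
      linarith
  refine hN.mono fun N hN => ⟨h1, fun e' he' => ?_, fun e' he' hne => ?_⟩
  · obtain ⟨t, ht, h2, h3⟩ := hT e' he'
    have h4 := (S j).add_mem (hj t ht).1 (hS j _ (sub_nonneg.2 (vOrder_le_of_le (hkn := hkn) (shift := shift) h3 h2)))
    rwa [sub_add_sub_cancel] at h4
  · obtain ⟨t, ht, h2, h3⟩ := hT e' he'
    have hw' : ∀ i, 0 < w i + N * formWeight hkn (L j) i := fun i =>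
      add_pos_of_pos_of_nonneg (hw i) (mul_nonneg hN.1 (formWeight_nonneg (hL j) i))
    by_cases hte : t = e
    · subst hte
      exact linWeight_lt_of_le hw' h3 h2 hne
    · refine (linWeight_le_of_le hw' h3 h2).trans_lt ?_
      rw [linWeight_add_form, linWeight_add_form]
      exact hN.2 t ht hte

/-- In a family of semigroups whose limit along an ultrafilter is a total preorder on `ℤᵏ`, there
is one for which normal forms exist: the finitely many elements of `I` needed to divide with
respect to the limit also serve for almost all members of the family. -/
lemma exists_hasNormalForms (I : Submodule (DiffOp n) (Fin r → DiffOp n)) {J : Type*}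
    (𝒰 : Ultrafilter J) {S : J → AddSubmonoid (Fin k → ℤ)} {L : J → DualSpace k}
    (hLS : ∀ j, ∀ a ∈ S j, 0 ≤ evalLattice (L j) a)
    (hLS' : ∀ j, ∀ a ∈ S j, evalLattice (L j) a = 0 → -a ∈ S j)
    (hS : ∀ j a, 0 ≤ a → a ∈ S j) (hL : ∀ j, L j ∈ positiveQuadrant k)
    (htot : ∀ a, ∀ᶠ j in 𝒰, a ∈ S j ∨ -a ∈ S j) :
    ∃ j, HasNormalForms hkn shift I (S j) := by
  obtain ⟨w, v, c, hw, hwv, hinj⟩ := exists_generic_linWeight n r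
  obtain ⟨T, hTfin, hTP, hT⟩ := exists_finite_topExponents (hkn := hkn) (shift := shift) I
    (limitSemigroup 𝒰 S) (linWeight w v c)
  choose! P hPI hPd hPtop hP1 using hTP
  have hev : ∀ᶠ j in 𝒰, ∀ t ∈ T, ∀ᶠ N : ℝ in atTop, IsLeading hkn shift (S j)
      (linWeight (fun i => w i + N * formWeight hkn (L j) i)
        (fun i => v i + N * formWeight hkn (L j) i)
        (fun j' => c j' + N * ((evalLattice (L j) (shift j') : ℚ) : ℝ))) (P t) t.2 := by
    rw [eventually_all_finite hTfin]
    exact fun t ht => (hPtop t ht).eventually_isLeading hLS hLS' hS hL hw (hP1 t ht)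
  obtain ⟨j, hj⟩ := hev.exists
  obtain ⟨N, hN, hN0⟩ :=
    (((eventually_all_finite hTfin).2 hj).and (eventually_ge_atTop 0)).exists
  refine ⟨j, fun d => ⟨topExponents hkn shift I (limitSemigroup 𝒰 S) (linWeight w v c) d,
    fun R hRI hRd hR => ?_, fun s Q hQ hQs => ?_⟩⟩
  · by_contra hne
    obtain ⟨e, he⟩ := exists_isTopExponent (hkn := hkn) (shift := shift)
      (S := limitSemigroup 𝒰 S) (fun a ha => Eventually.of_forall fun j => hS j a ha)
      (fun a => Ultrafilter.eventually_or.1 (htot a)) hw hinj hne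
    exact he.1 (hR e ⟨R, hRI, hRd, he⟩)
  · exact exists_normalForm
      (fun i => add_pos_of_pos_of_nonneg (hw i) (mul_nonneg hN0 (formWeight_nonneg (hL j) i)))
      (fun i => add_lt_add_left (hwv i) _) hTfin
      (fun t ht => ⟨P t, hPI t ht, hPd t ht, hN t ht⟩) (hT d) s hQ hQs

end Limits

/-! ### Adapted bases -/

section AdaptedBases

open MvPowerSeries

variable {n k r : ℕ}

open Classical in
/-- The part of `P` consisting of the monomials with exponents in `Y`. -/
noncomputable def restrictExponents (Y : Set (OpExponent n r)) (P : Fin r → DiffOp n) :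
    Fin r → DiffOp n := fun j =>
  DiffOp.coeffs.symm (Finsupp.onFinset (DiffOp.coeffs (P j)).support
    (fun β => ConvSeries.mk (fun α => if (α, β, j) ∈ Y then opCoeff P (α, β, j) else 0) (by
      obtain ⟨C, R, hC, hR, h⟩ := (DiffOp.coeffs (P j) β).2
      refine ⟨C, R, hC, hR, fun α => ?_⟩
      change ‖if (α, β, j) ∈ Y then opCoeff P (α, β, j) else 0‖ ≤ _
      split_ifs
      · exact h α
      · rw [norm_zero]
        positivity))
    fun β hβ => by
      rw [Finsupp.mem_support_iff]
      intro h0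
      refine hβ (toSeries_injective (MvPowerSeries.ext fun α => ?_))
      rw [map_zero, map_zero]
      change (if (α, β, j) ∈ Y then opCoeff P (α, β, j) else 0) = 0
      simp [opCoeff, h0])

open Classical in
lemma opCoeff_restrictExponents (Y : Set (OpExponent n r)) (P : Fin r → DiffOp n)
    (e : OpExponent n r) :
    opCoeff (restrictExponents Y P) e = if e ∈ Y then opCoeff P e else 0 := by
  rw [opCoeff, restrictExponents, LinearEquiv.apply_symm_apply, Finsupp.onFinset_apply]
  rfl

lemma opCoeff_sum {Λ : Type*} (s : Finset Λ) (P : Λ → Fin r → DiffOp n) (e : OpExponent n r) :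
    opCoeff (∑ l ∈ s, P l) e = ∑ l ∈ s, opCoeff (P l) e := by
  simp only [opCoeff, Finset.sum_apply, map_sum, Finsupp.finsetSum_apply]

lemma opCoeff_add (P Q : Fin r → DiffOp n) (e : OpExponent n r) :
    opCoeff (P + Q) e = opCoeff P e + opCoeff Q e := by
  simp [opCoeff]

/-- The operators with exponents in `Y`. -/
noncomputable def supportedIn (Y : Set (OpExponent n r)) : Submodule ℂ (Fin r → DiffOp n) where
  carrier := {P | ∀ e, opCoeff P e ≠ 0 → e ∈ Y}
  add_mem' {P Q} hP hQ e he := by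
    rw [opCoeff_add] at he
    by_cases h : opCoeff P e = 0
    · rw [h, zero_add] at he
      exact hQ e he
    · exact hP e h
  zero_mem' e he := absurd (opCoeff_zero e) he
  smul_mem' c P hP e he := by
    rw [opCoeff_smul] at he
    exact hP e (right_ne_zero_of_mul he)

lemma exists_vOrder_le (hkn : k ≤ n) (shift : Fin r → Fin k → ℤ) (d : ℕ) :
    ∃ B : Fin k → ℤ, ∀ e : OpExponent n r, e.2.1.degree ≤ d → vOrder hkn shift e ≤ B := by
  refine ⟨fun i => d + ∑ j, |shift j i|, fun e he i => ?_⟩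
  have h1 : (e.2.1 (Fin.castLE hkn i) : ℤ) ≤ d := by
    exact_mod_cast (Finsupp.le_degree _ _).trans he
  have h2 : shift e.2.2 i ≤ ∑ j, |shift j i| := (le_abs_self _).trans
    (Finset.single_le_sum (f := fun j => |shift j i|) (fun _ _ => abs_nonneg _)
      (Finset.mem_univ e.2.2))
  simp only [vOrder]
  have h3 : (0 : ℤ) ≤ e.1 (Fin.castLE hkn i) := Nat.cast_nonneg _
  linarith

/-- The exponents of bounded order in `∂` fall into finitely many classes, each containing an
exponent whose order in `ℤᵏ` is the largest one; the exponents of a class belong to the same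
steps, among finitely many given ones, of the filtration defined by the semigroup `S`. -/
lemma exists_exponent_classes (hkn : k ≤ n) (shift : Fin r → Fin k → ℤ)
    (S : AddSubmonoid (Fin k → ℤ)) (d : ℕ) {A : Set (Fin k → ℤ)} (hA : A.Finite) :
    ∃ T : Set (OpExponent n r), T.Finite ∧ ∀ e : OpExponent n r, e.2.1.degree ≤ d →
      ∃ t ∈ T, vOrder hkn shift e ≤ vOrder hkn shift t ∧
        ∀ s ∈ A, s - vOrder hkn shift e ∈ S → s - vOrder hkn shift t ∈ S := by
  obtain ⟨B, hB⟩ := exists_vOrder_le hkn shift d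
  -- Dickson's lemma for the differences to a common bound of the orders
  obtain ⟨T, hTX, hTfin, hT⟩ := exists_finite_lower_family
    {e : OpExponent n r | e.2.1.degree ≤ d}
    (fun e i => (B i - vOrder hkn shift e i).toNat)
    (fun e => {s ∈ A | s - vOrder hkn shift e ∈ S})
    (hA.finite_subsets.subset (by rintro _ ⟨e, -, rfl⟩; exact Set.sep_subset _ _))
  refine ⟨T, hTfin, fun e he => ?_⟩
  obtain ⟨t, ht, h1, h2⟩ := hT e he
  refine ⟨t, ht, fun i => ?_, fun s hs hse => ?_⟩
  · have h3 : (B i - vOrder hkn shift t i).toNat ≤ (B i - vOrder hkn shift e i).toNat := h2 i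
    have h4 : vOrder hkn shift e i ≤ B i := hB e he i
    have h5 : vOrder hkn shift t i ≤ B i := hB t (hTX ht) i
    change vOrder hkn shift e i ≤ vOrder hkn shift t i
    omega
  · have : s ∈ {s ∈ A | s - vOrder hkn shift t ∈ S} := by
      rw [h1]
      exact ⟨hs, hse⟩
    exact this.2

variable {M : Type*} [AddCommGroup M] [Module (DiffOp n) M] [Module ℂ M]
  [IsScalarTower ℂ (DiffOp n) M]

/-- If `π` is injective on the normal forms `N`, the images of independent families of normal forms
are jointly independent when these families have disjoint sets `Y t` of exponents. -/
lemma linearIndependent_of_normalForms (π : (Fin r → DiffOp n) →ₗ[DiffOp n] M)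
    {N : Set (Fin r → DiffOp n)} (hN : ∀ R ∈ N, π R = 0 → R = 0)
    {T : Type*} [Fintype T] {Y : T → Set (OpExponent n r)} {Z : Submodule ℂ (Fin r → DiffOp n)}
    (hZ : (Z : Set _) ⊆ N) (hY : ∀ t t' e, e ∈ Y t → e ∈ Y t' → t = t') {B : T → Type*}
    [∀ t, Fintype (B t)] (b : ∀ t, B t → Fin r → DiffOp n) (hb : ∀ t, LinearIndependent ℂ (b t))
    (hbY : ∀ t i, b t i ∈ supportedIn (Y t)) (hbZ : ∀ t i, b t i ∈ Z) :
    LinearIndependent ℂ fun x : Σ t, B t => π (b x.1 x.2) := by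
  rw [Fintype.linearIndependent_iff]
  intro g hg
  have h1 : ∑ x : Σ t, B t, g x • b x.1 x.2 = 0 := by
    refine hN _ (hZ (Submodule.sum_mem _ fun x _ => Z.smul_mem _ (hbZ _ _))) ?_
    rw [← hg, map_sum]
    exact Finset.sum_congr rfl fun x _ => (π.restrictScalars ℂ).map_smul _ _
  rw [Fintype.sum_sigma] at h1
  have h2 : ∀ t, ∑ i, g ⟨t, i⟩ • b t i ∈ supportedIn (Y t) := fun t =>
    Submodule.sum_mem _ fun i _ => Submodule.smul_mem _ _ (hbY t i)
  rintro ⟨t, i⟩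
  refine Fintype.linearIndependent_iff.1 (hb t) (fun i => g ⟨t, i⟩) (opCoeff_ext fun e => ?_) i
  rw [opCoeff_zero]
  by_contra he
  have h3 := congrArg (fun P => opCoeff P e) h1
  simp only [opCoeff_sum, opCoeff_zero] at h3
  rw [Fintype.sum_eq_single t] at h3
  · rw [opCoeff_sum] at he
    exact he h3
  · intro t' ht'
    rw [← opCoeff_sum]
    by_contra he'
    exact ht' (hY _ _ e (h2 t' e he') (h2 t e he))

/-- Normal forms give adapted bases: finitely many elements of steps of the filtration of `M`
defined by `S` are combinations of linearly independent elements of the multifiltration, of orders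
compatible with theirs. -/
lemma exists_adapted_of_hasNormalForms {hkn : k ≤ n} {shift : Fin r → Fin k → ℤ}
    {S : AddSubmonoid (Fin k → ℤ)} (π : (Fin r → DiffOp n) →ₗ[DiffOp n] M)
    (hNF : HasNormalForms hkn shift (LinearMap.ker π) S) (X : Finset ((Fin k → ℤ) × M))
    (hX : ∀ x ∈ X, x.2 ∈ (supportedIn {e | x.1 - vOrder hkn shift e ∈ S}).map
      (π.restrictScalars ℂ)) :
    ∃ (J : Type) (_ : Fintype J) (v : J → M) (t : J → Fin k → ℤ), LinearIndependent ℂ v ∧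
      (∀ j, v j ∈ (shiftedMultiV hkn shift (t j)).map (π.restrictScalars ℂ)) ∧
      ∀ x ∈ X, x.2 ∈ Submodule.span ℂ (v '' {j | x.1 - t j ∈ S}) := by
  classical
  choose! P hPX hP using hX
  choose d₀ hd₀ using fun x => exists_hasOrderLE (P x)
  set d := X.sup d₀
  obtain ⟨Δ, hΔ, hnf⟩ := hNF d
  have hR : ∀ x ∈ X, ∃ R, HasOrderLE d R ∧ P x - R ∈ LinearMap.ker π ∧
      (∀ e ∈ Δ, opCoeff R e = 0) ∧ ∀ e, opCoeff R e ≠ 0 → x.1 - vOrder hkn shift e ∈ S :=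
    fun x hx => hnf x.1 (P x) ((hd₀ x).mono (Finset.le_sup hx)) (hPX x hx)
  choose! R hRd hRP hRΔ hRS using hR
  obtain ⟨T, hTfin, hT⟩ := exists_exponent_classes hkn shift S d
    ((X.image Prod.fst).finite_toSet)
  choose! τ hτT hτle hτS using hT
  have : Fintype T := hTfin.fintype
  -- the class of an exponent `e` is `τ e`
  set Y : T → Set (OpExponent n r) := fun t => {e | e.2.1.degree ≤ d ∧ τ e = t} with hYdef
  set Z : Submodule ℂ (Fin r → DiffOp n) := supportedIn {e | e.2.1.degree ≤ d ∧ e ∉ Δ} with hZdef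
  -- the parts with exponents in the various classes of the normal forms of the given elements
  set W : T → Submodule ℂ (Fin r → DiffOp n) := fun t =>
    Submodule.span ℂ ((fun x => restrictExponents (Y t) (R x)) '' X) with hWdef
  have hWfin : ∀ t, Module.Finite ℂ (W t) := fun t =>
    Module.Finite.span_of_finite ℂ (X.finite_toSet.image _)
  have hWY : ∀ t, W t ≤ supportedIn (Y t) := by
    intro t
    refine Submodule.span_le.2 ?_
    rintro _ ⟨x, -, rfl⟩ e he
    rw [opCoeff_restrictExponents] at he
    by_contra h
    exact he (if_neg h)
  have hWZ : ∀ t, W t ≤ Z := by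
    intro t
    refine Submodule.span_le.2 ?_
    rintro _ ⟨x, hx, rfl⟩ e he
    rw [opCoeff_restrictExponents] at he
    split_ifs at he
    · exact ⟨hRd x hx e he, fun h => he (hRΔ x hx e h)⟩
    · exact absurd rfl he
  refine ⟨Σ t : T, Fin (Module.finrank ℂ (W t)), inferInstance,
    fun x => π (Module.finBasis ℂ (W x.1) x.2), fun x => vOrder hkn shift x.1, ?_, ?_, ?_⟩
  · refine linearIndependent_of_normalForms π (N := Z) (fun Q hQ h0 => ?_) (Y := Y) (Z := Z)
      subset_rfl (fun t t' e h h' => Subtype.ext (h.2.symm.trans h'.2))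
      (fun t i => (Module.finBasis ℂ (W t) i : Fin r → DiffOp n)) (fun t => ?_)
      (fun t i => hWY t (Subtype.mem _)) (fun t i => hWZ t (Subtype.mem _))
    · refine hΔ Q h0 (fun e he => (hQ e he).1) fun e he => ?_
      by_contra h
      exact (hQ e h).2 he
    · exact (Module.finBasis ℂ (W t)).linearIndependent.map' (W t).subtype
        (Submodule.ker_subtype _)
  · rintro ⟨t, i⟩
    refine ⟨_, mem_shiftedMultiV_iff.2 fun e he => ?_, rfl⟩
    obtain ⟨h1, h2⟩ := hWY t (Subtype.mem _) e he
    change vOrder hkn shift e ≤ vOrder hkn shift (t : OpExponent n r)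
    rw [← h2]
    exact hτle e h1
  · intro x hx
    have h1 : x.2 = π (R x) := by
      rw [← hP x hx, ← sub_eq_zero]
      simpa using hRP x hx
    have h2 : R x = ∑ t : T, restrictExponents (Y t) (R x) := by
      refine opCoeff_ext fun e => ?_
      rw [opCoeff_sum]
      by_cases he : opCoeff (R x) e = 0
      · rw [he, Finset.sum_eq_zero]
        intro t _
        rw [opCoeff_restrictExponents, he, ite_self]
      · have hed := hRd x hx e he
        rw [Fintype.sum_eq_single ⟨τ e, hτT e hed⟩]
        · rw [opCoeff_restrictExponents, if_pos ⟨hed, rfl⟩]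
        · intro t ht
          rw [opCoeff_restrictExponents, if_neg]
          exact fun h => ht (Subtype.ext h.2.symm)
    rw [h1, h2, map_sum]
    refine Submodule.sum_mem _ fun t _ => ?_
    by_cases h0 : restrictExponents (Y t) (R x) = 0
    · rw [h0, map_zero]
      exact zero_mem _
    · obtain ⟨e, he⟩ : ∃ e, opCoeff (restrictExponents (Y t) (R x)) e ≠ 0 := by
        by_contra hcon
        push Not at hcon
        exact h0 (opCoeff_ext fun e => by rw [hcon, opCoeff_zero])
      rw [opCoeff_restrictExponents] at he
      split_ifs at he with heY
      · have h3 : x.1 - vOrder hkn shift t ∈ S := by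
          rw [← heY.2]
          exact hτS e heY.1 _ (by simpa using ⟨x.2, hx⟩) (hRS x hx e he)
        have h4 : restrictExponents (Y t) (R x) ∈ W t := Submodule.subset_span ⟨x, hx, rfl⟩
        have h5 := (Module.finBasis ℂ (W t)).sum_repr ⟨_, h4⟩
        have h6 := congrArg (fun Q : W t => π (Q : Fin r → DiffOp n)) h5
        simp only [Submodule.coe_sum, Submodule.coe_smul, map_sum] at h6
        rw [← h6]
        refine Submodule.sum_mem _ fun i _ => ?_
        rw [show π ((Module.finBasis ℂ (W t)).repr ⟨_, h4⟩ i •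
          (Module.finBasis ℂ (W t) i : Fin r → DiffOp n)) = _ from
          (π.restrictScalars ℂ).map_smul _ _]
        exact Submodule.smul_mem _ _ (Submodule.subset_span ⟨⟨t, i⟩, h3, rfl⟩)
      · exact absurd rfl he

end AdaptedBases

/-! ### Flatness for all cones of a sufficiently fine fan -/

section Flatness

open Filter

variable {n k r : ℕ}

/-- The `Γ`-filtration of `M` is induced by the filtration of `𝒟ʳ` defined by the semigroup
`Γ̌ ∩ ℤᵏ`. -/
lemma coneFiltration_le_map {M : Type*} [AddCommGroup M] [Module (DiffOp n) M] [Module ℂ M]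
    [IsScalarTower ℂ (DiffOp n) M] {hkn : k ≤ n} {shift : Fin r → Fin k → ℤ}
    (π : (Fin r → DiffOp n) →ₗ[DiffOp n] M) {U : (Fin k → ℤ) → Submodule ℂ M}
    (hU : ∀ s, U s = (shiftedMultiV hkn shift s).map (π.restrictScalars ℂ))
    {σ : Finset (DualSpace k)} (hσ : LinearIndepOn ℚ id (σ : Set (DualSpace k)))
    (hpos : ∀ v ∈ σ, v ∈ positiveQuadrant k) (s : Fin k → ℤ) :
    coneFiltration U (PointedCone.hull ℚ (σ : Set (DualSpace k))) s ≤
      (supportedIn {e | s - vOrder hkn shift e ∈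
        dualLattice (PointedCone.hull ℚ (σ : Set (DualSpace k)))}).map (π.restrictScalars ℂ) := by
  refine iSup₂_le fun t ht => ?_
  rw [hU]
  refine Submodule.map_mono fun P hP e he => ?_
  have h1 : s - t ∈ dualLattice (PointedCone.hull ℚ (σ : Set (DualSpace k))) := by
    refine mem_dualLattice_of_primitiveGenerators hσ fun L hL => ?_
    rw [evalLattice_sub, sub_nonneg]
    exact ht L hL
  have h2 : t - vOrder hkn shift e ∈
      dualLattice (PointedCone.hull ℚ (σ : Set (DualSpace k))) :=
    mem_dualLattice_hull.2 fun v hv =>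
      evalLattice_nonneg (hpos v hv) (sub_nonneg.2 (mem_shiftedMultiV_iff.1 hP e he))
  have h3 := AddSubmonoid.add_mem _ h1 h2
  rwa [sub_add_sub_cancel] at h3

lemma flat_reesModule_of_hasNormalForms {M : Type*} [AddCommGroup M] [Module (DiffOp n) M]
    [Module ℂ M] [IsScalarTower ℂ (DiffOp n) M] {hkn : k ≤ n} {shift : Fin r → Fin k → ℤ}
    (π : (Fin r → DiffOp n) →ₗ[DiffOp n] M) {U : (Fin k → ℤ) → Submodule ℂ M}
    (hU : ∀ s, U s = (shiftedMultiV hkn shift s).map (π.restrictScalars ℂ))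
    {σ : Finset (DualSpace k)} (hσ : LinearIndepOn ℚ id (σ : Set (DualSpace k)))
    (hpos : ∀ v ∈ σ, v ∈ positiveQuadrant k)
    (hNF : HasNormalForms hkn shift (LinearMap.ker π)
      (dualLattice (PointedCone.hull ℚ (σ : Set (DualSpace k))))) :
    Module.Flat (conicalAlgebra (PointedCone.hull ℚ (σ : Set (DualSpace k))))
      (reesModule U (PointedCone.hull ℚ (σ : Set (DualSpace k)))) := by
  refine flat_reesModule_of_adapted U _ fun X hX => ?_
  obtain ⟨J, hJ, v, t, hv, hvt, hvX⟩ := exists_adapted_of_hasNormalForms π hNF X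
    fun x hx => coneFiltration_le_map π hU hσ hpos _ (hX x hx)
  refine ⟨J, hJ, v, t, hv, fun j => ?_, hvX⟩
  have h1 := hvt j
  rw [← hU] at h1
  exact Submodule.mem_iSup_of_mem (t j) (Submodule.mem_iSup_of_mem (fun L _ => le_rfl) h1)

lemma mem_complexSupport_of_mem {V : Type*} [AddCommGroup V] [Module ℚ V] {K : Set (Finset V)}
    (hK : IsConeComplex K) {σ : Finset V} (hσ : σ ∈ K) {v : V} (hv : v ∈ σ) :
    v ∈ complexSupport K := by
  classical
  refine ⟨Finsupp.single v 1, fun u => ?_, hK.subset_mem σ hσ _ ?_, ?_⟩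
  · rw [Finsupp.single_apply]
    split_ifs <;> norm_num
  · rw [Finsupp.support_single _ one_ne_zero]
    simpa using hv
  · simp

lemma evalLattice_sum (σ : Finset (DualSpace k)) (a : Fin k → ℤ) :
    evalLattice (∑ v ∈ σ, v) a = ∑ v ∈ σ, evalLattice v a :=
  map_sum (evalAt a) id σ

/-- The complexes cut by more and more lattice points have, sooner or later, only cones for which
normal forms exist: otherwise exceptional cones would converge, along an ultrafilter, to a total
preorder on `ℤᵏ`. -/
lemma exists_complex_hasNormalForms {hkn : k ≤ n} {shift : Fin r → Fin k → ℤ}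
    (I : Submodule (DiffOp n) (Fin r → DiffOp n)) :
    ∃ K : Set (Finset (DualSpace k)), IsConeComplex K ∧ complexSupport K = positiveQuadrant k ∧
      ∀ σ ∈ K, HasNormalForms hkn shift I
        (dualLattice (PointedCone.hull ℚ (σ : Set (DualSpace k)))) := by
  classical
  by_contra hcon
  push Not at hcon
  obtain ⟨K₀, hK₀, hsupp₀⟩ := exists_quadrant_complex k
  choose K hK hsupp hcut using fun F : Finset (Fin k → ℤ) => exists_cut_finset hK₀ F evalAt
  choose σ hσK hσ using fun F => hcon (K F) (hK F) ((hsupp F).trans hsupp₀)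
  have hpos : ∀ F, ∀ v ∈ σ F, v ∈ positiveQuadrant k := fun F v hv => by
    rw [← hsupp₀, ← hsupp F]
    exact mem_complexSupport_of_mem (hK F) (hσK F) hv
  have hmem : ∀ F a, a ∈ dualLattice (PointedCone.hull ℚ (σ F : Set (DualSpace k))) ↔
      ∀ v ∈ σ F, 0 ≤ evalLattice v a := fun F a => mem_dualLattice_hull
  -- the sum of the generators is positive on the elements of the dual cone that are not invertible
  obtain ⟨F, hF⟩ := exists_hasNormalForms (hkn := hkn) (shift := shift) I
    (Ultrafilter.of (atTop : Filter (Finset (Fin k → ℤ))))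
    (S := fun F => dualLattice (PointedCone.hull ℚ (σ F : Set (DualSpace k))))
    (L := fun F => ∑ v ∈ σ F, v)
    (fun F a ha => by
      rw [evalLattice_sum]
      exact Finset.sum_nonneg ((hmem F a).1 ha))
    (fun F a ha h0 => by
      rw [evalLattice_sum, Finset.sum_eq_zero_iff_of_nonneg ((hmem F a).1 ha)] at h0
      refine (hmem F _).2 fun v hv => ?_
      rw [evalLattice_neg, h0 v hv, neg_zero])
    (fun F a ha => (hmem F a).2 fun v hv => evalLattice_nonneg (hpos F v hv) ha)
    (fun F i => by
      rw [LinearMap.sum_apply]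
      exact Finset.sum_nonneg fun v hv => hpos F v hv i)
    -- once the complex is cut by `a`, either `a` or `-a` belongs to the dual of each of its cones
    (fun a => by
      refine Ultrafilter.of_le atTop ((eventually_ge_atTop {a}).mono fun F hF => ?_)
      rcases hcut F a (hF (Finset.mem_singleton_self a)) _ (hσK F) with h | h
      · exact Or.inl ((hmem F a).2 h)
      · refine Or.inr ((hmem F _).2 fun v hv => ?_)
        rw [evalLattice_neg]
        exact neg_nonneg.2 (h v hv))
  exact hσ F hF

end Flatness

theorem mainTheorem2 (n k : ℕ) (hk : 1 ≤ k) (hkn : k ≤ n)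
    {M : Type*} [AddCommGroup M] [Module (DiffOp n) M] [Module ℂ M]
    [IsScalarTower ℂ (DiffOp n) M]
    (U : (Fin k → ℤ) → Submodule ℂ M) (hU : IsGoodMultifiltration hkn U) :
    ∃ E : Set (PointedCone ℚ (DualSpace k)),
      IsSimplicialFan E ∧ fanSupport E = positiveQuadrant k ∧
        ∀ Γ ∈ E, Module.Flat (conicalAlgebra Γ) (reesModule U Γ) := by
  obtain ⟨r, π, shift, -, hU⟩ := hU
  obtain ⟨K, hK, hsupp, hNF⟩ :=
    exists_complex_hasNormalForms (hkn := hkn) (shift := shift) (LinearMap.ker π)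
  refine ⟨fanOfComplex K, isSimplicialFan_fanOfComplex hK,
    (fanSupport_fanOfComplex hK).trans hsupp, ?_⟩
  rintro _ ⟨σ, hσ, rfl⟩
  refine flat_reesModule_of_hasNormalForms π hU (hK.linearIndepOn hσ) (fun v hv => ?_) (hNF σ hσ)
  rw [← hsupp]
  exact mem_complexSupport_of_mem hK hσ hv
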